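/- **Definitions.** Let $k\ge 3$, let $d$ be a positive integer, $\alpha=d/k$, and $\lambda\in[0,1]$; powers $x^\lambda$ use the convention $0^0=0$. For a discrete probability measure $\mu$ on $[0,1]$ let $\hat{\mathscr R}_\lambda\mu$ and $\dot{\mathscr R}_\lambda\mu$ be the probability measures proportional to $$B\mapsto\int\Big(2-\prod_{i=1}^{k-1}x_i-\prod_{i=1}^{k-1}(1-x_i)\Big)^{\lambda}\mathbf 1\Big\{\tfrac{1-\prod_{i=1}^{k-1} x_i}{2-\prod_{i=1}^{k-1} x_i-\prod_{i=1}^{k-1}(1-x_i)}\in B\Big\}\prod_{i=1}^{k-1}\mu(dx_i),$$ $$B\mapsto\int\Big(\prod_{i=1}^{d-1}y_i+\prod_{i=1}^{d-1}(1-y_i)\Big)^{\lambda}\mathbf 1\Big\{\tfrac{\prod_{i=1}^{d-1} y_i}{\prod_{i=1}^{d-1} y_i+\prod_{i=1}^{d-1}(1-y_i)}\in B\Big\}\prod_{i=1}^{d-1}\mu(dy_i).$$ Put $\dot\mu_{\lambda,0}=\frac12\delta_0+\frac12\delta_1$, $\dot\mu_{\lambda,l+1}=\dot{\mathscr R}_\lambda\hat{\mathscr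 R}_\lambda\dot\mu_{\lambda,l}$ for $l\ge0$, let $\dot\mu_\lambda$ be the limit of $\dot\mu_{\lambda,l}$ in $\ell^1$ as $l\to\infty$, and $\hat\mu_\lambda=\hat{\mathscr R}_\lambda\dot\mu_\lambda$. Let $$\dot g(y)=\prod_{i=1}^d y_i+\prod_{i=1}^d(1-y_i),\qquad \hat g(x)=1-\prod_{i=1}^k x_i-\prod_{i=1}^k(1-x_i),\qquad \bar g(x,y)=xy+(1-x)(1-y),$$ let $\dot{\mathfrak Z}_\lambda,\hat{\mathfrak Z}_\lambda,\bar{\mathfrak Z}_\lambda$ be the integrals of $\dot g^\lambda,\hat g^\lambda,\bar g^\lambda$ against $\hat\mu_\lambda^{\otimes d}$, $\dot\mu_\lambda^{\otimes k}$, $\dot\mu_\lambda\otimes\hat\mu_\lambda$ respectively, and let $\dot w_\lambda,\hat w_\lambda,\bar w_\lambda$ be the laws of $\dot g,\hat g,\bar g$ under these product measures reweighted by $\dot g^\lambda/\dot{\mathfrak Z}_\lambda$, $\hat g^\lambda/\hat{\mathfrak Z}_\lambda$, $\bar g^\lambda/\bar{\mathfrak Z}_\lambda$. Define $$\mathfrak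 F(\lambda;\alpha)=\log\dot{\mathfrak Z}_\lambda+\alpha\log\hat{\mathfrak Z}_\lambda-k\alpha\log\bar{\mathfrak Z}_\lambda,\qquad s_\lambda(\alpha)=\int\log x\,\dot w_\lambda(dx)+\alpha\int\log x\,\hat w_\lambda(dx)-k\alpha\int\log x\,\bar w_\lambda(dx),$$ $$\Sigma(s_\lambda;\alpha)=\mathfrak F(\lambda;\alpha)-\lambda s_\lambda(\alpha),\qquad A=A_k=\big[(2^{k-1}-2)\log2,\;2^{k-1}\log2\big]\cap k^{-1}\mathbb Z,$$ $$\alpha_{\rm cond}=\sup\{\alpha\in A:\Sigma(s_1;\alpha)>0\},\qquad \alpha_{\rm sat}=\sup\{\alpha\in A:\Sigma(s_0;\alpha)>0\}.$$ **Proposition.** There are absolute constants $k_0$ and $C$ such that the following holds for every $k\ge k_0$. 1. For all $\lambda\in[0,1]$ and $\alpha\in A$ (with $d=k\alpha$) the objects above are well defined: the $\ell^1$ limit $\dot\mu_\lambda$ exists and is a probability measure, the normalizations are by finite positive constants, and the integrals in $s_\lambda(\alpha)$ converge absolutely. For every $\lambda\in[0,1]$, the function $\alpha\mapsto\Sigma(s_\lambda;\alpha)$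 is strictly decreasing on $A$, and there is a unique $\alpha_\lambda\in A$ such that, for $\alpha\in A$, $\Sigma(s_\lambda;\alpha)\ge0$ if $\alpha\le\alpha_\lambda$ and $\Sigma(s_\lambda;\alpha)<0$ if $\alpha>\alpha_\lambda$. 2. $\alpha_{\rm cond}=\alpha_1$, except that $\alpha_{\rm cond}=\alpha_1-\frac1k$ in case $\Sigma(s_1;\alpha_1)$ is exactly $0$. With $t=(2^{k-1}-1)\log2$, both $\alpha_1$ and $\alpha_{\rm cond}$ lie in $\big[t-\frac1k-\frac{k^{C}}{2^k},\;t+\frac{k^{C}}{2^k}\big]$. That is, they agree with $(2^{k-1}-1)\log 2$ up to rounding down to a multiple of $1/k$ and an error $k^{O(1)}/2^k$. 3. $\alpha_{\rm sat}=\alpha_0$, except that $\alpha_{\rm sat}=\alpha_0-\frac1k$ in case $\Sigma(s_0;\alpha_0)$ is exactly $0$. With $t=\big(2^{k-1}-\frac12-\frac1{4\log2}\big)\log2$, both $\alpha_0$ and $\alpha_{\rm sat}$ lie in $\big[t-\frac1k-\frac{k^{C}}{2^k},\;t+\frac{k^{C}}{2^k}\big]$. -/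

import Mathlib

open Set Filter Topology MeasureTheory
open scoped ENNReal

noncomputable section

namespace NAESat

/-- The weight `x ^ lam`, with the convention that `0 ^ 0 = 0` (so that `0` always has weight `0`). -/
def weight (lam x : ℝ) : ℝ≥0∞ := if x = 0 then 0 else ENNReal.ofReal (x ^ lam)

/-- The normalizing constant `∫ g ^ lam dν`. -/
def tiltedMass {Ω : Type*} [MeasurableSpace Ω] (ν : Measure Ω) (lam : ℝ) (g : Ω → ℝ) : ℝ≥0∞ :=
  ∫⁻ ω, weight lam (g ω) ∂ν

/-- The law `B ↦ (∫ g ^ lam dν)⁻¹ * ∫ g ^ lam * 1{f ∈ B} dν`. -/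
def tiltedLaw {Ω : Type*} [MeasurableSpace Ω] (ν : Measure Ω) (lam : ℝ) (g f : Ω → ℝ) :
    Measure ℝ :=
  (tiltedMass ν lam g)⁻¹ • (ν.withDensity fun ω => weight lam (g ω)).map f

/-- The product measure `μ ⊗ ⋯ ⊗ μ` with `n` factors. -/
def power (n : ℕ) (μ : Measure ℝ) : Measure (Fin n → ℝ) := Measure.pi fun _ => μ

/-- `∏ x_i + ∏ (1 - x_i)`. -/
def agree {n : ℕ} (x : Fin n → ℝ) : ℝ := ∏ i, x i + ∏ i, (1 - x i)

/-- The clause recursion. -/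
def clauseRec (k : ℕ) (lam : ℝ) (μ : Measure ℝ) : Measure ℝ :=
  tiltedLaw (power (k - 1) μ) lam (fun x => 2 - agree x)
    (fun x => (1 - ∏ i, x i) / (2 - agree x))

/-- The variable recursion. -/
def varRec (d : ℕ) (lam : ℝ) (μ : Measure ℝ) : Measure ℝ :=
  tiltedLaw (power (d - 1) μ) lam agree (fun y => (∏ i, y i) / agree y)

/-- The sequence of laws `μ_l`, started from the uniform law on `{0, 1}`. -/
def iterLaw (k d : ℕ) (lam : ℝ) : ℕ → Measure ℝ
  | 0 => (2 : ℝ≥0∞)⁻¹ • Measure.dirac 0 + (2 : ℝ≥0∞)⁻¹ • Measure.dirac 1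
  | l + 1 => varRec d lam (clauseRec k lam (iterLaw k d lam l))

/-- The limiting discrete law of the variable messages: its atom at `x` is the limit of the
atoms at `x` of the laws `μ_l`. -/
def varLaw (k d : ℕ) (lam : ℝ) : Measure ℝ :=
  Measure.sum fun x : ℝ => limUnder atTop (fun l => iterLaw k d lam l {x}) • Measure.dirac x

/-- The corresponding law of the clause messages. -/
def clauseLaw (k d : ℕ) (lam : ℝ) : Measure ℝ := clauseRec k lam (varLaw k d lam)

/-- `x y + (1 - x) (1 - y)`. -/
def edgeAgree (p : ℝ × ℝ) : ℝ := p.1 * p.2 + (1 - p.1) * (1 - p.2)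

/-- The normalizing constant for a variable. -/
def varZ (k d : ℕ) (lam : ℝ) : ℝ≥0∞ := tiltedMass (power d (clauseLaw k d lam)) lam agree

/-- The normalizing constant for a clause. -/
def clauseZ (k d : ℕ) (lam : ℝ) : ℝ≥0∞ :=
  tiltedMass (power k (varLaw k d lam)) lam (fun x => 1 - agree x)

/-- The normalizing constant for an edge. -/
def edgeZ (k d : ℕ) (lam : ℝ) : ℝ≥0∞ :=
  tiltedMass ((varLaw k d lam).prod (clauseLaw k d lam)) lam edgeAgree

/-- The tilted law at a variable. -/
def varW (k d : ℕ) (lam : ℝ) : Measure ℝ :=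
  tiltedLaw (power d (clauseLaw k d lam)) lam agree agree

/-- The tilted law at a clause. -/
def clauseW (k d : ℕ) (lam : ℝ) : Measure ℝ :=
  tiltedLaw (power k (varLaw k d lam)) lam (fun x => 1 - agree x) (fun x => 1 - agree x)

/-- The tilted law at an edge. -/
def edgeW (k d : ℕ) (lam : ℝ) : Measure ℝ :=
  tiltedLaw ((varLaw k d lam).prod (clauseLaw k d lam)) lam edgeAgree edgeAgree

/-- All the limits, normalizations and integrals in the definitions of the one-step
replica-symmetry-breaking quantities below are genuine: the laws `μ_l` converge in `ℓ¹` to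
the probability law `varLaw`, the laws derived from it are well-normalized, and `log` is
integrable against the three tilted laws. -/
structure WellDefined (k d : ℕ) (lam : ℝ) : Prop where
  iter_prob : ∀ l, IsProbabilityMeasure (iterLaw k d lam l)
  var_prob : IsProbabilityMeasure (varLaw k d lam)
  tendsto : Tendsto
    (fun l => ∑' x : ℝ, ENNReal.ofReal |(iterLaw k d lam l).real {x} - (varLaw k d lam).real {x}|)
    atTop (𝓝 0)
  clause_prob : IsProbabilityMeasure (clauseLaw k d lam)
  varW_prob : IsProbabilityMeasure (varW k d lam)
  clauseW_prob : IsProbabilityMeasure (clauseW k d lam)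
  edgeW_prob : IsProbabilityMeasure (edgeW k d lam)
  varW_int : Integrable Real.log (varW k d lam)
  clauseW_int : Integrable Real.log (clauseW k d lam)
  edgeW_int : Integrable Real.log (edgeW k d lam)

/-- The variable degree `d = k α`, for `α` a non-negative multiple of `1 / k`. -/
def deg (k : ℕ) (α : ℝ) : ℕ := ⌊(k : ℝ) * α⌋₊

/-- The free energy `𝔉(lam; α)` of the auxiliary model. -/
def freeEnergy (k : ℕ) (lam α : ℝ) : ℝ :=
  Real.log (varZ k (deg k α) lam).toReal + α * Real.log (clauseZ k (deg k α) lam).toReal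
    - k * α * Real.log (edgeZ k (deg k α) lam).toReal

/-- The cluster size exponent `s_lam(α)`. -/
def clusterSize (k : ℕ) (lam α : ℝ) : ℝ :=
  ∫ x, Real.log x ∂(varW k (deg k α) lam) + α * ∫ x, Real.log x ∂(clauseW k (deg k α) lam)
    - k * α * ∫ x, Real.log x ∂(edgeW k (deg k α) lam)

/-- The cluster complexity `Σ(s_lam; α) = 𝔉(lam; α) - lam * s_lam(α)`. -/
def complexity (k : ℕ) (lam α : ℝ) : ℝ := freeEnergy k lam α - lam * clusterSize k lam α

/-- The set `A` of multiples of `1 / k` in `[(2 ^ (k-1) - 2) log 2, 2 ^ (k-1) log 2]`. -/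
def densities (k : ℕ) : Set ℝ :=
  Icc (((2 : ℝ) ^ (k - 1) - 2) * Real.log 2) ((2 : ℝ) ^ (k - 1) * Real.log 2) ∩
    {α | ∃ m : ℤ, α = m / k}

/-- `a` is the sign-change point of the complexity on `A`. -/
def IsSignChange (k : ℕ) (lam a : ℝ) : Prop :=
  a ∈ densities k ∧
    (∀ α ∈ densities k, α ≤ a → 0 ≤ complexity k lam α) ∧
    (∀ α ∈ densities k, a < α → complexity k lam α < 0)

/-- The condensation threshold `sup {α ∈ A : Σ(s_1; α) > 0}`. -/
def alphaCond (k : ℕ) : ℝ := sSup {α ∈ densities k | 0 < complexity k 1 α}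

/-- The satisfiability threshold `sup {α ∈ A : Σ(s_0; α) > 0}`. -/
def alphaSat (k : ℕ) : ℝ := sSup {α ∈ densities k | 0 < complexity k 0 α}

/-- `a` equals `t` up to rounding down to a multiple of `1 / k` and an error `k ^ C / 2 ^ k`. -/
def RoundsDownTo (k C : ℕ) (t a : ℝ) : Prop :=
  t - 1 / k - (k : ℝ) ^ C / 2 ^ k ≤ a ∧ a ≤ t + (k : ℝ) ^ C / 2 ^ k

end NAESat

end

namespace NAESat

section Power

variable {μ ν : Measure ℝ} [IsFiniteMeasure μ] [IsFiniteMeasure ν] {n : ℕ}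

instance : IsFiniteMeasure (power n μ) := by unfold power; infer_instance

instance (μ : Measure ℝ) [IsProbabilityMeasure μ] : IsProbabilityMeasure (power n μ) := by
  unfold power; infer_instance

lemma lintegral_power_succ {F : (Fin (n + 1) → ℝ) → ℝ≥0∞} (hF : Measurable F) :
    ∫⁻ x, F x ∂power (n + 1) μ = ∫⁻ a, ∫⁻ x, F (Fin.cons a x) ∂power n μ ∂μ := by
  have h := (measurePreserving_piFinSuccAbove (fun _ : Fin (n + 1) => μ) 0).symm
  have h2 := h.lintegral_comp hF
  unfold power
  rw [← h2, lintegral_prod]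
  · simp only [MeasurableEquiv.piFinSuccAbove_symm_apply, Fin.insertNthEquiv, Equiv.coe_fn_mk,
      Fin.insertNth_zero']
  · exact (hF.comp (MeasurableEquiv.measurable _)).aemeasurable

omit [IsFiniteMeasure μ] in
lemma lintegral_power_zero {F : (Fin 0 → ℝ) → ℝ≥0∞} :
    ∫⁻ x, F x ∂power 0 μ = F default := by
  unfold power
  rw [Measure.pi_of_empty _ default]
  simp

@[fun_prop]
lemma measurable_cons (a : ℝ) : Measurable fun x : Fin n → ℝ => (Fin.cons a x : Fin (n + 1) → ℝ) := by
  refine measurable_pi_lambda _ fun i => ?_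
  refine Fin.cases ?_ (fun j => ?_) i
  · simp
  · simpa using measurable_pi_apply j

@[fun_prop]
lemma measurable_cons_uncurry :
    Measurable fun p : ℝ × (Fin n → ℝ) => (Fin.cons p.1 p.2 : Fin (n + 1) → ℝ) := by
  refine measurable_pi_lambda _ fun i => ?_
  refine Fin.cases ?_ (fun j => ?_) i
  · simpa using measurable_fst
  · simp only [Fin.cons_succ]
    exact (measurable_pi_apply j).comp measurable_snd

lemma lintegral_power_prod (f : Fin n → ℝ → ℝ≥0∞) (hf : ∀ i, Measurable (f i)) :
    ∫⁻ x, ∏ i, f i (x i) ∂power n μ = ∏ i, ∫⁻ t, f i t ∂μ := by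
  induction n with
  | zero => rw [lintegral_power_zero]; simp
  | succ n ih =>
    have hm : Measurable fun x : Fin (n + 1) → ℝ => ∏ i, f i (x i) :=
      Finset.measurable_prod _ fun i _ => (hf i).comp (measurable_pi_apply i)
    have hm' : Measurable fun x : Fin n → ℝ => ∏ i : Fin n, f i.succ (x i) :=
      Finset.measurable_prod _ fun i _ => (hf i.succ).comp (measurable_pi_apply i)
    rw [lintegral_power_succ hm, Fin.prod_univ_succ, ← ih (fun i => f i.succ) (fun i => hf i.succ),
      ← lintegral_mul_const _ (hf 0)]
    refine lintegral_congr fun a => ?_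
    simp only [Fin.prod_univ_succ, Fin.cons_zero, Fin.cons_succ]
    exact lintegral_const_mul _ hm'

lemma lintegral_power_prod_const {f : ℝ → ℝ≥0∞} (hf : Measurable f) :
    ∫⁻ x, ∏ i, f (x i) ∂power n μ = (∫⁻ t, f t ∂μ) ^ n := by
  simp [lintegral_power_prod (fun _ => f) fun _ => hf]

lemma lintegral_power_single {a g : ℝ → ℝ≥0∞} (ha : Measurable a) (hg : Measurable g) (i : Fin n) :
    ∫⁻ x, g (x i) * ∏ j ∈ Finset.univ.erase i, a (x j) ∂power n μ
      = (∫⁻ t, g t ∂μ) * (∫⁻ t, a t ∂μ) ^ (n - 1) := by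
  have h := lintegral_power_prod (μ := μ) (fun j => if j = i then g else a)
    (fun j => by split_ifs <;> assumption)
  rw [← Finset.mul_prod_erase _ _ (Finset.mem_univ i)] at h
  simp only [if_true] at h
  rw [Finset.prod_congr rfl (g := fun _ => ∫⁻ t, a t ∂μ)] at h
  · simp only [Finset.prod_const, Finset.card_erase_of_mem (Finset.mem_univ i), Finset.card_univ,
      Fintype.card_fin] at h
    rw [← h]
    refine lintegral_congr fun x => ?_
    rw [← Finset.mul_prod_erase _ _ (Finset.mem_univ i)]
    simp only [if_true]
    congr 1
    exact Finset.prod_congr rfl fun j hj => by simp [(Finset.mem_erase.1 hj).1]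
  · intro j hj
    simp [(Finset.mem_erase.1 hj).1]

lemma lintegral_power_pair {a g g' : ℝ → ℝ≥0∞} (ha : Measurable a) (hg : Measurable g)
    (hg' : Measurable g') {i j : Fin n} (hij : j ≠ i) :
    ∫⁻ x, g (x i) * (g' (x j) * ∏ l ∈ (Finset.univ.erase i).erase j, a (x l)) ∂power n μ
      = (∫⁻ t, g t ∂μ) * ((∫⁻ t, g' t ∂μ) * (∫⁻ t, a t ∂μ) ^ (n - 2)) := by
  have hj : j ∈ Finset.univ.erase i := by simp [hij]
  have h := lintegral_power_prod (μ := μ) (fun l => if l = i then g else if l = j then g' else a)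
    (fun j => by split_ifs <;> assumption)
  rw [← Finset.mul_prod_erase _ _ (Finset.mem_univ i), ← Finset.mul_prod_erase _ _ hj] at h
  simp only [if_true, hij, if_false] at h
  rw [Finset.prod_congr rfl (g := fun _ => ∫⁻ t, a t ∂μ)] at h
  · rw [Finset.prod_const, Finset.card_erase_of_mem hj,
      Finset.card_erase_of_mem (Finset.mem_univ i), Finset.card_univ, Fintype.card_fin,
      Nat.sub_sub] at h
    rw [← h]
    refine lintegral_congr fun x => ?_
    rw [← Finset.mul_prod_erase _ _ (Finset.mem_univ i), ← Finset.mul_prod_erase _ _ hj]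
    simp only [if_true, hij, if_false]
    congr 2
    refine Finset.prod_congr rfl fun l hl => ?_
    have h1 := Finset.mem_erase.1 hl
    have h2 := Finset.mem_erase.1 h1.2
    simp [h1.1, h2.1]
  · intro l hl
    have h1 := Finset.mem_erase.1 hl
    have h2 := Finset.mem_erase.1 h1.2
    simp [h1.1, h2.1]

lemma power_restrict (s : Set ℝ) :
    (power n μ).restrict (univ.pi fun _ => s) = power n (μ.restrict s) := by
  unfold power
  exact Measure.restrict_pi_pi _ _

lemma power_smul {c : ℝ≥0∞} (hc : c ≠ ∞) : power n (c • μ) = c ^ n • power n μ := by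
  have : IsFiniteMeasure (c • μ) := μ.smul_finite hc
  unfold power
  refine (Measure.pi_eq fun s hs => ?_)
  simp [Finset.prod_mul_distrib]

lemma power_map {f : ℝ → ℝ} (hf : Measurable f) :
    power n (μ.map f) = (power n μ).map fun x i => f (x i) := by
  have : IsFiniteMeasure (μ.map f) := by infer_instance
  refine (MeasurePreserving.map_eq ?_).symm
  exact measurePreserving_pi _ _ fun i => ⟨hf, rfl⟩

lemma power_withDensity {g : ℝ → ℝ≥0∞} (hg : Measurable g) [IsFiniteMeasure (μ.withDensity g)] :
    power n (μ.withDensity g) = (power n μ).withDensity fun x => ∏ i, g (x i) := by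
  unfold power
  refine Measure.pi_eq fun s hs => ?_
  rw [withDensity_apply _ (MeasurableSet.univ_pi hs), ← lintegral_indicator (MeasurableSet.univ_pi hs)]
  have h := lintegral_power_prod (μ := μ) (fun i => (s i).indicator g) (fun i => hg.indicator (hs i))
  simp only [withDensity_apply _ (hs _), ← lintegral_indicator (hs _)]
  rw [← h]
  refine lintegral_congr fun x => ?_
  by_cases hx : x ∈ univ.pi s
  · rw [indicator_of_mem hx]
    exact Finset.prod_congr rfl fun i _ => by rw [indicator_of_mem (hx i trivial)]
  · rw [indicator_of_notMem hx]
    simp only [mem_univ_pi, not_forall] at hx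
    obtain ⟨i, hi⟩ := hx
    exact (Finset.prod_eq_zero (Finset.mem_univ i) (indicator_of_notMem hi _)).symm

lemma ae_power {P : ℝ → Prop} (h : ∀ᵐ t ∂μ, P t) : ∀ᵐ x ∂power n μ, ∀ i, P (x i) := by
  rw [ae_all_iff]
  intro i
  exact (Measure.tendsto_eval_ae_ae (μ := fun _ : Fin n => μ) (i := i)).eventually h

lemma power_univ : power n μ univ = μ univ ^ n := by
  simp [power, Measure.pi_univ]

lemma lintegral_power_comp_perm (σ : Equiv.Perm (Fin n)) {F : (Fin n → ℝ) → ℝ≥0∞} (hF : Measurable F) :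
    ∫⁻ x, F (fun i => x (σ i)) ∂power n μ = ∫⁻ x, F x ∂power n μ := by
  have h := measurePreserving_piCongrLeft (fun _ : Fin n => μ) σ.symm
  have := h.lintegral_comp hF
  unfold power
  rw [← this]
  refine lintegral_congr fun x => ?_
  congr 1
  ext i
  obtain ⟨j, rfl⟩ := σ.symm.surjective i
  rw [MeasurableEquiv.coe_piCongrLeft, Equiv.piCongrLeft_apply_apply]
  simp

end Power

/-- `ν` dominates `μ` up to an error `ε` on test functions with values in `[0, 1]`. -/
def Near {Ω : Type*} [MeasurableSpace Ω] (ε : ℝ≥0∞) (μ ν : Measure Ω) : Prop :=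
  ∀ φ : Ω → ℝ≥0∞, Measurable φ → (∀ x, φ x ≤ 1) → ∫⁻ x, φ x ∂μ ≤ ∫⁻ x, φ x ∂ν + ε

lemma Near.scaled {Ω : Type*} [MeasurableSpace Ω] {ε : ℝ≥0∞} {μ ν : Measure Ω} (h : Near ε μ ν)
    {c : ℝ≥0∞} (hc : c ≠ ∞) {φ : Ω → ℝ≥0∞} (hφ : Measurable φ) (hφc : ∀ x, φ x ≤ c) :
    ∫⁻ x, φ x ∂μ ≤ ∫⁻ x, φ x ∂ν + c * ε := by
  rcases eq_or_ne c 0 with rfl | h0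
  · have : φ = fun _ => 0 := funext fun x => le_antisymm (hφc x) bot_le
    simp [this]
  have h1 := h (fun x => c⁻¹ * φ x) (hφ.const_mul _) (fun x => by
    calc c⁻¹ * φ x ≤ c⁻¹ * c := by gcongr; exact hφc x
      _ = 1 := ENNReal.inv_mul_cancel h0 hc)
  rw [lintegral_const_mul _ hφ, lintegral_const_mul _ hφ] at h1
  calc ∫⁻ x, φ x ∂μ = c * (c⁻¹ * ∫⁻ x, φ x ∂μ) := by
        rw [← mul_assoc, ENNReal.mul_inv_cancel h0 hc, one_mul]
    _ ≤ c * (c⁻¹ * ∫⁻ x, φ x ∂ν + ε) := by gcongr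
    _ = _ := by rw [mul_add, ← mul_assoc, ENNReal.mul_inv_cancel h0 hc, one_mul]

lemma Near.power {μ ν : Measure ℝ} [IsFiniteMeasure μ] [IsFiniteMeasure ν] {ε M : ℝ≥0∞}
    (h : Near ε μ ν) (hM : M ≠ ∞) (hμ : μ univ ≤ M) (hν : ν univ ≤ M) (n : ℕ) :
    Near (n * M ^ (n - 1) * ε) (power n μ) (power n ν) := by
  induction n with
  | zero => intro φ _ _; simp [lintegral_power_zero]
  | succ n ih =>
    intro F hF hF1
    rw [lintegral_power_succ hF, lintegral_power_succ hF]
    have hm (κ : Measure ℝ) [IsFiniteMeasure κ] :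
        Measurable fun a => ∫⁻ x, F (Fin.cons a x) ∂NAESat.power n κ :=
      Measurable.lintegral_prod_right' (f := fun p : ℝ × (Fin n → ℝ) => F (Fin.cons p.1 p.2))
        (hF.comp measurable_cons_uncurry)
    calc ∫⁻ a, ∫⁻ x, F (Fin.cons a x) ∂NAESat.power n μ ∂μ
        ≤ ∫⁻ a, (∫⁻ x, F (Fin.cons a x) ∂NAESat.power n ν + n * M ^ (n - 1) * ε) ∂μ := by
          refine lintegral_mono fun a => ih _ (hF.comp (measurable_cons a)) fun x => hF1 _
      _ = ∫⁻ a, ∫⁻ x, F (Fin.cons a x) ∂NAESat.power n ν ∂μ + n * M ^ (n - 1) * ε * μ univ := by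
          rw [lintegral_add_right _ measurable_const, lintegral_const]
      _ ≤ (∫⁻ a, ∫⁻ x, F (Fin.cons a x) ∂NAESat.power n ν ∂ν + M ^ n * ε)
            + n * M ^ (n - 1) * ε * M := by
          gcongr
          refine h.scaled (ENNReal.pow_ne_top hM) (hm ν) fun a => ?_
          calc ∫⁻ x, F (Fin.cons a x) ∂NAESat.power n ν ≤ ∫⁻ x, 1 ∂NAESat.power n ν :=
                lintegral_mono fun x => hF1 _
            _ = ν univ ^ n := by simp [power_univ]
            _ ≤ M ^ n := by gcongr
      _ = _ := by
          have : (n : ℝ≥0∞) * M ^ (n - 1) * ε * M = n * M ^ n * ε := by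
            cases n with
            | zero => simp
            | succ m => simp only [Nat.add_sub_cancel]; ring
          rw [this, Nat.add_sub_cancel]
          push_cast
          ring

section Tilted

variable {Ω : Type*} [MeasurableSpace Ω] {ν : Measure Ω} {lam : ℝ} {g f : Ω → ℝ}

@[fun_prop]
lemma measurable_weight (lam : ℝ) : Measurable (weight lam) := by
  unfold weight
  exact Measurable.ite (measurableSet_singleton 0) measurable_const (by fun_prop)

lemma weight_ne_top (lam x : ℝ) : weight lam x ≠ ∞ := by
  unfold weight; split_ifs <;> simp

lemma weight_zero (lam : ℝ) : weight lam 0 = 0 := by simp [weight]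

lemma weight_of_pos {x : ℝ} (hx : 0 < x) : weight lam x = ENNReal.ofReal (x ^ lam) := by
  simp [weight, hx.ne']

lemma weight_one (lam : ℝ) : weight lam 1 = 1 := by simp [weight]

lemma weight_mul {x y : ℝ} (hx : 0 ≤ x) (hy : 0 ≤ y) :
    weight lam (x * y) = weight lam x * weight lam y := by
  rcases hx.eq_or_lt with rfl | hx
  · simp [weight_zero]
  rcases hy.eq_or_lt with rfl | hy
  · simp [weight_zero]
  rw [weight_of_pos hx, weight_of_pos hy, weight_of_pos (mul_pos hx hy),
    Real.mul_rpow hx.le hy.le, ENNReal.ofReal_mul (Real.rpow_nonneg hx.le _)]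

lemma weight_prod {ι : Type*} (s : Finset ι) {x : ι → ℝ} (hx : ∀ i, 0 ≤ x i) :
    weight lam (∏ i ∈ s, x i) = ∏ i ∈ s, weight lam (x i) := by
  classical
  induction s using Finset.induction_on with
  | empty => simp [weight_one]
  | insert i s hi ih =>
    rw [Finset.prod_insert hi, Finset.prod_insert hi,
      weight_mul (hx i) (Finset.prod_nonneg fun i _ => hx i), ih]

lemma weight_mono (hl : 0 ≤ lam) {x y : ℝ} (hx : 0 ≤ x) (hxy : x ≤ y) :
    weight lam x ≤ weight lam y := by
  rcases hx.eq_or_lt with rfl | hx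
  · simp [weight_zero]
  rw [weight_of_pos hx, weight_of_pos (hx.trans_le hxy)]
  exact ENNReal.ofReal_le_ofReal (Real.rpow_le_rpow hx.le hxy hl)

lemma weight_le_one (hl : 0 ≤ lam) {x : ℝ} (hx : 0 ≤ x) (hx1 : x ≤ 1) : weight lam x ≤ 1 :=
  (weight_mono hl hx hx1).trans_eq (weight_one _)

lemma weight_le_two (hl : 0 ≤ lam) (hl1 : lam ≤ 1) {x : ℝ} (hx : 0 ≤ x) (hx1 : x ≤ 2) :
    weight lam x ≤ 2 := by
  refine (weight_mono hl hx hx1).trans ?_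
  rw [weight_of_pos two_pos]
  calc ENNReal.ofReal ((2 : ℝ) ^ lam) ≤ ENNReal.ofReal ((2 : ℝ) ^ (1 : ℝ)) :=
        ENNReal.ofReal_le_ofReal (Real.rpow_le_rpow_of_exponent_le one_le_two hl1)
    _ = 2 := by simp

lemma weight_add_le (hl : 0 ≤ lam) (hl1 : lam ≤ 1) {x y : ℝ} (hx : 0 ≤ x) (hy : 0 ≤ y) :
    weight lam (x + y) ≤ weight lam x + weight lam y := by
  rcases hx.eq_or_lt with rfl | hx
  · simp [weight_zero]
  rcases hy.eq_or_lt with rfl | hy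
  · simp [weight_zero]
  rw [weight_of_pos hx, weight_of_pos hy, weight_of_pos (by positivity),
    ← ENNReal.ofReal_add (by positivity) (by positivity)]
  exact ENNReal.ofReal_le_ofReal (Real.rpow_add_le_add_rpow hx.le hy.le hl hl1)

lemma lintegral_tiltedLaw (hg : Measurable g) (hf : Measurable f) {φ : ℝ → ℝ≥0∞}
    (hφ : Measurable φ) : ∫⁻ t, φ t ∂tiltedLaw ν lam g f
      = (tiltedMass ν lam g)⁻¹ * ∫⁻ ω, weight lam (g ω) * φ (f ω) ∂ν := by
  unfold tiltedLaw
  rw [lintegral_smul_measure, lintegral_map hφ hf, smul_eq_mul]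
  congr 1
  exact lintegral_withDensity_eq_lintegral_mul _ ((measurable_weight lam).comp hg) (hφ.comp hf)

lemma isProbabilityMeasure_tiltedLaw (hf : Measurable f)
    (h0 : tiltedMass ν lam g ≠ 0) (h1 : tiltedMass ν lam g ≠ ∞) :
    IsProbabilityMeasure (tiltedLaw ν lam g f) := by
  constructor
  unfold tiltedLaw
  rw [Measure.smul_apply, Measure.map_apply hf MeasurableSet.univ, preimage_univ,
    withDensity_apply _ MeasurableSet.univ, Measure.restrict_univ]
  exact ENNReal.inv_mul_cancel h0 h1

lemma integrable_tiltedLaw_iff (hg : Measurable g) (hf : Measurable f) (h0 : tiltedMass ν lam g ≠ 0)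
    (h1 : tiltedMass ν lam g ≠ ∞) {φ : ℝ → ℝ} (hφ : Measurable φ) :
    Integrable φ (tiltedLaw ν lam g f) ↔
      ∫⁻ ω, weight lam (g ω) * ‖φ (f ω)‖ₑ ∂ν ≠ ∞ := by
  unfold Integrable HasFiniteIntegral
  rw [lintegral_tiltedLaw hg hf hφ.enorm, lt_top_iff_ne_top]
  have h2 : (tiltedMass ν lam g)⁻¹ ≠ 0 := ENNReal.inv_ne_zero.2 h1
  have h3 : (tiltedMass ν lam g)⁻¹ ≠ ∞ := ENNReal.inv_ne_top.2 h0
  constructor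
  · rintro ⟨-, h⟩ h'
    rw [h', ENNReal.mul_top h2] at h
    exact h rfl
  · intro h
    exact ⟨hφ.aestronglyMeasurable, ENNReal.mul_ne_top h3 h⟩

/-- The integral of a function that is non-positive on the relevant range. -/
lemma integral_tiltedLaw_of_nonpos (hg : Measurable g) (hf : Measurable f)
    (h0 : tiltedMass ν lam g ≠ 0) {φ : ℝ → ℝ} (hφ : Measurable φ)
    (hn : ∀ᵐ ω ∂ν, g ω ≠ 0 → φ (f ω) ≤ 0) :
    ∫ t, φ t ∂tiltedLaw ν lam g f = -((∫⁻ ω, weight lam (g ω) * ENNReal.ofReal (-φ (f ω)) ∂ν).toReal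
        / (tiltedMass ν lam g).toReal) := by
  have h3 : (tiltedMass ν lam g)⁻¹ ≠ ∞ := ENNReal.inv_ne_top.2 h0
  have hn' : ∀ᵐ t ∂tiltedLaw ν lam g f, 0 ≤ -φ t := by
    unfold tiltedLaw
    refine Measure.ae_smul_measure ?_ _
    refine (ae_map_iff hf.aemeasurable (measurableSet_le measurable_const hφ.neg)).2 ?_
    refine (ae_withDensity_iff ((measurable_weight lam).comp hg)).2 ?_
    filter_upwards [hn] with ω hω hw
    have : g ω ≠ 0 := by
      intro h; exact hw (by rw [Function.comp_apply, h, weight_zero])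
    exact neg_nonneg.2 (hω this)
  have h4 : ∫ t, φ t ∂tiltedLaw ν lam g f = -∫ t, -φ t ∂tiltedLaw ν lam g f := by
    rw [integral_neg, neg_neg]
  rw [h4, integral_eq_lintegral_of_nonneg_ae hn' hφ.neg.aestronglyMeasurable,
    lintegral_tiltedLaw hg hf (φ := fun t => ENNReal.ofReal (-φ t)) hφ.neg.ennreal_ofReal, ENNReal.toReal_mul, ENNReal.toReal_inv]
  congr 1
  rw [div_eq_inv_mul]

end Tilted

/-- A measure on `[0, 1]` that is invariant under `t ↦ 1 - t`. -/
structure Balanced (μ : Measure ℝ) : Prop where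
  supp : ∀ᵐ t ∂μ, t ∈ Icc (0 : ℝ) 1
  symm : μ.map (fun t => 1 - t) = μ

section Balanced

variable {μ ν : Measure ℝ} {n : ℕ}

lemma Balanced.lintegral_reflect (h : Balanced μ) {φ : ℝ → ℝ≥0∞} (hφ : Measurable φ) :
    ∫⁻ t, φ (1 - t) ∂μ = ∫⁻ t, φ t ∂μ := by
  conv_rhs => rw [← h.symm]
  rw [lintegral_map hφ (by fun_prop)]

lemma Balanced.setLIntegral_reflect (h : Balanced μ) {φ : ℝ → ℝ≥0∞} (hφ : Measurable φ) :
    ∫⁻ t in Ioo 0 1, φ (1 - t) ∂μ = ∫⁻ t in Ioo 0 1, φ t ∂μ := by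
  rw [← lintegral_indicator measurableSet_Ioo, ← lintegral_indicator measurableSet_Ioo,
    ← h.lintegral_reflect (hφ.indicator measurableSet_Ioo)]
  refine lintegral_congr fun t => ?_
  have : t ∈ Ioo (0 : ℝ) 1 ↔ 1 - t ∈ Ioo (0 : ℝ) 1 := by simp [and_comm]
  by_cases ht : t ∈ Ioo (0 : ℝ) 1
  · rw [indicator_of_mem ht, indicator_of_mem (this.1 ht)]
  · rw [indicator_of_notMem ht, indicator_of_notMem (fun h => ht (this.2 h))]

lemma Balanced.atom (h : Balanced μ) : μ {0} = μ {1} := by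
  conv_lhs => rw [← h.symm]
  rw [Measure.map_apply (by fun_prop) (measurableSet_singleton 0)]
  congr 1
  ext t
  simp only [mem_preimage, mem_singleton_iff]
  constructor <;> intro h <;> linarith

lemma Balanced.ae_power [IsFiniteMeasure μ] (h : Balanced μ) :
    ∀ᵐ x ∂power n μ, ∀ i, x i ∈ Icc (0 : ℝ) 1 := NAESat.ae_power h.supp

lemma Balanced.lintegral_power_reflect [IsFiniteMeasure μ] (h : Balanced μ)
    {F : (Fin n → ℝ) → ℝ≥0∞} (hF : Measurable F) :
    ∫⁻ x, F (fun i => 1 - x i) ∂power n μ = ∫⁻ x, F x ∂power n μ := by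
  conv_rhs => rw [← h.symm]
  rw [power_map (by fun_prop), lintegral_map hF]
  exact measurable_pi_lambda _ fun i => by fun_prop

lemma Balanced.lintegral_ne_zero (h : Balanced μ) {φ : ℝ → ℝ≥0∞} :
    ∫⁻ t in {0}ᶜ, φ t ∂μ = φ 1 * μ {1} + ∫⁻ t in Ioo 0 1, φ t ∂μ := by
  have h1 : ({0}ᶜ : Set ℝ) =ᵐ[μ] ({1} ∪ Ioo 0 1 : Set ℝ) := by
    rw [eventuallyEq_set]
    filter_upwards [h.supp] with t ht
    simp only [mem_compl_iff, mem_singleton_iff, mem_union, mem_Ioo]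
    constructor
    · intro h0
      rcases ht.2.eq_or_lt with h1 | h1
      · exact Or.inl h1
      · exact Or.inr ⟨lt_of_le_of_ne ht.1 (Ne.symm h0), h1⟩
    · rintro (h1 | h1)
      · rw [h1]; norm_num
      · exact h1.1.ne'
  rw [setLIntegral_congr h1, lintegral_union measurableSet_Ioo (by simp), lintegral_singleton]

lemma Balanced.lintegral_ne_one (h : Balanced μ) {φ : ℝ → ℝ≥0∞} :
    ∫⁻ t in {1}ᶜ, φ t ∂μ = φ 0 * μ {1} + ∫⁻ t in Ioo 0 1, φ t ∂μ := by
  have h1 : ({1}ᶜ : Set ℝ) =ᵐ[μ] ({0} ∪ Ioo 0 1 : Set ℝ) := by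
    rw [eventuallyEq_set]
    filter_upwards [h.supp] with t ht
    simp only [mem_compl_iff, mem_singleton_iff, mem_union, mem_Ioo]
    constructor
    · intro h0
      rcases ht.1.eq_or_lt with h1 | h1
      · exact Or.inl h1.symm
      · exact Or.inr ⟨h1, lt_of_le_of_ne ht.2 h0⟩
    · rintro (h1 | h1)
      · rw [h1]; norm_num
      · exact h1.2.ne
  rw [setLIntegral_congr h1, lintegral_union measurableSet_Ioo (by simp), lintegral_singleton,
    h.atom]

lemma Balanced.lintegral_eq (h : Balanced μ) {φ : ℝ → ℝ≥0∞} :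
    ∫⁻ t, φ t ∂μ = (φ 0 + φ 1) * μ {1} + ∫⁻ t in Ioo 0 1, φ t ∂μ := by
  rw [← lintegral_add_compl φ (measurableSet_singleton 0), h.lintegral_ne_zero, lintegral_singleton,
    h.atom]
  ring

lemma Balanced.mass_ne_zero (h : Balanced μ) : μ {0}ᶜ = μ {1} + μ (Ioo 0 1) := by
  have := h.lintegral_ne_zero (φ := fun _ => 1)
  simpa using this

lemma Balanced.mass_ne_one (h : Balanced μ) : μ {1}ᶜ = μ {1} + μ (Ioo 0 1) := by
  have := h.lintegral_ne_one (φ := fun _ => 1)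
  simpa using this

lemma Balanced.mass (h : Balanced μ) : μ univ = 2 * μ {1} + μ (Ioo 0 1) := by
  have := h.lintegral_eq (φ := fun _ => 1)
  simp only [lintegral_const, Measure.restrict_apply, MeasurableSet.univ, univ_inter, one_mul] at this
  rw [this, one_add_one_eq_two]

lemma Balanced.near_atom [IsProbabilityMeasure μ] [IsProbabilityMeasure ν] (hμ : Balanced μ)
    (hν : Balanced ν) {ε : ℝ≥0∞} (h : Near ε (ν.restrict (Ioo 0 1)) (μ.restrict (Ioo 0 1))) :
    μ {1} ≤ ν {1} + ε := by
  have h1 := h (fun _ => 1) measurable_const fun _ => le_rfl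
  simp only [lintegral_const, Measure.restrict_apply, MeasurableSet.univ, univ_inter, one_mul] at h1
  have h2 : 2 * μ {1} + μ (Ioo 0 1) ≤ 2 * ν {1} + ε + μ (Ioo 0 1) := by
    calc _ = 2 * ν {1} + ν (Ioo 0 1) := by rw [← hμ.mass, ← hν.mass]; simp
      _ ≤ _ := by rw [add_assoc, add_comm ε]; gcongr
  have h3 := (ENNReal.add_le_add_iff_right (measure_ne_top _ _)).1 h2
  have h4 : 2 * μ {1} ≤ 2 * (ν {1} + ε) := by
    refine h3.trans ?_
    rw [mul_add]
    gcongr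
    exact le_mul_of_one_le_left bot_le (by norm_num)
  exact (ENNReal.mul_le_mul_iff_right (by norm_num) (by norm_num)).1 h4

lemma Balanced.near_ne_zero [IsProbabilityMeasure μ] [IsProbabilityMeasure ν] (hμ : Balanced μ)
    (hν : Balanced ν) {ε : ℝ≥0∞} (h : Near ε (μ.restrict (Ioo 0 1)) (ν.restrict (Ioo 0 1)))
    (h' : Near ε (ν.restrict (Ioo 0 1)) (μ.restrict (Ioo 0 1))) :
    Near (2 * ε) (μ.restrict {0}ᶜ) (ν.restrict {0}ᶜ) := by
  intro φ hφ h1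
  rw [hμ.lintegral_ne_zero, hν.lintegral_ne_zero]
  calc φ 1 * μ {1} + ∫⁻ t in Ioo 0 1, φ t ∂μ
      ≤ φ 1 * (ν {1} + ε) + (∫⁻ t in Ioo 0 1, φ t ∂ν + ε) := by
        gcongr
        · exact hμ.near_atom hν h'
        · exact h φ hφ h1
    _ ≤ (φ 1 * ν {1} + 1 * ε) + (∫⁻ t in Ioo 0 1, φ t ∂ν + ε) := by
        rw [mul_add]; gcongr; exact h1 1
    _ = _ := by ring

lemma Balanced.near_ne_one [IsProbabilityMeasure μ] [IsProbabilityMeasure ν] (hμ : Balanced μ)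
    (hν : Balanced ν) {ε : ℝ≥0∞} (h : Near ε (μ.restrict (Ioo 0 1)) (ν.restrict (Ioo 0 1)))
    (h' : Near ε (ν.restrict (Ioo 0 1)) (μ.restrict (Ioo 0 1))) :
    Near (2 * ε) (μ.restrict {1}ᶜ) (ν.restrict {1}ᶜ) := by
  intro φ hφ h1
  rw [hμ.lintegral_ne_one, hν.lintegral_ne_one]
  calc φ 0 * μ {1} + ∫⁻ t in Ioo 0 1, φ t ∂μ
      ≤ φ 0 * (ν {1} + ε) + (∫⁻ t in Ioo 0 1, φ t ∂ν + ε) := by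
        gcongr
        · exact hμ.near_atom hν h'
        · exact h φ hφ h1
    _ ≤ (φ 0 * ν {1} + 1 * ε) + (∫⁻ t in Ioo 0 1, φ t ∂ν + ε) := by
        rw [mul_add]; gcongr; exact h1 0
    _ = _ := by ring

lemma Balanced.near [IsProbabilityMeasure μ] [IsProbabilityMeasure ν] (hμ : Balanced μ)
    (hν : Balanced ν) {ε : ℝ≥0∞} (h : Near ε (μ.restrict (Ioo 0 1)) (ν.restrict (Ioo 0 1)))
    (h' : Near ε (ν.restrict (Ioo 0 1)) (μ.restrict (Ioo 0 1))) : Near (3 * ε) μ ν := by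
  intro φ hφ h1
  rw [hμ.lintegral_eq, hν.lintegral_eq]
  calc (φ 0 + φ 1) * μ {1} + ∫⁻ t in Ioo 0 1, φ t ∂μ
      ≤ (φ 0 + φ 1) * (ν {1} + ε) + (∫⁻ t in Ioo 0 1, φ t ∂ν + ε) := by
        gcongr
        · exact hμ.near_atom hν h'
        · exact h φ hφ h1
    _ ≤ ((φ 0 + φ 1) * ν {1} + (1 + 1) * ε) + (∫⁻ t in Ioo 0 1, φ t ∂ν + ε) := by
        rw [mul_add]; gcongr
        · exact h1 0
        · exact h1 1
    _ = _ := by ring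

end Balanced

section ClauseNear

variable {μ ν : Measure ℝ} {n : ℕ}

/-- Configurations without a zero. -/
def noZero (n : ℕ) : Set (Fin n → ℝ) := univ.pi fun _ => {0}ᶜ

/-- Configurations without a one. -/
def noOne (n : ℕ) : Set (Fin n → ℝ) := univ.pi fun _ => {1}ᶜ

lemma measurableSet_noZero : MeasurableSet (noZero n) :=
  MeasurableSet.univ_pi fun _ => (measurableSet_singleton _).compl

lemma measurableSet_noOne : MeasurableSet (noOne n) :=
  MeasurableSet.univ_pi fun _ => (measurableSet_singleton _).compl

lemma mem_noZero {x : Fin n → ℝ} : x ∈ noZero n ↔ ∀ i, x i ≠ 0 := by simp [noZero]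

lemma mem_noOne {x : Fin n → ℝ} : x ∈ noOne n ↔ ∀ i, x i ≠ 1 := by simp [noOne]

lemma lintegral_split_zero_one [IsFiniteMeasure μ] {F : (Fin n → ℝ) → ℝ≥0∞} :
    ∫⁻ x, F x ∂power n μ = ∫⁻ x, F x ∂power n (μ.restrict {0}ᶜ)
      + ∫⁻ x, (noZero n)ᶜ.indicator F x ∂power n (μ.restrict {1}ᶜ)
      + ∫⁻ x in (noZero n ∪ noOne n)ᶜ, F x ∂power n μ := by
  rw [← power_restrict, ← power_restrict,
    ← lintegral_add_compl F (measurableSet_noZero.union measurableSet_noOne)]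
  congr 1
  rw [← union_sdiff_self, lintegral_union (measurableSet_noOne.diff measurableSet_noZero)
    disjoint_sdiff_right]
  congr 1
  rw [lintegral_indicator measurableSet_noZero.compl, Measure.restrict_restrict
    measurableSet_noZero.compl, inter_comm]
  rfl

lemma clause_near [IsProbabilityMeasure μ] [IsProbabilityMeasure ν] {ε M : ℝ≥0∞}
    (h0 : Near ε (μ.restrict {0}ᶜ) (ν.restrict {0}ᶜ)) (h0' : Near ε (ν.restrict {0}ᶜ) (μ.restrict {0}ᶜ))
    (h1 : Near ε (μ.restrict {1}ᶜ) (ν.restrict {1}ᶜ)) (h1' : Near ε (ν.restrict {1}ᶜ) (μ.restrict {1}ᶜ))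
    (hM : M ≠ ∞) (hμ0 : μ {0}ᶜ ≤ M) (hμ1 : μ {1}ᶜ ≤ M) (hν0 : ν {0}ᶜ ≤ M) (hν1 : ν {1}ᶜ ≤ M)
    {F : (Fin n → ℝ) → ℝ≥0∞} (hF : Measurable F) (hF1 : ∀ x, F x ≤ 1) {c : ℝ≥0∞} (hc : c ≤ 1)
    (hE : ∀ x, (∃ i, x i = 0) → (∃ i, x i = 1) → F x = c) :
    ∫⁻ x, F x ∂power n μ ≤ ∫⁻ x, F x ∂power n ν + 4 * (n * M ^ (n - 1) * ε) := by
  set e := n * M ^ (n - 1) * ε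
  have a0 := h0.power hM (by simpa) (by simpa) n
  have a0' := h0'.power hM (by simpa) (by simpa) n
  have a1 := h1.power hM (by simpa) (by simpa) n
  have a1' := h1'.power hM (by simpa) (by simpa) n
  have hconst (κ : Measure ℝ) [IsProbabilityMeasure κ] :
      ∫⁻ x in (noZero n ∪ noOne n)ᶜ, F x ∂power n κ = c * power n κ (noZero n ∪ noOne n)ᶜ := by
    rw [setLIntegral_congr_fun (measurableSet_noZero.union measurableSet_noOne).compl
      (g := fun _ => c), setLIntegral_const]
    intro x hx
    simp only [compl_union, mem_inter_iff, mem_compl_iff, mem_noZero, mem_noOne, not_forall,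
      not_not] at hx
    exact hE x hx.1 hx.2
  have hmass (κ : Measure ℝ) [IsProbabilityMeasure κ] :
      1 = power n (κ.restrict {0}ᶜ) univ
      + ∫⁻ x, (noZero n)ᶜ.indicator (fun _ => 1) x ∂power n (κ.restrict {1}ᶜ)
      + power n κ (noZero n ∪ noOne n)ᶜ := by
    have := lintegral_split_zero_one (μ := κ) (n := n) (F := fun _ => 1)
    simpa using this
  have hE' : power n μ (noZero n ∪ noOne n)ᶜ ≤ power n ν (noZero n ∪ noOne n)ᶜ + 2 * e := by
    have b0 := a0' (fun _ => 1) measurable_const fun _ => le_rfl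
    have b1 := a1' ((noZero n)ᶜ.indicator fun _ => 1)
      (measurable_const.indicator measurableSet_noZero.compl) fun x => by
        by_cases hx : x ∈ (noZero n)ᶜ <;> simp [hx]
    simp only [lintegral_const, one_mul] at b0
    have key := (hmass μ).symm.trans (hmass ν)
    have hfin : power n (μ.restrict {0}ᶜ) univ
      + ∫⁻ x, (noZero n)ᶜ.indicator (fun _ => 1) x ∂power n (μ.restrict {1}ᶜ) ≠ ∞ := by
      intro h
      have := hmass μ
      rw [h] at this
      simp at this
    rw [← ENNReal.add_le_add_iff_left hfin, key]
    calc _ ≤ (power n (μ.restrict {0}ᶜ) univ + e)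
      + (∫⁻ x, (noZero n)ᶜ.indicator (fun _ => 1) x ∂power n (μ.restrict {1}ᶜ) + e)
      + power n ν (noZero n ∪ noOne n)ᶜ := by gcongr
      _ = _ := by ring
  rw [lintegral_split_zero_one (μ := μ), lintegral_split_zero_one (μ := ν), hconst, hconst]
  calc _ ≤ (∫⁻ x, F x ∂power n (ν.restrict {0}ᶜ) + e)
      + (∫⁻ x, (noZero n)ᶜ.indicator F x ∂power n (ν.restrict {1}ᶜ) + e)
      + c * (power n ν (noZero n ∪ noOne n)ᶜ + 2 * e) := by
        gcongr
        · exact a0 F hF hF1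
        · exact a1 _ (hF.indicator measurableSet_noZero.compl) fun x =>
            (indicator_le_self' (fun _ _ => bot_le) x).trans (hF1 x)
    _ ≤ (∫⁻ x, F x ∂power n (ν.restrict {0}ᶜ) + e)
      + (∫⁻ x, (noZero n)ᶜ.indicator F x ∂power n (ν.restrict {1}ᶜ) + e)
      + (c * power n ν (noZero n ∪ noOne n)ᶜ + 1 * (2 * e)) := by
        rw [mul_add]; gcongr
    _ = _ := by ring

end ClauseNear

section Geometry

variable {n : ℕ} {x : Fin n → ℝ}

/-- The message sent by a clause. -/
noncomputable def clauseOut (x : Fin n → ℝ) : ℝ := (1 - ∏ i, x i) / (2 - agree x)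

/-- The message sent by a variable. -/
noncomputable def varOut (y : Fin n → ℝ) : ℝ := (∏ i, y i) / agree y

@[fun_prop]
lemma measurable_agree : Measurable (agree : (Fin n → ℝ) → ℝ) := by
  unfold agree; fun_prop

@[fun_prop]
lemma measurable_clauseOut : Measurable (clauseOut : (Fin n → ℝ) → ℝ) := by
  unfold clauseOut; fun_prop

@[fun_prop]
lemma measurable_varOut : Measurable (varOut : (Fin n → ℝ) → ℝ) := by
  unfold varOut; fun_prop

lemma measurable_reflect : Measurable fun (x : Fin n → ℝ) (i : Fin n) => 1 - x i :=
  measurable_pi_lambda _ fun i => by fun_prop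

lemma agree_reflect (x : Fin n → ℝ) : agree (fun i => 1 - x i) = agree x := by
  simp [agree, add_comm]

lemma agree_eq_zero (h0 : ∃ i, x i = 0) (h1 : ∃ i, x i = 1) : agree x = 0 := by
  obtain ⟨i, hi⟩ := h0
  obtain ⟨j, hj⟩ := h1
  unfold agree
  rw [Finset.prod_eq_zero (Finset.mem_univ i) hi,
    Finset.prod_eq_zero (Finset.mem_univ j) (by rw [hj, sub_self]), add_zero]

lemma prod_mem_Icc {ι : Type*} {s : Finset ι} {x : ι → ℝ} (hx : ∀ i, x i ∈ Icc (0 : ℝ) 1) :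
    ∏ i ∈ s, x i ∈ Icc (0 : ℝ) 1 :=
  ⟨Finset.prod_nonneg fun i _ => (hx i).1,
    Finset.prod_le_one (fun i _ => (hx i).1) fun i _ => (hx i).2⟩

lemma prod_le_of_mem {ι : Type*} {s : Finset ι} {x : ι → ℝ} (hx : ∀ i, x i ∈ Icc (0 : ℝ) 1)
    {i : ι} (hi : i ∈ s) : ∏ i ∈ s, x i ≤ x i := by
  classical
  rw [← Finset.mul_prod_erase _ _ hi]
  exact mul_le_of_le_one_right (hx i).1 (prod_mem_Icc hx).2

lemma reflect_mem (hx : ∀ i, x i ∈ Icc (0 : ℝ) 1) (i : Fin n) : 1 - x i ∈ Icc (0 : ℝ) 1 :=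
  ⟨sub_nonneg.2 (hx i).2, sub_le_self _ (hx i).1⟩

lemma agree_nonneg (hx : ∀ i, x i ∈ Icc (0 : ℝ) 1) : 0 ≤ agree x :=
  add_nonneg (prod_mem_Icc hx).1 (prod_mem_Icc (reflect_mem hx)).1

lemma agree_le_one (hn : 0 < n) (hx : ∀ i, x i ∈ Icc (0 : ℝ) 1) : agree x ≤ 1 := by
  have h1 := prod_le_of_mem hx (Finset.mem_univ (⟨0, hn⟩ : Fin n))
  have h2 := prod_le_of_mem (reflect_mem hx) (Finset.mem_univ (⟨0, hn⟩ : Fin n))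
  unfold agree
  linarith

lemma clauseOut_mem (hn : 0 < n) (hx : ∀ i, x i ∈ Icc (0 : ℝ) 1) : clauseOut x ∈ Icc (0 : ℝ) 1 := by
  have h := agree_le_one hn hx
  have h1 := prod_mem_Icc (s := Finset.univ) hx
  have h2 := prod_mem_Icc (s := Finset.univ) (reflect_mem hx)
  refine ⟨div_nonneg (by linarith [h1.2]) (by linarith), (div_le_one (by linarith)).2 ?_⟩
  unfold agree
  linarith [h2.2]

lemma clauseOut_mul (hn : 0 < n) (hx : ∀ i, x i ∈ Icc (0 : ℝ) 1) :
    (2 - agree x) * clauseOut x = 1 - ∏ i, x i := by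
  have h := agree_le_one hn hx
  unfold clauseOut
  field_simp [show (2 - agree x) ≠ 0 by linarith]

lemma clauseOut_mul' (hn : 0 < n) (hx : ∀ i, x i ∈ Icc (0 : ℝ) 1) :
    (2 - agree x) * (1 - clauseOut x) = 1 - ∏ i, (1 - x i) := by
  have := clauseOut_mul hn hx
  rw [mul_sub, this]
  unfold agree
  ring

lemma clauseOut_reflect (hn : 0 < n) (hx : ∀ i, x i ∈ Icc (0 : ℝ) 1) :
    clauseOut (fun i => 1 - x i) = 1 - clauseOut x := by
  have h := agree_le_one hn hx
  have h1 := clauseOut_mul' hn hx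
  have h2 := clauseOut_mul hn (reflect_mem hx)
  rw [agree_reflect, ← h1] at h2
  exact mul_left_cancel₀ (by linarith) h2

lemma eq_one_of_prod_eq_one (hx : ∀ i, x i ∈ Icc (0 : ℝ) 1) (h : ∏ i, x i = 1) (i : Fin n) :
    x i = 1 :=
  le_antisymm (hx i).2 (h ▸ prod_le_of_mem hx (Finset.mem_univ i))

lemma clauseOut_mixed (h0 : ∃ i, x i = 0) (h1 : ∃ i, x i = 1) : clauseOut x = 1 / 2 := by
  unfold clauseOut
  rw [agree_eq_zero h0 h1]
  obtain ⟨i, hi⟩ := h0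
  rw [Finset.prod_eq_zero (Finset.mem_univ i) hi]
  norm_num

end Geometry

section Clause

variable {μ ν : Measure ℝ} {n : ℕ} {lam : ℝ}

/-- The law of the message sent by a clause, before normalization. -/
noncomputable def clauseRaw (n : ℕ) (lam : ℝ) (μ : Measure ℝ) : Measure ℝ :=
  ((power n μ).withDensity fun x => weight lam (2 - agree x)).map clauseOut

/-- The normalizing constant of the clause recursion. -/
noncomputable def clauseMass (n : ℕ) (lam : ℝ) (μ : Measure ℝ) : ℝ≥0∞ :=
  tiltedMass (power n μ) lam fun x => 2 - agree x

lemma clauseRec_eq (k : ℕ) (lam : ℝ) (μ : Measure ℝ) :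
    clauseRec k lam μ = (clauseMass (k - 1) lam μ)⁻¹ • clauseRaw (k - 1) lam μ := rfl

lemma lintegral_clauseRaw {φ : ℝ → ℝ≥0∞} (hφ : Measurable φ) :
    ∫⁻ t, φ t ∂clauseRaw n lam μ
      = ∫⁻ x, weight lam (2 - agree x) * φ (clauseOut x) ∂power n μ := by
  unfold clauseRaw
  rw [lintegral_map hφ (by fun_prop)]
  exact lintegral_withDensity_eq_lintegral_mul _ (by fun_prop) (by fun_prop)

variable [IsProbabilityMeasure μ]

omit [IsProbabilityMeasure μ] in
lemma clauseMass_eq_univ : clauseRaw n lam μ univ = clauseMass n lam μ := by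
  have := lintegral_clauseRaw (n := n) (lam := lam) (μ := μ) (φ := fun _ => 1) measurable_const
  simpa [clauseMass, tiltedMass] using this

lemma clauseMass_le (hn : 0 < n) (hμ : Balanced μ) (hl : 0 ≤ lam) (hl1 : lam ≤ 1) :
    clauseMass n lam μ ≤ 2 := by
  unfold clauseMass tiltedMass
  calc _ ≤ ∫⁻ _, 2 ∂power n μ := by
        refine lintegral_mono_ae ?_
        filter_upwards [hμ.ae_power (n := n)] with x hx
        exact weight_le_two hl hl1 (by linarith [agree_le_one hn hx]) (by linarith [agree_nonneg hx])
    _ = 2 := by simp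

lemma clauseMass_ge (hn : 0 < n) (hμ : Balanced μ) (hl : 0 ≤ lam) :
    1 ≤ clauseMass n lam μ := by
  unfold clauseMass tiltedMass
  calc (1 : ℝ≥0∞) = ∫⁻ _, 1 ∂power n μ := by simp
    _ ≤ _ := by
        refine lintegral_mono_ae ?_
        filter_upwards [hμ.ae_power (n := n)] with x hx
        rw [← weight_one lam]
        exact weight_mono hl zero_le_one (by linarith [agree_le_one hn hx])

lemma clauseMass_ne_zero (hn : 0 < n) (hμ : Balanced μ) (hl : 0 ≤ lam) : clauseMass n lam μ ≠ 0 :=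
  (zero_lt_one.trans_le (clauseMass_ge hn hμ hl)).ne'

lemma clauseMass_ne_top (hn : 0 < n) (hμ : Balanced μ) (hl : 0 ≤ lam) (hl1 : lam ≤ 1) :
    clauseMass n lam μ ≠ ∞ := ne_top_of_le_ne_top (by simp) (clauseMass_le hn hμ hl hl1)

lemma isFiniteMeasure_clauseRaw (hn : 0 < n) (hμ : Balanced μ) (hl : 0 ≤ lam) (hl1 : lam ≤ 1) :
    IsFiniteMeasure (clauseRaw n lam μ) :=
  ⟨by rw [clauseMass_eq_univ]; exact (clauseMass_ne_top hn hμ hl hl1).lt_top⟩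

lemma balanced_clauseRaw (hn : 0 < n) (hμ : Balanced μ) : Balanced (clauseRaw n lam μ) := by
  constructor
  · unfold clauseRaw
    refine (ae_map_iff (by fun_prop) measurableSet_Icc).2 ?_
    refine withDensity_absolutelyContinuous _ _ |>.ae_le ?_
    filter_upwards [hμ.ae_power (n := n)] with x hx
    exact clauseOut_mem hn hx
  · ext s hs
    have h1 : ∀ κ : Measure ℝ, κ s = ∫⁻ t, s.indicator 1 t ∂κ := fun κ => by
      rw [lintegral_indicator_one hs]
    rw [h1, h1, lintegral_map (measurable_one.indicator hs) (by fun_prop),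
      lintegral_clauseRaw (φ := fun t => s.indicator 1 (1 - t))
        ((measurable_one.indicator hs).comp (measurable_const.sub measurable_id)),
      lintegral_clauseRaw (measurable_one.indicator hs),
      ← hμ.lintegral_power_reflect (n := n)
        (F := fun x => weight lam (2 - agree x) * s.indicator 1 (clauseOut x))
        ((by fun_prop : Measurable fun x : Fin n → ℝ => weight lam (2 - agree x)).mul
          ((measurable_one.indicator hs).comp measurable_clauseOut))]
    refine lintegral_congr_ae ?_
    filter_upwards [hμ.ae_power (n := n)] with x hx
    rw [agree_reflect, clauseOut_reflect hn hx]

lemma clauseRaw_one (hn : 0 < n) (hμ : Balanced μ) : clauseRaw n lam μ {1} = μ {1} ^ n := by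
  rw [← lintegral_indicator_one (measurableSet_singleton 1),
    lintegral_clauseRaw (measurable_one.indicator (measurableSet_singleton _)), ← hμ.atom]
  have h : μ {0} ^ n = power n μ {fun _ => 0} := by
    unfold power; rw [Measure.pi_singleton]; simp
  rw [h, ← lintegral_indicator_one (measurableSet_singleton _)]
  refine lintegral_congr_ae ?_
  filter_upwards [hμ.ae_power (n := n)] with x hx
  have ha := agree_le_one hn hx
  by_cases h0 : x = fun _ => 0
  · have h1 : agree x = 1 := by simp [h0, agree, hn.ne']
    have h2 : clauseOut x = 1 := by unfold clauseOut; rw [h1]; simp [h0, hn.ne']; norm_num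
    have h3 : x ∈ ({fun _ => 0} : Set (Fin n → ℝ)) := h0
    rw [h1, h2, indicator_of_mem h3, indicator_of_mem (mem_singleton 1)]
    norm_num [weight_one]
  · have h1 : clauseOut x ∉ ({1} : Set ℝ) := by
      intro h1
      apply h0
      have h2 := clauseOut_mul' hn hx
      rw [mem_singleton_iff.1 h1, sub_self, mul_zero] at h2
      ext i
      have := eq_one_of_prod_eq_one (reflect_mem hx) (by linarith) i
      linarith
    rw [indicator_of_notMem h1, indicator_of_notMem (by simpa using h0), mul_zero]

lemma lintegral_clauseRaw_weight (hn : 0 < n) (hμ : Balanced μ) {φ : ℝ → ℝ≥0∞} (hφ : Measurable φ) :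
    ∫⁻ t, weight lam t * φ t ∂clauseRaw n lam μ
      = ∫⁻ x, weight lam (1 - ∏ i, x i) * φ (clauseOut x) ∂power n μ := by
  rw [lintegral_clauseRaw (by fun_prop)]
  refine lintegral_congr_ae ?_
  filter_upwards [hμ.ae_power (n := n)] with x hx
  rw [← mul_assoc, ← weight_mul (by linarith [agree_le_one hn hx]) (clauseOut_mem hn hx).1,
    clauseOut_mul hn hx]

/-- The Lipschitz estimate for the clause recursion. -/
lemma clauseRaw_near {ν : Measure ℝ} [IsProbabilityMeasure ν] (hn : 0 < n) (hμ : Balanced μ)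
    (hν : Balanced ν) (hl : 0 ≤ lam)
    {ε M : ℝ≥0∞} (h : Near ε (μ.restrict (Ioo 0 1)) (ν.restrict (Ioo 0 1)))
    (h' : Near ε (ν.restrict (Ioo 0 1)) (μ.restrict (Ioo 0 1))) (hM : M ≠ ∞)
    (hμM : μ {0}ᶜ ≤ M) (hνM : ν {0}ᶜ ≤ M) {φ : ℝ → ℝ≥0∞} (hφ : Measurable φ) (hφ1 : ∀ t, φ t ≤ 1) :
    ∫⁻ t, weight lam t * φ t ∂clauseRaw n lam μ ≤ ∫⁻ t, weight lam t * φ t ∂clauseRaw n lam ν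
      + 8 * (n * M ^ (n - 1) * ε) := by
  rw [lintegral_clauseRaw_weight hn hμ hφ, lintegral_clauseRaw_weight hn hν hφ]
  have key := clause_near (hμ.near_ne_zero hν h h') (hν.near_ne_zero hμ h' h)
    (hμ.near_ne_one hν h h') (hν.near_ne_one hμ h' h) hM hμM
    (by rwa [hμ.mass_ne_one, ← hμ.mass_ne_zero]) hνM (by rwa [hν.mass_ne_one, ← hν.mass_ne_zero])
    (F := fun x : Fin n → ℝ => min (weight lam (1 - ∏ i, x i) * φ (clauseOut x)) 1)
    (by fun_prop) (fun x => min_le_right _ _) (c := φ (1 / 2)) (hφ1 _) (fun x h0 h1 => by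
      rw [clauseOut_mixed h0 h1]
      obtain ⟨i, hi⟩ := h0
      rw [Finset.prod_eq_zero (Finset.mem_univ i) hi, sub_zero, weight_one, one_mul]
      exact min_eq_left (hφ1 _))
  have hmin (κ : Measure ℝ) [IsProbabilityMeasure κ] (hκ : Balanced κ) :
      ∫⁻ x, min (weight lam (1 - ∏ i, x i) * φ (clauseOut x)) 1 ∂power n κ
        = ∫⁻ x, weight lam (1 - ∏ i, x i) * φ (clauseOut x) ∂power n κ := by
    refine lintegral_congr_ae ?_
    filter_upwards [hκ.ae_power (n := n)] with x hx
    refine min_eq_left ?_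
    have := prod_mem_Icc (s := Finset.univ) hx
    exact mul_le_one' (weight_le_one hl (by linarith [this.2]) (by linarith [this.1])) (hφ1 _)
  rw [hmin μ hμ, hmin ν hν] at key
  refine key.trans_eq ?_
  ring

end Clause

section VarGeometry

variable {n : ℕ} {y : Fin n → ℝ}

/-- Configurations with all entries in the open unit interval. -/
def freeBox (n : ℕ) : Set (Fin n → ℝ) := univ.pi fun _ => Ioo 0 1

/-- Configurations without a zero which are not free. -/
def forced (n : ℕ) : Set (Fin n → ℝ) := noZero n \ freeBox n

lemma mem_freeBox : y ∈ freeBox n ↔ ∀ i, y i ∈ Ioo (0 : ℝ) 1 := by simp [freeBox]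

lemma measurableSet_freeBox : MeasurableSet (freeBox n) := MeasurableSet.univ_pi fun _ => measurableSet_Ioo

lemma measurableSet_forced : MeasurableSet (forced n) := measurableSet_noZero.diff measurableSet_freeBox

lemma freeBox_subset : freeBox n ⊆ noZero n := fun _ hy =>
  mem_noZero.2 fun i => (mem_freeBox.1 hy i).1.ne'

lemma reflect_mem_freeBox (hy : y ∈ freeBox n) : (fun i => 1 - y i) ∈ freeBox n :=
  mem_freeBox.2 fun i => ⟨sub_pos.2 (mem_freeBox.1 hy i).2, sub_lt_self _ (mem_freeBox.1 hy i).1⟩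

lemma mem_Icc_of_mem_freeBox (hy : y ∈ freeBox n) (i : Fin n) : y i ∈ Icc (0 : ℝ) 1 :=
  Ioo_subset_Icc_self (mem_freeBox.1 hy i)

lemma exists_one_of_forced (hy : ∀ i, y i ∈ Icc (0 : ℝ) 1) (h : y ∈ forced n) : ∃ i, y i = 1 := by
  by_contra! h1
  exact h.2 (mem_freeBox.2 fun i => ⟨lt_of_le_of_ne (hy i).1 (mem_noZero.1 h.1 i).symm,
    lt_of_le_of_ne (hy i).2 (h1 i)⟩)

lemma agree_forced (hy : ∀ i, y i ∈ Icc (0 : ℝ) 1) (h : y ∈ forced n) : agree y = ∏ i, y i := by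
  obtain ⟨i, hi⟩ := exists_one_of_forced hy h
  unfold agree
  rw [Finset.prod_eq_zero (f := fun i => 1 - y i) (Finset.mem_univ i) (by rw [hi, sub_self]),
    add_zero]

lemma prod_pos_of_forced (hy : ∀ i, y i ∈ Icc (0 : ℝ) 1) (h : y ∈ forced n) : 0 < ∏ i, y i :=
  Finset.prod_pos fun i _ => lt_of_le_of_ne (hy i).1 (mem_noZero.1 h.1 i).symm

lemma varOut_forced (hy : ∀ i, y i ∈ Icc (0 : ℝ) 1) (h : y ∈ forced n) : varOut y = 1 := by
  unfold varOut
  rw [agree_forced hy h, div_self (prod_pos_of_forced hy h).ne']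

lemma varOut_reflect (h : agree y ≠ 0) : varOut (fun i => 1 - y i) = 1 - varOut y := by
  unfold varOut
  rw [agree_reflect, eq_sub_iff_add_eq, ← add_div, div_eq_one_iff_eq h]
  unfold agree
  rw [add_comm]

lemma prod_pos_of_freeBox (h : y ∈ freeBox n) : 0 < ∏ i, y i :=
  Finset.prod_pos fun i _ => (mem_freeBox.1 h i).1

lemma agree_pos_of_freeBox (h : y ∈ freeBox n) : 0 < agree y :=
  add_pos (prod_pos_of_freeBox h) (prod_pos_of_freeBox (reflect_mem_freeBox h))

lemma varOut_free (h : y ∈ freeBox n) : varOut y ∈ Ioo (0 : ℝ) 1 := by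
  have h1 := prod_pos_of_freeBox h
  have h2 := prod_pos_of_freeBox (reflect_mem_freeBox h)
  unfold varOut agree
  refine ⟨by positivity, (div_lt_one (by positivity)).2 (by linarith)⟩

lemma varOut_mem (hy : ∀ i, y i ∈ Icc (0 : ℝ) 1) : varOut y ∈ Icc (0 : ℝ) 1 := by
  have h1 := prod_mem_Icc (s := Finset.univ) hy
  have h2 := prod_mem_Icc (s := Finset.univ) (reflect_mem hy)
  unfold varOut agree
  exact ⟨div_nonneg h1.1 (by linarith [h1.1, h2.1]),
    div_le_one_of_le₀ (by linarith [h1.1, h2.1]) (by linarith [h1.1, h2.1])⟩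

lemma weight_agree_le {lam : ℝ} (hl : 0 ≤ lam) (hl1 : lam ≤ 1) (hy : ∀ i, y i ∈ Icc (0 : ℝ) 1) :
    weight lam (agree y) ≤ ∏ i, weight lam (y i) + ∏ i, weight lam (1 - y i) := by
  unfold agree
  rw [← weight_prod _ fun i => (hy i).1, ← weight_prod _ fun i => (reflect_mem hy i).1]
  exact weight_add_le hl hl1 (prod_mem_Icc hy).1 (prod_mem_Icc (reflect_mem hy)).1

end VarGeometry

section Var

variable {m m' : Measure ℝ} [IsFiniteMeasure m] [IsFiniteMeasure m'] {n : ℕ} {lam : ℝ}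

lemma lintegral_var_split (hm : Balanced m) {G : (Fin n → ℝ) → ℝ≥0∞} (hG : Measurable G)
    (h0 : ∀ y, (∃ i, y i = 0) → (∃ i, y i = 1) → G y = 0) :
    ∫⁻ y, G y ∂power n m = ∫⁻ y in forced n, G y ∂power n m
      + ∫⁻ y in forced n, G (fun i => 1 - y i) ∂power n m + ∫⁻ y in freeBox n, G y ∂power n m := by
  have hG' : Measurable fun y : Fin n → ℝ => G fun i => 1 - y i := hG.comp measurable_reflect
  rw [← lintegral_indicator measurableSet_forced, ← lintegral_indicator measurableSet_forced,
    ← lintegral_indicator measurableSet_freeBox,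
    ← hm.lintegral_power_reflect (hG'.indicator measurableSet_forced),
    ← lintegral_add_left (hG.indicator measurableSet_forced), ← lintegral_add_left]
  swap
  · exact (hG.indicator measurableSet_forced).add
      ((hG'.indicator measurableSet_forced).comp measurable_reflect)
  refine lintegral_congr_ae ?_
  filter_upwards [hm.ae_power (n := n)] with y hy
  have hr : ∀ i, 1 - (1 - y i) = y i := fun i => by ring
  by_cases hf : y ∈ freeBox n
  · have h1 : y ∉ forced n := fun h => h.2 hf
    have h2 : (fun i => 1 - y i) ∉ forced n := fun h => h.2 (reflect_mem_freeBox hf)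
    rw [indicator_of_notMem h1, indicator_of_notMem h2, indicator_of_mem hf]
    simp
  have hf' : (fun i => 1 - y i) ∉ freeBox n := fun h => hf (by
    have := reflect_mem_freeBox h
    simpa only [hr] using this)
  rw [indicator_of_notMem hf, add_zero]
  by_cases hz : y ∈ noZero n
  · have h1 : y ∈ forced n := ⟨hz, hf⟩
    obtain ⟨i, hi⟩ := exists_one_of_forced hy h1
    have h2 : (fun i => 1 - y i) ∉ forced n := fun h => by
      have := mem_noZero.1 h.1 i
      simp [hi] at this
    rw [indicator_of_mem h1, indicator_of_notMem h2, add_zero]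
  · have h1 : y ∉ forced n := fun h => hz h.1
    rw [indicator_of_notMem h1, zero_add]
    by_cases ho : y ∈ noOne n
    · have h2 : (fun i => 1 - y i) ∈ forced n := ⟨mem_noZero.2 fun i h => mem_noOne.1 ho i (by linarith), hf'⟩
      rw [indicator_of_mem h2]
      simp only [hr]
    · have h2 : (fun i => 1 - y i) ∉ forced n := fun h => by
        apply ho
        refine mem_noOne.2 fun i hi => ?_
        have := mem_noZero.1 h.1 i
        simp [hi] at this
      rw [indicator_of_notMem h2]
      simp only [mem_noZero, mem_noOne, not_forall, not_not] at hz ho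
      exact h0 y hz ho

/-- The weight of the free messages. -/
noncomputable def freeWeight (lam : ℝ) (m : Measure ℝ) : ℝ≥0∞ := ∫⁻ t in Ioo 0 1, weight lam t ∂m

/-- The weight of all messages which allow the value one. -/
noncomputable def allWeight (lam : ℝ) (m : Measure ℝ) : ℝ≥0∞ := ∫⁻ t, weight lam t ∂m

/-- The weight of forced configurations. -/
noncomputable def forcedWeight (n : ℕ) (lam : ℝ) (m : Measure ℝ) : ℝ≥0∞ :=
  ∫⁻ y in forced n, ∏ i, weight lam (y i) ∂power n m

/-- The unnormalized integral of a function of the message sent by a free variable. -/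
noncomputable def freeOut (n : ℕ) (lam : ℝ) (m : Measure ℝ) (φ : ℝ → ℝ≥0∞) : ℝ≥0∞ :=
  ∫⁻ y in freeBox n, weight lam (agree y) * φ (varOut y) ∂power n m

omit [IsFiniteMeasure m] in
lemma allWeight_eq (hm : Balanced m) : allWeight lam m = m {1} + freeWeight lam m := by
  unfold allWeight freeWeight
  rw [hm.lintegral_eq, weight_zero, weight_one, zero_add, one_mul]

omit [IsFiniteMeasure m] in
lemma allWeight_le (hl : 0 ≤ lam) (hm : Balanced m) : allWeight lam m ≤ m univ := by
  rw [← lintegral_one]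
  refine lintegral_mono_ae ?_
  filter_upwards [hm.supp] with t ht
  exact weight_le_one hl ht.1 ht.2

omit [IsFiniteMeasure m] in
lemma freeWeight_le_allWeight : freeWeight lam m ≤ allWeight lam m := setLIntegral_le_lintegral _ _

omit [IsFiniteMeasure m] in
lemma setLIntegral_forced_add {P : (Fin n → ℝ) → ℝ≥0∞}
    (h0 : ∀ y, (∃ i, y i = 0) → P y = 0) :
    ∫⁻ y in forced n, P y ∂power n m + ∫⁻ y in freeBox n, P y ∂power n m = ∫⁻ y, P y ∂power n m := by
  have h1 : ∫⁻ y, P y ∂power n m = ∫⁻ y in noZero n, P y ∂power n m := by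
    rw [← lintegral_add_compl P (measurableSet_noZero (n := n)),
      setLIntegral_congr_fun measurableSet_noZero.compl (g := fun _ => 0)]
    · simp
    · intro y hy
      simp only [mem_compl_iff, mem_noZero, not_forall, not_not] at hy
      exact h0 y hy
  have hd : Disjoint (forced n) (freeBox n) := disjoint_sdiff_left
  rw [h1, ← lintegral_union measurableSet_freeBox hd]
  congr 2
  exact sdiff_union_of_subset freeBox_subset

lemma lintegral_freeBox {F : (Fin n → ℝ) → ℝ≥0∞} :
    ∫⁻ y in freeBox n, F y ∂power n m = ∫⁻ y, F y ∂power n (m.restrict (Ioo 0 1)) := by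
  rw [← power_restrict]; rfl

lemma lintegral_freeBox_prod {f : ℝ → ℝ≥0∞} (hf : Measurable f) :
    ∫⁻ y in freeBox n, ∏ i, f (y i) ∂power n m = (∫⁻ t in Ioo 0 1, f t ∂m) ^ n := by
  rw [lintegral_freeBox, lintegral_power_prod_const hf]

omit [IsFiniteMeasure m] in
lemma Balanced.restrict_free (hm : Balanced m) : Balanced (m.restrict (Ioo 0 1)) := by
  constructor
  · exact ae_restrict_of_ae hm.supp
  · ext s hs
    have h1 : ∀ κ : Measure ℝ, κ s = ∫⁻ t, s.indicator 1 t ∂κ := fun κ => by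
      rw [lintegral_indicator_one hs]
    rw [h1, h1, lintegral_map (measurable_one.indicator hs) (by fun_prop),
      hm.setLIntegral_reflect (measurable_one.indicator hs)]

lemma lintegral_freeBox_reflect (hm : Balanced m) {F : (Fin n → ℝ) → ℝ≥0∞} (hF : Measurable F) :
    ∫⁻ y in freeBox n, F (fun i => 1 - y i) ∂power n m = ∫⁻ y in freeBox n, F y ∂power n m := by
  rw [lintegral_freeBox, lintegral_freeBox, hm.restrict_free.lintegral_power_reflect hF]

lemma forcedWeight_add : forcedWeight n lam m + freeWeight lam m ^ n = allWeight lam m ^ n := by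
  unfold forcedWeight freeWeight allWeight
  rw [← lintegral_freeBox_prod (by fun_prop), ← lintegral_power_prod_const (by fun_prop)]
  refine setLIntegral_forced_add ?_
  rintro y ⟨i, hi⟩
  exact Finset.prod_eq_zero (Finset.mem_univ i) (by rw [hi, weight_zero])

lemma lintegral_weight_agree (hm : Balanced m) {φ : ℝ → ℝ≥0∞} (hφ : Measurable φ) :
    ∫⁻ y, weight lam (agree y) * φ (varOut y) ∂power n m
      = (φ 0 + φ 1) * forcedWeight n lam m + freeOut n lam m φ := by
  rw [lintegral_var_split hm (by fun_prop) (fun y h0 h1 => by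
    rw [agree_eq_zero h0 h1, weight_zero, zero_mul])]
  unfold freeOut forcedWeight
  rw [add_comm (φ 0), add_mul, ← lintegral_const_mul _ (by fun_prop),
    ← lintegral_const_mul _ (by fun_prop)]
  congr 2
  · refine lintegral_congr_ae ?_
    filter_upwards [ae_restrict_mem measurableSet_forced, ae_restrict_of_ae (hm.ae_power (n := n))]
      with y hy hy1
    rw [varOut_forced hy1 hy, agree_forced hy1 hy, weight_prod _ fun i => (hy1 i).1, mul_comm]
  · refine lintegral_congr_ae ?_
    filter_upwards [ae_restrict_mem measurableSet_forced, ae_restrict_of_ae (hm.ae_power (n := n))]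
      with y hy hy1
    have ha := agree_forced hy1 hy
    have h2 : agree y ≠ 0 := by rw [ha]; exact (prod_pos_of_forced hy1 hy).ne'
    rw [varOut_reflect h2, agree_reflect, varOut_forced hy1 hy, ha, weight_prod _ fun i => (hy1 i).1,
      mul_comm, sub_self]

lemma tiltedMass_agree (hm : Balanced m) : tiltedMass (power n m) lam agree
    = 2 * forcedWeight n lam m + freeOut n lam m fun _ => 1 := by
  have := lintegral_weight_agree (n := n) (lam := lam) hm (φ := fun _ => 1) measurable_const
  rw [one_add_one_eq_two] at this
  rw [← this]
  simp [tiltedMass]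

omit [IsFiniteMeasure m] in
lemma freeOut_indicator {φ : ℝ → ℝ≥0∞} :
    freeOut n lam m ((Ioo 0 1).indicator φ) = freeOut n lam m φ := by
  unfold freeOut
  refine setLIntegral_congr_fun measurableSet_freeBox fun y hy => ?_
  simp only [indicator_of_mem (varOut_free hy)]

lemma setLIntegral_varLaw (hm : Balanced m) {φ : ℝ → ℝ≥0∞} (hφ : Measurable φ) :
    ∫⁻ t in Ioo 0 1, φ t ∂tiltedLaw (power n m) lam agree varOut
      = (tiltedMass (power n m) lam agree)⁻¹ * freeOut n lam m φ := by
  rw [← lintegral_indicator measurableSet_Ioo, lintegral_tiltedLaw (by fun_prop) (by fun_prop)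
    (hφ.indicator measurableSet_Ioo), lintegral_weight_agree hm (hφ.indicator measurableSet_Ioo),
    freeOut_indicator]
  simp

lemma balanced_varLaw (hm : Balanced m) : Balanced (tiltedLaw (power n m) lam agree varOut) := by
  constructor
  · unfold tiltedLaw
    refine Measure.ae_smul_measure ?_ _
    refine (ae_map_iff (by fun_prop) measurableSet_Icc).2 ?_
    refine withDensity_absolutelyContinuous _ _ |>.ae_le ?_
    filter_upwards [hm.ae_power (n := n)] with y hy
    exact varOut_mem hy
  · ext s hs
    have h1 : ∀ κ : Measure ℝ, κ s = ∫⁻ t, s.indicator 1 t ∂κ := fun κ => by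
      rw [lintegral_indicator_one hs]
    rw [h1, h1, lintegral_map (measurable_one.indicator hs) (by fun_prop),
      lintegral_tiltedLaw (φ := fun t => s.indicator 1 (1 - t)) (by fun_prop) (by fun_prop)
        ((measurable_one.indicator hs).comp (measurable_const.sub measurable_id)),
      lintegral_tiltedLaw (by fun_prop) (by fun_prop) (measurable_one.indicator hs),
      ← hm.lintegral_power_reflect (n := n)
        (F := fun x => weight lam (agree x) * s.indicator 1 (varOut x))
        ((by fun_prop : Measurable fun x : Fin n → ℝ => weight lam (agree x)).mul
          ((measurable_one.indicator hs).comp measurable_varOut))]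
    congr 1
    refine lintegral_congr fun y => ?_
    rw [agree_reflect]
    by_cases h : agree y = 0
    · rw [h, weight_zero, zero_mul, zero_mul]
    · rw [varOut_reflect h]

lemma lintegral_freeBox_le (hl : 0 ≤ lam) (hl1 : lam ≤ 1) (hm : Balanced m)
    {F : (Fin n → ℝ) → ℝ≥0∞} (hF : Measurable F) (hr : ∀ y, F (fun i => 1 - y i) = F y) :
    ∫⁻ y in freeBox n, weight lam (agree y) * F y ∂power n m
      ≤ 2 * ∫⁻ y in freeBox n, (∏ i, weight lam (y i)) * F y ∂power n m := by
  have hp : Measurable fun y : Fin n → ℝ => ∏ i, weight lam (y i) := by fun_prop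
  have hpF : Measurable fun y : Fin n → ℝ => (∏ i, weight lam (y i)) * F y := hp.mul hF
  calc _ ≤ ∫⁻ y in freeBox n, ((∏ i, weight lam (y i)) * F y
        + (∏ i, weight lam (1 - y i)) * F y) ∂power n m := by
        refine setLIntegral_mono' measurableSet_freeBox fun y hy => ?_
        rw [← add_mul]
        gcongr
        exact weight_agree_le hl hl1 (mem_Icc_of_mem_freeBox hy)
    _ = _ := by
        rw [lintegral_add_left hpF, two_mul]
        congr 1
        rw [← lintegral_freeBox_reflect hm hpF]
        refine lintegral_congr fun y => ?_
        rw [hr]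

lemma freeOut_one_le (hl : 0 ≤ lam) (hl1 : lam ≤ 1) (hm : Balanced m) :
    freeOut n lam m (fun _ => 1) ≤ 2 * freeWeight lam m ^ n := by
  have := lintegral_freeBox_le (n := n) hl hl1 hm (F := fun _ => 1) measurable_const fun _ => rfl
  simp only [mul_one] at this
  rw [lintegral_freeBox_prod (by fun_prop)] at this
  simpa [freeOut, freeWeight] using this

/-- The free messages, weighted. -/
noncomputable def freeMeasure (lam : ℝ) (m : Measure ℝ) : Measure ℝ :=
  (m.restrict (Ioo 0 1)).withDensity (weight lam)

omit [IsFiniteMeasure m] in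
lemma lintegral_freeMeasure {φ : ℝ → ℝ≥0∞} (hφ : Measurable φ) :
    ∫⁻ t, φ t ∂freeMeasure lam m = ∫⁻ t in Ioo 0 1, weight lam t * φ t ∂m :=
  lintegral_withDensity_eq_lintegral_mul _ (measurable_weight lam) hφ

omit [IsFiniteMeasure m] in
lemma freeMeasure_univ : freeMeasure lam m univ = freeWeight lam m := by
  rw [← lintegral_one, lintegral_freeMeasure measurable_const]
  simp [freeWeight]

lemma allWeight_ne_top (hl : 0 ≤ lam) (hm : Balanced m) : allWeight lam m ≠ ∞ :=
  ne_top_of_le_ne_top (measure_ne_top m univ) (allWeight_le hl hm)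

lemma freeWeight_ne_top (hl : 0 ≤ lam) (hm : Balanced m) : freeWeight lam m ≠ ∞ :=
  ne_top_of_le_ne_top (allWeight_ne_top hl hm) freeWeight_le_allWeight

lemma isFiniteMeasure_freeMeasure (hl : 0 ≤ lam) (hm : Balanced m) :
    IsFiniteMeasure (freeMeasure lam m) :=
  ⟨by rw [freeMeasure_univ]; exact (freeWeight_ne_top hl hm).lt_top⟩

lemma lintegral_power_freeMeasure (hl : 0 ≤ lam) (hm : Balanced m) {F : (Fin n → ℝ) → ℝ≥0∞}
    (hF : Measurable F) : ∫⁻ y, F y ∂power n (freeMeasure lam m)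
      = ∫⁻ y in freeBox n, (∏ i, weight lam (y i)) * F y ∂power n m := by
  have : IsFiniteMeasure ((m.restrict (Ioo 0 1)).withDensity (weight lam)) :=
    isFiniteMeasure_freeMeasure hl hm
  unfold freeMeasure
  rw [power_withDensity (measurable_weight lam), lintegral_freeBox]
  exact lintegral_withDensity_eq_lintegral_mul _ (by fun_prop) hF

/-- The Lipschitz estimate for the free part of the variable recursion. -/
lemma freeOut_near (hl : 0 ≤ lam) (hl1 : lam ≤ 1) (hm : Balanced m) (hm' : Balanced m')
    {δ M : ℝ≥0∞} (h : Near δ (freeMeasure lam m) (freeMeasure lam m')) (hM : M ≠ ∞)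
    (hmM : freeWeight lam m ≤ M) (hmM' : freeWeight lam m' ≤ M) {φ : ℝ → ℝ≥0∞} (hφ : Measurable φ)
    (hφ1 : ∀ t, φ t ≤ 1) :
    freeOut n lam m φ ≤ freeOut n lam m' φ + 2 * (n * M ^ (n - 1) * δ) := by
  have := isFiniteMeasure_freeMeasure hl hm
  have := isFiniteMeasure_freeMeasure hl hm'
  have hn := h.power hM (by rwa [freeMeasure_univ]) (by rwa [freeMeasure_univ]) n
  set D : (Fin n → ℝ) → ℝ≥0∞ := fun y => ∏ i, weight lam (y i) + ∏ i, weight lam (1 - y i) with hD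
  set G : (Fin n → ℝ) → ℝ≥0∞ := fun y => min (weight lam (agree y) * φ (varOut y) / D y) 1 with hG
  have hp : Measurable fun y : Fin n → ℝ => ∏ i, weight lam (y i) := by fun_prop
  have hp' : Measurable fun y : Fin n → ℝ => ∏ i, weight lam (1 - y i) := by fun_prop
  have hDm : Measurable D := hp.add hp'
  have hGm : Measurable G := by
    refine Measurable.min ?_ measurable_const
    refine Measurable.div ?_ hDm
    fun_prop
  have key (κ : Measure ℝ) [IsFiniteMeasure κ] (hκ : Balanced κ) :
      freeOut n lam κ φ = ∫⁻ y, G y ∂power n (freeMeasure lam κ)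
        + ∫⁻ y, G (fun i => 1 - y i) ∂power n (freeMeasure lam κ) := by
    have hpG : Measurable fun y : Fin n → ℝ => (∏ i, weight lam (y i)) * G y := hp.mul hGm
    have hpG' : Measurable fun y : Fin n → ℝ => (∏ i, weight lam (1 - y i)) * G y := hp'.mul hGm
    have hGr : Measurable fun y : Fin n → ℝ => G fun i => 1 - y i := hGm.comp measurable_reflect
    rw [lintegral_power_freeMeasure hl hκ hGm, lintegral_power_freeMeasure hl hκ hGr]
    have h2 : ∫⁻ y in freeBox n, (∏ i, weight lam (y i)) * G (fun i => 1 - y i) ∂power n κ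
        = ∫⁻ y in freeBox n, (∏ i, weight lam (1 - y i)) * G y ∂power n κ := by
      rw [← lintegral_freeBox_reflect hκ hpG']
      refine lintegral_congr fun y => ?_
      simp only [sub_sub_cancel]
    rw [h2, ← lintegral_add_left hpG]
    refine setLIntegral_congr_fun measurableSet_freeBox fun y hy => ?_
    have h3 : weight lam (agree y) * φ (varOut y) ≤ D y := by
      calc _ ≤ D y * 1 := by
            gcongr
            · exact weight_agree_le hl hl1 (mem_Icc_of_mem_freeBox hy)
            · exact hφ1 _
        _ = D y := mul_one _
    have h4 : D y ≠ 0 := by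
      have : ∏ i, weight lam (y i) ≠ 0 := Finset.prod_ne_zero_iff.2 fun i _ => by
        have h5 := (mem_freeBox.1 hy i).1
        rw [weight_of_pos h5]
        simpa using Real.rpow_pos_of_pos h5 lam
      simp only [hD]
      intro h
      exact this (add_eq_zero.1 h).1
    have h5 : D y ≠ ∞ := by
      simp only [hD]
      exact ENNReal.add_ne_top.2 ⟨ENNReal.prod_ne_top fun i _ => weight_ne_top _ _,
        ENNReal.prod_ne_top fun i _ => weight_ne_top _ _⟩
    have h6 : G y = weight lam (agree y) * φ (varOut y) / D y :=
      min_eq_left (ENNReal.div_le_of_le_mul (by rwa [one_mul]))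
    simp only [← add_mul]
    rw [h6]
    exact (ENNReal.mul_div_cancel h4 h5).symm
  rw [key m hm, key m' hm']
  have a1 := hn G hGm fun y => min_le_right _ _
  have a2 := hn (fun y => G fun i => 1 - y i) (hGm.comp measurable_reflect) fun y => min_le_right _ _
  calc _ ≤ _ := add_le_add a1 a2
    _ = _ := by ring

end Var

/-- The range of parameters: `θ = 2 ^ (1 - k)` is small even after multiplication by `k ^ 12`,
and `N` is within `k ^ O(1)` of `k * 2 ^ (k - 1) * log 2`. -/
structure Regime (k N : ℕ) (θ : ℝ) : Prop where
  theta : θ = (1 / 2) ^ (k - 1)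
  large : 100 ≤ k
  small : (k : ℝ) ^ 12 * θ ≤ 1
  upper : N * θ ≤ k * Real.log 2
  lower : k * Real.log 2 - 4 * k * θ ≤ N * θ

namespace Regime

variable {k N : ℕ} {θ : ℝ} (h : Regime k N θ)
include h

lemma theta_pos : 0 < θ := by rw [h.theta]; positivity

lemma k_ge : (100 : ℝ) ≤ k := by exact_mod_cast h.large

lemma small_two : (10 : ℝ) ^ 20 * ((k : ℝ) ^ 2 * θ) ≤ 1 := by
  refine le_trans ?_ h.small
  have h1 : (10 : ℝ) ^ 20 ≤ (k : ℝ) ^ 10 := by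
    calc (10 : ℝ) ^ 20 = 100 ^ 10 := by norm_num
      _ ≤ _ := by gcongr; exact h.k_ge
  have h2 := h.theta_pos
  calc (10 : ℝ) ^ 20 * ((k : ℝ) ^ 2 * θ) ≤ (k : ℝ) ^ 10 * ((k : ℝ) ^ 2 * θ) := by gcongr
    _ = _ := by ring

lemma small_one : (10 : ℝ) ^ 20 * ((k : ℝ) * θ) ≤ 1 := by
  refine le_trans ?_ h.small_two
  have h2 := h.theta_pos
  have h3 := h.k_ge
  gcongr
  nlinarith

lemma small_zero : (10 : ℝ) ^ 20 * θ ≤ 1 := by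
  refine le_trans ?_ h.small_one
  have h2 := h.theta_pos
  have h3 := h.k_ge
  gcongr
  nlinarith

lemma N_pos : 0 < N := by
  by_contra h0
  have : N = 0 := by omega
  have h1 := h.lower
  have h2 := h.small_one
  have h3 := h.k_ge
  have h4 := Real.log_two_gt_d9
  rw [this] at h1
  norm_num at h1
  nlinarith

lemma exp_eq : Real.exp (-(k * Real.log 2)) = θ / 2 := by
  have hk := h.large
  rw [h.theta, Real.exp_neg, mul_comm, Real.exp_mul, Real.exp_log two_pos, Real.rpow_natCast]
  obtain ⟨m, rfl⟩ : ∃ m, k = m + 1 := ⟨k - 1, by omega⟩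
  rw [Nat.add_sub_cancel, pow_succ, one_div, inv_pow, mul_inv]
  ring

lemma theta_sq_le : (10 : ℝ) ^ 20 * (k * θ ^ 2) ≤ θ := by
  have := h.theta_pos
  calc (10 : ℝ) ^ 20 * (k * θ ^ 2) = (10 : ℝ) ^ 20 * (k * θ) * θ := by ring
    _ ≤ 1 * θ := by gcongr; exact h.small_one
    _ = θ := one_mul θ

lemma k_theta_le : (k : ℝ) * θ ≤ k ^ 2 * θ := by
  have := h.theta_pos
  have := h.k_ge
  gcongr
  nlinarith

lemma N_mul_le : (N : ℝ) * (8 * (k * θ ^ 2)) ≤ 8 * (k ^ 2 * θ) := by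
  have hθ := h.theta_pos
  have hl2 := Real.log_two_lt_d9
  calc (N : ℝ) * (8 * (k * θ ^ 2)) = 8 * (k * θ) * (N * θ) := by ring
    _ ≤ 8 * (k * θ) * (k * Real.log 2) := mul_le_mul_of_nonneg_left h.upper (by positivity)
    _ ≤ 8 * (k * θ) * (k * 1) := by gcongr; linarith
    _ = _ := by ring

lemma pow_le {K T : ℝ} (hK0 : 0 ≤ K) (hK : K ≤ 1 - 2 * θ + 2 * k * θ ^ 2)
    (hT : 1 - θ - 2 * k * θ ^ 2 ≤ T) : K ^ N ≤ θ / 2 * (1 + 100 * (k ^ 2 * θ)) * T ^ N := by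
  have hθ := h.theta_pos
  have hs := h.small_one
  have hs0 := h.small_zero
  have hs2 := h.small_two
  have hk := h.k_ge
  have hl2 := Real.log_two_lt_d9
  have e1 : (k : ℝ) * θ ^ 2 = (k * θ) * θ := by ring
  have hT0 : 0 ≤ T := by nlinarith
  have h1 : K ≤ Real.exp (-θ + 8 * (k * θ ^ 2)) * T := by
    have h2 : 1 - θ + 8 * (k * θ ^ 2) ≤ Real.exp (-θ + 8 * (k * θ ^ 2)) := by
      linarith [Real.add_one_le_exp (-θ + 8 * (k * θ ^ 2))]
    have h3 : 0 ≤ 1 - θ + 8 * (k * θ ^ 2) := by nlinarith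
    calc K ≤ 1 - 2 * θ + 2 * k * θ ^ 2 := hK
      _ ≤ (1 - θ + 8 * (k * θ ^ 2)) * (1 - θ - 2 * k * θ ^ 2) := by
          have hu := h.theta_sq_le
          have hu0 : 0 < k * θ ^ 2 := by positivity
          rw [mul_assoc 2]
          generalize (k : ℝ) * θ ^ 2 = u at *
          nlinarith [mul_nonneg hu0.le (by linarith : 0 ≤ 1 / 100 - θ),
            mul_nonneg hu0.le (by linarith : 0 ≤ 1 / 100 - u), sq_nonneg θ]
      _ ≤ _ := by
          gcongr
          nlinarith
  have h4 : (N : ℝ) * (-θ + 8 * (k * θ ^ 2)) ≤ -(k * Real.log 2) + 12 * (k ^ 2 * θ) := by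
    have h5 := h.lower
    have h6 := h.N_mul_le
    linarith [h.k_theta_le]
  have h7 : Real.exp (12 * (k ^ 2 * θ)) ≤ 1 + 100 * (k ^ 2 * θ) := by
    have h8 : 12 * ((k : ℝ) ^ 2 * θ) ≤ 1 := by nlinarith
    have h9 : 0 ≤ 12 * ((k : ℝ) ^ 2 * θ) := by positivity
    have := Real.abs_exp_sub_one_le (x := 12 * ((k : ℝ) ^ 2 * θ)) (by rwa [abs_of_nonneg h9])
    rw [abs_of_nonneg h9] at this
    have := le_abs_self (Real.exp (12 * ((k : ℝ) ^ 2 * θ)) - 1)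
    nlinarith
  calc K ^ N ≤ (Real.exp (-θ + 8 * (k * θ ^ 2)) * T) ^ N := by gcongr
    _ = Real.exp (N * (-θ + 8 * (k * θ ^ 2))) * T ^ N := by rw [mul_pow, ← Real.exp_nat_mul]
    _ ≤ Real.exp (-(k * Real.log 2) + 12 * (k ^ 2 * θ)) * T ^ N := by gcongr
    _ = θ / 2 * Real.exp (12 * (k ^ 2 * θ)) * T ^ N := by rw [Real.exp_add, h.exp_eq]
    _ ≤ _ := by gcongr

lemma le_pow {b K T : ℝ} (hb : b ≤ θ) (hTK : T = b + K)
    (hT : 1 - θ - 2 * k * θ ^ 2 ≤ T) : θ / 2 * (1 - 100 * (k ^ 2 * θ)) * T ^ N ≤ K ^ N := by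
  have hθ := h.theta_pos
  have hs := h.small_one
  have hs0 := h.small_zero
  have hs2 := h.small_two
  have hk := h.k_ge
  have hl2 := Real.log_two_lt_d9
  have e1 : (k : ℝ) * θ ^ 2 = (k * θ) * θ := by ring
  have hT0 : 0 < T := by nlinarith
  have h0 : 0 ≤ 1 - θ - 2 * θ ^ 2 := by nlinarith
  have h1 : Real.exp (-θ - 8 * (k * θ ^ 2)) * T ≤ K := by
    have h2 : Real.exp (-θ - 8 * (k * θ ^ 2)) ≤ 1 - θ - 4 * (θ * θ) := by
      have hx : 0 ≤ θ + 8 * (k * θ ^ 2) := by positivity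
      have hx1 : θ + 8 * (k * θ ^ 2) ≤ 1 := by nlinarith
      have := Real.abs_exp_sub_one_sub_id_le (x := -θ - 8 * (k * θ ^ 2))
        (by rw [abs_le]; constructor <;> linarith)
      have h3 := (abs_le.1 this).2
      have h4 : (-θ - 8 * (k * θ ^ 2)) ^ 2 ≤ 4 * (θ * θ) := by
        have h5 : θ + 8 * (k * θ ^ 2) ≤ 2 * θ := by nlinarith
        nlinarith
      have h6 : 100 * (θ * θ) ≤ k * θ ^ 2 := by nlinarith [mul_pos hθ hθ]
      nlinarith [mul_pos hθ hθ]
    calc _ ≤ (1 - θ - 4 * (θ * θ)) * T := by gcongr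
      _ ≤ T - θ := by
          have hT2 : 1 - 2 * θ ≤ T := by linarith [h.theta_sq_le]
          nlinarith [mul_pos hθ hθ, mul_le_mul_of_nonneg_left hT2 (by positivity : 0 ≤ θ + 4 * (θ * θ)),
            mul_nonneg (mul_pos hθ hθ).le (by linarith : 0 ≤ 1 / 100 - θ)]
      _ ≤ K := by linarith
  have h4 : -(k * Real.log 2) - 8 * (k ^ 2 * θ) ≤ (N : ℝ) * (-θ - 8 * (k * θ ^ 2)) := by
    have h5 := h.upper
    have h6 := h.N_mul_le
    linarith
  have h7 : 1 - 100 * (k ^ 2 * θ) ≤ Real.exp (-(8 * (k ^ 2 * θ))) := by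
    have : 0 ≤ (k : ℝ) ^ 2 * θ := by positivity
    linarith [Real.add_one_le_exp (-(8 * ((k : ℝ) ^ 2 * θ)))]
  calc _ ≤ θ / 2 * Real.exp (-(8 * (k ^ 2 * θ))) * T ^ N := by gcongr
    _ = Real.exp (-(k * Real.log 2) - 8 * (k ^ 2 * θ)) * T ^ N := by
        rw [sub_eq_add_neg, Real.exp_add, h.exp_eq]
    _ ≤ Real.exp (N * (-θ - 8 * (k * θ ^ 2))) * T ^ N := by gcongr
    _ = (Real.exp (-θ - 8 * (k * θ ^ 2)) * T) ^ N := by rw [mul_pow, ← Real.exp_nat_mul]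
    _ ≤ _ := by gcongr

lemma pow_le_two_mul {T T' : ℝ} (hT0 : 0 ≤ T') (hT' : T' ≤ 1 - θ + k * θ ^ 2)
    (hT : 1 - θ - 2 * k * θ ^ 2 ≤ T) : T' ^ N ≤ 2 * T ^ N := by
  have hθ := h.theta_pos
  have hs := h.small_one
  have hs0 := h.small_zero
  have hs2 := h.small_two
  have hk := h.k_ge
  have hl2 := Real.log_two_lt_d9
  have e1 : (k : ℝ) * θ ^ 2 = (k * θ) * θ := by ring
  have hp : 0 < k * θ ^ 2 := by positivity
  have hT0' : 0 < T := by nlinarith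
  have h1 : T' ≤ Real.exp (8 * (k * θ ^ 2)) * T := by
    have h2 : 1 + 8 * (k * θ ^ 2) ≤ Real.exp (8 * (k * θ ^ 2)) := by
      linarith [Real.add_one_le_exp (8 * (k * θ ^ 2))]
    calc T' ≤ (1 + 8 * (k * θ ^ 2)) * (1 - θ - 2 * k * θ ^ 2) := by
          have hu := h.theta_sq_le
          rw [mul_assoc 2]
          generalize (k : ℝ) * θ ^ 2 = u at *
          nlinarith [mul_nonneg hp.le (by linarith : 0 ≤ 1 / 100 - θ),
            mul_nonneg hp.le (by linarith : 0 ≤ 1 / 100 - u)]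
      _ ≤ _ := by gcongr; nlinarith
  have h6 := h.N_mul_le
  have h7 : Real.exp (8 * (k ^ 2 * θ)) ≤ 2 := by
    have h9 : 0 ≤ 8 * ((k : ℝ) ^ 2 * θ) := by positivity
    have := Real.abs_exp_sub_one_le (x := 8 * ((k : ℝ) ^ 2 * θ)) (by rw [abs_of_nonneg h9]; nlinarith)
    rw [abs_of_nonneg h9] at this
    have := le_abs_self (Real.exp (8 * ((k : ℝ) ^ 2 * θ)) - 1)
    nlinarith
  calc T' ^ N ≤ (Real.exp (8 * (k * θ ^ 2)) * T) ^ N := by gcongr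
    _ = Real.exp (N * (8 * (k * θ ^ 2))) * T ^ N := by rw [mul_pow, ← Real.exp_nat_mul]
    _ ≤ Real.exp (8 * (k ^ 2 * θ)) * T ^ N := by gcongr
    _ ≤ _ := by gcongr

end Regime

section Cost

/-- The deviation of a free message from `1 / 2`. -/
noncomputable def cost (t : ℝ) : ℝ≥0∞ :=
  (if t = 1 / 2 then 0 else 1) + ENNReal.ofReal |Real.log ((1 - t) / t)|

@[fun_prop]
lemma measurable_cost : Measurable cost := by
  unfold cost
  exact (Measurable.ite (measurableSet_singleton _) measurable_const measurable_const).add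
    (by fun_prop)

lemma neg_log_le {t : ℝ} (ht : t ∈ Ioo (0 : ℝ) 1) :
    -Real.log t ≤ Real.log 2 + |Real.log ((1 - t) / t)| := by
  have h1 : 0 < 1 - t := sub_pos.2 ht.2
  rw [Real.log_div h1.ne' ht.1.ne']
  rcases le_total t (1 / 2) with h | h
  · have h2 : -Real.log 2 ≤ Real.log (1 - t) := by
      rw [← Real.log_inv]
      exact Real.log_le_log (by norm_num) (by norm_num; linarith)
    have := le_abs_self (Real.log (1 - t) - Real.log t)
    linarith
  · have h2 : -Real.log 2 ≤ Real.log t := by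
      rw [← Real.log_inv]
      exact Real.log_le_log (by norm_num) (by norm_num; linarith)
    have := abs_nonneg (Real.log (1 - t) - Real.log t)
    linarith

lemma abs_log_reflect {t : ℝ} : |Real.log ((1 - (1 - t)) / (1 - t))| = |Real.log ((1 - t) / t)| := by
  rw [sub_sub_cancel, ← inv_div, Real.log_inv, abs_neg]

lemma cost_reflect (t : ℝ) : cost (1 - t) = cost t := by
  unfold cost
  rw [abs_log_reflect]
  congr 1
  have : 1 - t = 1 / 2 ↔ t = 1 / 2 := by constructor <;> intro h <;> linarith
  simp only [this]

lemma neg_log_one_sub_le {t : ℝ} (ht : t ∈ Ioo (0 : ℝ) 1) :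
    -Real.log (1 - t) ≤ Real.log 2 + |Real.log ((1 - t) / t)| := by
  have := neg_log_le (t := 1 - t) ⟨sub_pos.2 ht.2, sub_lt_self _ ht.1⟩
  rwa [abs_log_reflect] at this

lemma ofReal_abs_le_cost (t : ℝ) : ENNReal.ofReal |Real.log ((1 - t) / t)| ≤ cost t := le_add_self

lemma ofReal_log_two_add_le {t : ℝ} :
    ENNReal.ofReal (Real.log 2 + |Real.log ((1 - t) / t)|) ≤ 1 + cost t := by
  rw [ENNReal.ofReal_add (Real.log_nonneg one_le_two) (abs_nonneg _)]
  gcongr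
  · rw [ENNReal.ofReal_le_one]; linarith [Real.log_two_lt_d9]
  · exact ofReal_abs_le_cost t

lemma cost_half : cost (1 / 2) = 0 := by
  unfold cost
  norm_num

lemma log_varOut {n : ℕ} {y : Fin n → ℝ} (hy : y ∈ freeBox n) :
    Real.log ((1 - varOut y) / varOut y) = ∑ i, Real.log ((1 - y i) / y i) := by
  have h1 := prod_pos_of_freeBox hy
  have h2 := prod_pos_of_freeBox (reflect_mem_freeBox hy)
  have h3 := agree_pos_of_freeBox hy
  have h4 : (1 - varOut y) / varOut y = ∏ i, ((1 - y i) / y i) := by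
    rw [← varOut_reflect h3.ne', Finset.prod_div_distrib]
    unfold varOut
    rw [agree_reflect]
    field_simp
  rw [h4, Real.log_prod fun i _ => ?_]
  have := mem_freeBox.1 hy i
  exact (div_pos (sub_pos.2 this.2) this.1).ne'

lemma cost_varOut_le {n : ℕ} {y : Fin n → ℝ} (hy : y ∈ freeBox n) :
    cost (varOut y) ≤ ∑ i, cost (y i) := by
  unfold cost
  rw [Finset.sum_add_distrib]
  gcongr
  · by_cases h : ∀ i, y i = 1 / 2
    · have h1 : varOut y = 1 / 2 := by
        unfold varOut agree
        simp only [h]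
        norm_num
        field_simp
        norm_num
      rw [if_pos h1]
      exact bot_le
    · push Not at h
      obtain ⟨i, hi⟩ := h
      calc (if varOut y = 1 / 2 then (0 : ℝ≥0∞) else 1) ≤ 1 := by split_ifs <;> simp
        _ = if y i = 1 / 2 then 0 else 1 := by rw [if_neg hi]
        _ ≤ _ := Finset.single_le_sum (f := fun i => if y i = 1 / 2 then (0 : ℝ≥0∞) else 1)
            (fun _ _ => bot_le) (Finset.mem_univ i)
  · rw [log_varOut hy, ← ENNReal.ofReal_sum_of_nonneg fun i _ => abs_nonneg _]
    exact ENNReal.ofReal_le_ofReal (Finset.abs_sum_le_sum_abs _ _)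

end Cost

section ClauseBounds

variable {μ : Measure ℝ} [IsProbabilityMeasure μ] {n : ℕ} {lam : ℝ}

lemma allWeight_clauseRaw (hn : 0 < n) (hμ : Balanced μ) :
    allWeight lam (clauseRaw n lam μ) = ∫⁻ x, weight lam (1 - ∏ i, x i) ∂power n μ := by
  have := lintegral_clauseRaw_weight (lam := lam) hn hμ (φ := fun _ => 1) measurable_const
  simpa [allWeight] using this

lemma allWeight_add_le (hn : 0 < n) (hμ : Balanced μ) (hl : 0 ≤ lam) :
    allWeight lam (clauseRaw n lam μ) + μ {1} ^ n ≤ 1 := by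
  have h : μ {1} ^ n = power n μ {fun _ => 1} := by
    unfold power; rw [Measure.pi_singleton]; simp
  rw [h, allWeight_clauseRaw hn hμ, ← lintegral_indicator_one (measurableSet_singleton _),
    ← lintegral_add_left (by fun_prop)]
  calc _ ≤ ∫⁻ _, 1 ∂power n μ := by
        refine lintegral_mono_ae ?_
        filter_upwards [hμ.ae_power (n := n)] with x hx
        have hp := prod_mem_Icc (s := Finset.univ) hx
        by_cases h1 : x = fun _ => 1
        · rw [indicator_of_mem (by simpa using h1)]
          simp [h1, weight_zero]
        · rw [indicator_of_notMem (by simpa using h1), add_zero]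
          exact weight_le_one hl (by linarith [hp.2]) (by linarith [hp.1])
    _ = 1 := by simp

lemma one_le_allWeight_add (hn : 0 < n) (hμ : Balanced μ) :
    1 ≤ allWeight lam (clauseRaw n lam μ) + μ {0}ᶜ ^ n := by
  have h : μ {0}ᶜ ^ n = power n μ (noZero n) := by
    unfold power noZero; rw [Measure.pi_pi]; simp
  rw [h, allWeight_clauseRaw hn hμ, ← lintegral_indicator_one measurableSet_noZero,
    ← lintegral_add_left (by fun_prop)]
  calc (1 : ℝ≥0∞) = ∫⁻ _, 1 ∂power n μ := by simp
    _ ≤ _ := by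
        refine lintegral_mono fun x => ?_
        by_cases h1 : x ∈ noZero n
        · rw [indicator_of_mem h1]
          exact le_add_self
        · rw [indicator_of_notMem h1, add_zero]
          simp only [mem_noZero, not_forall, not_not] at h1
          obtain ⟨i, hi⟩ := h1
          rw [Finset.prod_eq_zero (Finset.mem_univ i) hi, sub_zero, weight_one]

/-- A first-order bound for integrals over configurations with a free entry. -/
lemma lintegral_one_free {g : ℝ → ℝ≥0∞} (hg : Measurable g) (hμ : Balanced μ) :
    ∫⁻ x : Fin n → ℝ, ∑ i, (Ioo 0 1).indicator g (x i)
        * (∏ j ∈ Finset.univ.erase i, ({0}ᶜ : Set ℝ).indicator 1 (x j)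
          + ∏ j ∈ Finset.univ.erase i, ({1}ᶜ : Set ℝ).indicator 1 (x j)) ∂power n μ
      = n * (2 * ((∫⁻ t in Ioo 0 1, g t ∂μ) * μ {0}ᶜ ^ (n - 1))) := by
  have m0 : Measurable (({0}ᶜ : Set ℝ).indicator (1 : ℝ → ℝ≥0∞)) :=
    measurable_one.indicator (measurableSet_singleton _).compl
  have m1 : Measurable (({1}ᶜ : Set ℝ).indicator (1 : ℝ → ℝ≥0∞)) :=
    measurable_one.indicator (measurableSet_singleton _).compl
  have mg : Measurable ((Ioo (0 : ℝ) 1).indicator g) := hg.indicator measurableSet_Ioo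
  have p0 (i : Fin n) : Measurable fun x : Fin n → ℝ => (Ioo (0 : ℝ) 1).indicator g (x i)
      * ∏ j ∈ Finset.univ.erase i, ({0}ᶜ : Set ℝ).indicator (1 : ℝ → ℝ≥0∞) (x j) :=
    (mg.comp (measurable_pi_apply i)).mul
      (Finset.measurable_prod _ fun j _ => m0.comp (measurable_pi_apply j))
  have p1 (i : Fin n) : Measurable fun x : Fin n → ℝ => (Ioo (0 : ℝ) 1).indicator g (x i)
      * ∏ j ∈ Finset.univ.erase i, ({1}ᶜ : Set ℝ).indicator (1 : ℝ → ℝ≥0∞) (x j) :=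
    (mg.comp (measurable_pi_apply i)).mul
      (Finset.measurable_prod _ fun j _ => m1.comp (measurable_pi_apply j))
  simp only [mul_add]
  rw [lintegral_finsetSum]
  · simp only [lintegral_add_left (p0 _), lintegral_power_single m0 mg, lintegral_power_single m1 mg,
      lintegral_indicator_one (measurableSet_singleton _).compl, lintegral_indicator measurableSet_Ioo,
      hμ.mass_ne_zero, hμ.mass_ne_one, Finset.sum_const, Finset.card_univ, Fintype.card_fin,
      nsmul_eq_mul, ← two_mul]
  · exact fun i _ => (p0 i).add (p1 i)

lemma exists_free_of_clauseOut (hn : 0 < n) {x : Fin n → ℝ} (hx : ∀ i, x i ∈ Icc (0 : ℝ) 1)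
    (h : clauseOut x ∈ Ioo (0 : ℝ) 1) (hmix : ¬((∃ i, x i = 0) ∧ ∃ i, x i = 1)) :
    ∃ i, x i ∈ Ioo (0 : ℝ) 1 := by
  by_contra! hf
  have h01 : ∀ i, x i = 0 ∨ x i = 1 := fun i => by
    by_contra! h2
    exact hf i ⟨lt_of_le_of_ne (hx i).1 h2.1.symm, lt_of_le_of_ne (hx i).2 h2.2⟩
  by_cases h0 : ∃ i, x i = 0
  · have h1 : ∀ i, x i = 0 := fun i => (h01 i).resolve_right fun h1 => hmix ⟨h0, i, h1⟩
    have : clauseOut x = 1 := by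
      unfold clauseOut agree
      simp [h1, hn.ne']
      norm_num
    rw [this] at h
    exact lt_irrefl _ h.2
  · have h1 : ∀ i, x i = 1 := fun i => (h01 i).resolve_left fun h1 => h0 ⟨i, h1⟩
    have : clauseOut x = 0 := by
      unfold clauseOut agree
      simp [h1]
    rw [this] at h
    exact lt_irrefl _ h.1

lemma clause_log_bounds {x : Fin n → ℝ} (hx : ∀ i, x i ∈ Icc (0 : ℝ) 1) {i : Fin n}
    (hi : x i ∈ Ioo (0 : ℝ) 1) :
    0 < 1 - ∏ j, x j ∧ 0 < 1 - ∏ j, (1 - x j) ∧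
    -Real.log (1 - ∏ j, x j) ≤ Real.log 2 + |Real.log ((1 - x i) / x i)| ∧
    -Real.log (1 - ∏ j, (1 - x j)) ≤ Real.log 2 + |Real.log ((1 - x i) / x i)| := by
  have h1 := prod_le_of_mem hx (Finset.mem_univ i)
  have h2 := prod_le_of_mem (reflect_mem hx) (Finset.mem_univ i)
  have h3 : x i ≤ 1 - ∏ j, (1 - x j) := by linarith
  have h4 : 1 - x i ≤ 1 - ∏ j, x j := by linarith
  have h5 := hi.1
  have h6 := hi.2
  refine ⟨by linarith, by linarith, ?_, ?_⟩
  · have := Real.log_le_log (by linarith) h4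
    linarith [neg_log_one_sub_le hi]
  · have := Real.log_le_log h5 h3
    linarith [neg_log_le hi]

lemma clauseOut_ratio (hn : 0 < n) {x : Fin n → ℝ} (hx : ∀ i, x i ∈ Icc (0 : ℝ) 1) :
    (1 - clauseOut x) / clauseOut x = (1 - ∏ i, (1 - x i)) / (1 - ∏ i, x i) := by
  have := agree_le_one hn hx
  rw [← clauseOut_mul hn hx, ← clauseOut_mul' hn hx, mul_div_mul_left _ _ (by linarith)]

lemma cost_clauseOut_le (hn : 0 < n) {x : Fin n → ℝ} (hx : ∀ i, x i ∈ Icc (0 : ℝ) 1) {i : Fin n}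
    (hi : x i ∈ Ioo (0 : ℝ) 1) : cost (clauseOut x) ≤ 2 + cost (x i) := by
  obtain ⟨h1, h2, h3, h4⟩ := clause_log_bounds hx hi
  have hp1 := prod_mem_Icc (s := Finset.univ) hx
  have hp2 := prod_mem_Icc (s := Finset.univ) (reflect_mem hx)
  have h5 : |Real.log ((1 - clauseOut x) / clauseOut x)|
      ≤ Real.log 2 + |Real.log ((1 - x i) / x i)| := by
    rw [clauseOut_ratio hn hx, Real.log_div h2.ne' h1.ne', abs_le]
    have h6 := Real.log_nonpos h1.le (by linarith [hp1.1])
    have h7 := Real.log_nonpos h2.le (by linarith [hp2.1])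
    constructor <;> linarith
  calc cost (clauseOut x) ≤ 1 + ENNReal.ofReal (Real.log 2 + |Real.log ((1 - x i) / x i)|) := by
        unfold cost
        gcongr
        split_ifs <;> simp
    _ ≤ 1 + (1 + cost (x i)) := by gcongr; exact ofReal_log_two_add_le
    _ = 2 + cost (x i) := by rw [← add_assoc, one_add_one_eq_two]

lemma one_le_noZero_add_noOne {x : Fin n → ℝ} (hmix : ¬((∃ i, x i = 0) ∧ ∃ i, x i = 1))
    (s : Finset (Fin n)) : 1 ≤ ∏ j ∈ s, ({0}ᶜ : Set ℝ).indicator (1 : ℝ → ℝ≥0∞) (x j)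
      + ∏ j ∈ s, ({1}ᶜ : Set ℝ).indicator (1 : ℝ → ℝ≥0∞) (x j) := by
  rcases not_and_or.1 hmix with h | h
  · push Not at h
    rw [Finset.prod_eq_one fun j _ => by rw [indicator_of_mem (h j)]; rfl]
    exact le_self_add
  · push Not at h
    rw [add_comm, Finset.prod_eq_one fun j _ => by rw [indicator_of_mem (h j)]; rfl]
    exact le_self_add

lemma freeWeight_cost_le (hn : 0 < n) (hμ : Balanced μ) (hl : 0 ≤ lam) :
    ∫⁻ t in Ioo 0 1, weight lam t * cost t ∂clauseRaw n lam μ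
      ≤ n * (2 * ((2 * μ (Ioo 0 1) + ∫⁻ t in Ioo 0 1, cost t ∂μ) * μ {0}ᶜ ^ (n - 1))) := by
  have h1 : 2 * μ (Ioo 0 1) + ∫⁻ t in Ioo 0 1, cost t ∂μ = ∫⁻ t in Ioo 0 1, (2 + cost t) ∂μ := by
    rw [lintegral_add_left measurable_const, setLIntegral_const]
  have h2 : ∫⁻ t in Ioo 0 1, weight lam t * cost t ∂clauseRaw n lam μ
      = ∫⁻ t, weight lam t * (Ioo 0 1).indicator cost t ∂clauseRaw n lam μ := by
    rw [← lintegral_indicator measurableSet_Ioo]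
    refine lintegral_congr fun t => ?_
    by_cases ht : t ∈ Ioo (0 : ℝ) 1
    · rw [indicator_of_mem ht, indicator_of_mem ht]
    · rw [indicator_of_notMem ht, indicator_of_notMem ht, mul_zero]
  rw [h1, h2, lintegral_clauseRaw_weight hn hμ (measurable_cost.indicator measurableSet_Ioo),
    ← lintegral_one_free (by fun_prop) hμ]
  refine lintegral_mono_ae ?_
  filter_upwards [hμ.ae_power (n := n)] with x hx
  have hp := prod_mem_Icc (s := Finset.univ) hx
  by_cases hc : clauseOut x ∈ Ioo (0 : ℝ) 1
  swap
  · rw [indicator_of_notMem hc, mul_zero]; exact bot_le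
  rw [indicator_of_mem hc]
  by_cases hmix : (∃ i, x i = 0) ∧ ∃ i, x i = 1
  · rw [clauseOut_mixed hmix.1 hmix.2, cost_half, mul_zero]; exact bot_le
  obtain ⟨i, hi⟩ := exists_free_of_clauseOut hn hx hc hmix
  refine le_trans ?_ (Finset.single_le_sum (fun _ _ => bot_le) (Finset.mem_univ i))
  rw [indicator_of_mem hi]
  calc _ ≤ 1 * cost (clauseOut x) := by
        gcongr
        exact weight_le_one hl (by linarith [hp.2]) (by linarith [hp.1])
    _ ≤ (2 + cost (x i)) * 1 := by rw [one_mul, mul_one]; exact cost_clauseOut_le hn hx hi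
    _ ≤ _ := by gcongr; exact one_le_noZero_add_noOne hmix _

end ClauseBounds

/-- The laws among which the recursion is run: balanced probability laws which are almost
carried by `{0, 1}`, and the rest almost by `1 / 2`. -/
structure Good (k : ℕ) (θ : ℝ) (μ : Measure ℝ) : Prop where
  prob : IsProbabilityMeasure μ
  balanced : Balanced μ
  free_le : μ (Ioo 0 1) ≤ ENNReal.ofReal θ
  cost_le : ∫⁻ t in Ioo 0 1, cost t ∂μ ≤ ENNReal.ofReal (k ^ 4 * θ ^ 2)

/-- Bounds for the weights of the messages of a clause. -/
structure MessageBounds (k : ℕ) (θ lam : ℝ) (m : Measure ℝ) (b T K : ℝ) : Prop where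
  finite : IsFiniteMeasure m
  balanced : Balanced m
  all_eq : allWeight lam m = ENNReal.ofReal T
  free_eq : freeWeight lam m = ENNReal.ofReal K
  one_eq : m {1} = ENNReal.ofReal b
  add_eq : T = b + K
  b_ge : θ - k * θ ^ 2 ≤ b
  b_le : b ≤ θ
  T_ge : 1 - θ - 2 * k * θ ^ 2 ≤ T
  T_le : T ≤ 1 - θ + k * θ ^ 2
  K_nonneg : 0 ≤ K
  cost_le : ∫⁻ t in Ioo 0 1, weight lam t * cost t ∂m ≤ ENNReal.ofReal (18 * k * θ ^ 2)

section Atoms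

variable {k N : ℕ} {θ lam : ℝ} {μ : Measure ℝ}

lemma Balanced.real_atom [IsProbabilityMeasure μ] (h : Balanced μ) :
    μ.real {1} = (1 - μ.real (Ioo 0 1)) / 2 := by
  have h1 := congrArg ENNReal.toReal h.mass
  rw [ENNReal.toReal_add (by finiteness) (by finiteness), ENNReal.toReal_mul] at h1
  simp only [measure_univ, ENNReal.toReal_one, ENNReal.toReal_ofNat] at h1
  simp only [Measure.real]
  linarith

lemma Balanced.real_ne_zero [IsProbabilityMeasure μ] (h : Balanced μ) :
    μ.real {0}ᶜ = (1 + μ.real (Ioo 0 1)) / 2 := by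
  have h1 := congrArg ENNReal.toReal h.mass_ne_zero
  rw [ENNReal.toReal_add (by finiteness) (by finiteness)] at h1
  have := h.real_atom
  simp only [Measure.real] at *
  linarith

lemma Good.free_real (h : Good k θ μ) (hθ : 0 ≤ θ) : μ.real (Ioo 0 1) ≤ θ :=
  ENNReal.toReal_le_of_le_ofReal hθ h.free_le

lemma Regime.half_pow (hR : Regime k N θ) : (1 / 2 : ℝ) ^ (k - 1 - 1) = 2 * θ := by
  have := hR.large
  obtain ⟨m, rfl⟩ : ∃ m, k = m + 2 := ⟨k - 2, by omega⟩
  rw [hR.theta]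
  simp only [Nat.add_sub_cancel, show m + 2 - 1 = m + 1 by omega]
  rw [pow_succ]
  ring

lemma Regime.one_add_pow_le (hR : Regime k N θ) {q : ℝ} (hq : 0 ≤ q) (hq1 : q ≤ θ) {j : ℕ}
    (hj : j ≤ k) : (1 + q) ^ j ≤ 1 + 2 * (k * q) := by
  have hs := hR.small_one
  have h0 : (0 : ℝ) ≤ k * q := by positivity
  have h1 : (k : ℝ) * q ≤ k * θ := by gcongr
  calc (1 + q) ^ j ≤ (1 + q) ^ k := pow_le_pow_right₀ (by linarith) hj
    _ ≤ Real.exp q ^ k := by gcongr; linarith [Real.add_one_le_exp q]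
    _ = Real.exp (k * q) := by rw [Real.exp_nat_mul]
    _ ≤ _ := by
      have := Real.abs_exp_sub_one_le (x := k * q) (by rw [abs_of_nonneg h0]; linarith)
      rw [abs_of_nonneg h0] at this
      linarith [le_abs_self (Real.exp (k * q) - 1)]

lemma Regime.pow_ne_zero_le (hR : Regime k N θ) {q : ℝ} (hq : 0 ≤ q) (hq1 : q ≤ θ) :
    ((1 + q) / 2) ^ (k - 1 - 1) ≤ 3 * θ := by
  have h1 := hR.one_add_pow_le hq hq1 (show k - 1 - 1 ≤ k by omega)
  have hs := hR.small_one
  have hθ := hR.theta_pos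
  have h2 : (k : ℝ) * q ≤ k * θ := by gcongr
  rw [show (1 + q) / 2 = (1 / 2) * (1 + q) by ring, mul_pow, hR.half_pow]
  calc 2 * θ * (1 + q) ^ (k - 1 - 1) ≤ 2 * θ * (3 / 2) := by gcongr; linarith
    _ = 3 * θ := by ring

lemma Good.mass_ne_zero_le (h : Good k θ μ) (hθ : 0 ≤ θ) : μ {0}ᶜ ≤ ENNReal.ofReal ((1 + θ) / 2) := by
  have := h.prob
  rw [← ofReal_measureReal, h.balanced.real_ne_zero]
  exact ENNReal.ofReal_le_ofReal (by linarith [h.free_real hθ])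

end Atoms

section Bounds

variable {k N : ℕ} {θ lam : ℝ} {μ : Measure ℝ}

lemma Good.messageBounds (hR : Regime k N θ) (h : Good k θ μ) (hl : 0 ≤ lam) (hl1 : lam ≤ 1) :
    ∃ b T K, MessageBounds k θ lam (clauseRaw (k - 1) lam μ) b T K := by
  have := h.prob
  have hk := hR.large
  have hn : 0 < k - 1 := by omega
  have hθ := hR.theta_pos
  have hs := hR.small_one
  have hb := h.balanced
  have hfin := isFiniteMeasure_clauseRaw hn hb hl hl1
  have hbal := balanced_clauseRaw (lam := lam) hn hb
  have hs0 := hR.small_zero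
  set m := clauseRaw (k - 1) lam μ with hm
  set q := μ.real (Ioo 0 1) with hq
  have hq0 : 0 ≤ q := measureReal_nonneg
  have hq1 : q ≤ θ := h.free_real hθ.le
  have hTtop := allWeight_ne_top hl hbal
  have hKtop := freeWeight_ne_top hl hbal
  have hone : m {1} = ENNReal.ofReal (((1 - q) / 2) ^ (k - 1)) := by
    rw [hm, clauseRaw_one hn hb, ENNReal.ofReal_pow (by norm_num at hs0; linarith), ← hb.real_atom, ofReal_measureReal]
  have hb0 : (0 : ℝ) ≤ ((1 - q) / 2) ^ (k - 1) := pow_nonneg (by linarith [hR.small_zero]) _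
  have hkq : (k : ℝ) * q ≤ k * θ := by gcongr
  have hbeq : ((1 - q) / 2) ^ (k - 1) = θ * (1 - q) ^ (k - 1) := by
    rw [show (1 - q) / 2 = (1 / 2) * (1 - q) by ring, mul_pow, ← hR.theta]
  have hbge : θ - k * θ ^ 2 ≤ ((1 - q) / 2) ^ (k - 1) := by
    rw [hbeq]
    have h1 : 1 - k * θ ≤ (1 - q) ^ (k - 1) := by
      have h2 := one_add_mul_le_pow (a := -q) (by linarith [hR.small_zero]) (k - 1)
      have h3 : ((k - 1 : ℕ) : ℝ) ≤ k := by exact_mod_cast Nat.sub_le k 1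
      have h4 : ((k - 1 : ℕ) : ℝ) * q ≤ k * θ := by gcongr
      rw [← sub_eq_add_neg] at h2
      linarith
    calc θ - k * θ ^ 2 = θ * (1 - k * θ) := by ring
      _ ≤ _ := by gcongr
  have hble : ((1 - q) / 2) ^ (k - 1) ≤ θ := by
    rw [hbeq]
    exact mul_le_of_le_one_right hθ.le (pow_le_one₀ (by linarith [hR.small_zero]) (by linarith))
  have hadd : (allWeight lam m).toReal = ((1 - q) / 2) ^ (k - 1) + (freeWeight lam m).toReal := by
    rw [allWeight_eq hbal, ENNReal.toReal_add (measure_ne_top _ _) hKtop, hone,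
      ENNReal.toReal_ofReal hb0]
  have hTge : 1 - θ - 2 * k * θ ^ 2 ≤ (allWeight lam m).toReal := by
    have h1 := one_le_allWeight_add (lam := lam) hn hb
    have h2 : μ {0}ᶜ ^ (k - 1) = ENNReal.ofReal (((1 + q) / 2) ^ (k - 1)) := by
      rw [ENNReal.ofReal_pow (by linarith), ← hb.real_ne_zero, ofReal_measureReal]
    have h3 : (0 : ℝ) ≤ ((1 + q) / 2) ^ (k - 1) := by positivity
    have h4 := ENNReal.toReal_mono (by finiteness) h1
    rw [ENNReal.toReal_one, h2, ENNReal.toReal_add hTtop (by finiteness), ENNReal.toReal_ofReal h3,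
      show (1 + q) / 2 = (1 / 2) * (1 + q) by ring, mul_pow, ← hR.theta] at h4
    have h5 := hR.one_add_pow_le hq0 hq1 (show k - 1 ≤ k by omega)
    have h6 : θ * (1 + q) ^ (k - 1) ≤ θ * (1 + 2 * (k * θ)) := by gcongr; linarith
    linarith
  have hTle : (allWeight lam m).toReal ≤ 1 - θ + k * θ ^ 2 := by
    have h1 := allWeight_add_le (lam := lam) hn hb hl
    rw [← clauseRaw_one (lam := lam) hn hb, ← hm, hone] at h1
    have h4 := ENNReal.toReal_mono (by finiteness) h1
    rw [ENNReal.toReal_one, ENNReal.toReal_add hTtop (by finiteness), ENNReal.toReal_ofReal hb0] at h4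
    linarith
  refine ⟨((1 - q) / 2) ^ (k - 1), (allWeight lam m).toReal, (freeWeight lam m).toReal, hfin, hbal,
    (ENNReal.ofReal_toReal hTtop).symm, (ENNReal.ofReal_toReal hKtop).symm, hone, hadd, hbge, hble,
    hTge, hTle, ENNReal.toReal_nonneg, ?_⟩
  refine (freeWeight_cost_le hn hb hl).trans ?_
  have h1 : μ {0}ᶜ ^ (k - 1 - 1) ≤ ENNReal.ofReal (3 * θ) := by
    rw [← ofReal_measureReal (s := {0}ᶜ), hb.real_ne_zero, ← ENNReal.ofReal_pow (by positivity)]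
    exact ENNReal.ofReal_le_ofReal (hR.pow_ne_zero_le hq0 hq1)
  have h2 : 2 * μ (Ioo 0 1) + ∫⁻ t in Ioo 0 1, cost t ∂μ ≤ ENNReal.ofReal (3 * θ) := by
    calc _ ≤ 2 * ENNReal.ofReal θ + ENNReal.ofReal (k ^ 4 * θ ^ 2) := by
          gcongr
          · exact h.free_le
          · exact h.cost_le
      _ = ENNReal.ofReal (2 * θ + k ^ 4 * θ ^ 2) := by
          rw [ENNReal.ofReal_add (by positivity) (by positivity), ENNReal.ofReal_mul two_pos.le]
          simp
      _ ≤ _ := by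
          refine ENNReal.ofReal_le_ofReal ?_
          have h5 : (k : ℝ) ^ 4 * θ ≤ 1 := by
            refine le_trans ?_ hR.small
            gcongr
            · linarith [hR.k_ge]
            · norm_num
          nlinarith
  have h3 : ((k - 1 : ℕ) : ℝ≥0∞) ≤ ENNReal.ofReal k := by
    rw [ENNReal.ofReal_natCast]
    exact_mod_cast Nat.sub_le k 1
  calc _ ≤ ENNReal.ofReal k * (2 * (ENNReal.ofReal (3 * θ) * ENNReal.ofReal (3 * θ))) := by gcongr
    _ = ENNReal.ofReal (k * (2 * ((3 * θ) * (3 * θ)))) := by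
        rw [ENNReal.ofReal_mul (p := (k : ℝ)) (by positivity), ENNReal.ofReal_mul (p := 2) two_pos.le,
          ENNReal.ofReal_mul (p := 3 * θ) (by positivity)]
        simp
    _ = _ := by congr 1; ring

namespace MessageBounds

variable {m : Measure ℝ} {b T K : ℝ} (h : MessageBounds k θ lam m b T K)
include h

lemma K_le : K ≤ 1 - 2 * θ + 2 * k * θ ^ 2 := by
  linarith [h.add_eq, h.b_ge, h.T_le]

lemma T_pos (hR : Regime k N θ) : 1 / 2 ≤ T := by
  linarith [h.T_ge, hR.theta_sq_le, hR.small_zero]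

lemma K_ge (hR : Regime k N θ) : 1 / 2 ≤ K := by
  linarith [h.T_ge, h.add_eq, h.b_le, hR.theta_sq_le, hR.small_zero]

lemma K_le_T (hR : Regime k N θ) : K ≤ T := by
  linarith [h.add_eq, h.b_ge, hR.theta_sq_le, hR.theta_pos]

lemma T_le_one (hR : Regime k N θ) : T ≤ 1 := by
  linarith [h.T_le, hR.theta_sq_le, hR.theta_pos]

lemma forced_eq (hR : Regime k N θ) (n : ℕ) :
    forcedWeight n lam m = ENNReal.ofReal (T ^ n - K ^ n) := by
  have := h.finite
  have hKT := h.K_le_T hR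
  have h1 := forcedWeight_add (m := m) (n := n) (lam := lam)
  rw [h.all_eq, h.free_eq, ← ENNReal.ofReal_pow h.K_nonneg, ← ENNReal.ofReal_pow
    (h.K_nonneg.trans hKT)] at h1
  have h2 : K ^ n ≤ T ^ n := pow_le_pow_left₀ h.K_nonneg hKT n
  rw [ENNReal.ofReal_sub _ (pow_nonneg h.K_nonneg n), ← h1,
    ENNReal.add_sub_cancel_right ENNReal.ofReal_ne_top]

lemma pow_le (hR : Regime k N θ) : K ^ N ≤ θ / 2 * (1 + 100 * (k ^ 2 * θ)) * T ^ N :=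
  hR.pow_le h.K_nonneg h.K_le h.T_ge

lemma le_pow (hR : Regime k N θ) : θ / 2 * (1 - 100 * (k ^ 2 * θ)) * T ^ N ≤ K ^ N :=
  hR.le_pow h.b_le h.add_eq h.T_ge

lemma two_forced_le_tiltedMass (hR : Regime k N θ) (n : ℕ) :
    ENNReal.ofReal (2 * (T ^ n - K ^ n)) ≤ tiltedMass (power n m) lam agree := by
  have := h.finite
  rw [tiltedMass_agree h.balanced, h.forced_eq hR, ENNReal.ofReal_mul two_pos.le]
  simp

lemma freeOut_le (hl : 0 ≤ lam) (hl1 : lam ≤ 1) (n : ℕ) :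
    freeOut n lam m (fun _ => 1) ≤ ENNReal.ofReal (2 * K ^ n) := by
  have := h.finite
  refine (freeOut_one_le hl hl1 h.balanced).trans_eq ?_
  rw [h.free_eq, ENNReal.ofReal_mul two_pos.le, ENNReal.ofReal_pow h.K_nonneg]
  simp

lemma tiltedMass_ne_top (hR : Regime k N θ) (hl : 0 ≤ lam) (hl1 : lam ≤ 1) (n : ℕ) :
    tiltedMass (power n m) lam agree ≠ ∞ := by
  have := h.finite
  rw [tiltedMass_agree h.balanced, h.forced_eq hR]
  exact ENNReal.add_ne_top.2 ⟨by finiteness, ne_top_of_le_ne_top (by finiteness)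
    (h.freeOut_le hl hl1 n)⟩

lemma forced_pos (hR : Regime k N θ) : T ^ N * (1 - θ) ≤ T ^ N - K ^ N ∧ 0 < T ^ N := by
  have h1 := h.pow_le hR
  have h2 : 0 < T ^ N := pow_pos (by linarith [h.T_pos hR]) N
  have h3 := hR.small_two
  have h4 := hR.theta_pos
  refine ⟨?_, h2⟩
  have : θ / 2 * (1 + 100 * (k ^ 2 * θ)) ≤ θ := by nlinarith
  nlinarith

lemma tiltedMass_ne_zero (hR : Regime k N θ) : tiltedMass (power N m) lam agree ≠ 0 := by
  have h1 := h.two_forced_le_tiltedMass hR N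
  obtain ⟨h2, h3⟩ := h.forced_pos hR
  have h4 := hR.small_zero
  refine (lt_of_lt_of_le (ENNReal.ofReal_pos.2 ?_) h1).ne'
  nlinarith

lemma inv_mul_le (hR : Regime k N θ) (hl : 0 ≤ lam) (hl1 : lam ≤ 1) {a : ℝ≥0∞} {c : ℝ} (hc : 0 ≤ c)
    (ha : a ≤ ENNReal.ofReal (c * (2 * (T ^ N - K ^ N)))) :
    (tiltedMass (power N m) lam agree)⁻¹ * a ≤ ENNReal.ofReal c := by
  have h0 := h.tiltedMass_ne_zero hR
  have h1 := h.tiltedMass_ne_top hR hl hl1 N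
  calc _ ≤ (tiltedMass (power N m) lam agree)⁻¹ *
        (ENNReal.ofReal c * tiltedMass (power N m) lam agree) := by
        gcongr
        refine ha.trans ?_
        rw [ENNReal.ofReal_mul hc]
        gcongr
        exact h.two_forced_le_tiltedMass hR N
    _ = ENNReal.ofReal c := by
        rw [mul_comm (ENNReal.ofReal c), ← mul_assoc, ENNReal.inv_mul_cancel h0 h1, one_mul]

end MessageBounds

lemma lintegral_freeBox_sum {m : Measure ℝ} [IsFiniteMeasure m] {n : ℕ} {g : ℝ → ℝ≥0∞}
    (hg : Measurable g) : ∫⁻ y in freeBox n, (∏ i, weight lam (y i)) * ∑ i, g (y i) ∂power n m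
      = n * ((∫⁻ t in Ioo 0 1, weight lam t * g t ∂m) * freeWeight lam m ^ (n - 1)) := by
  rw [lintegral_freeBox]
  simp only [Finset.mul_sum]
  have hm : Measurable fun t => weight lam t * g t := by fun_prop
  rw [lintegral_finsetSum _ fun i _ => by fun_prop]
  have h1 (i : Fin n) : ∫⁻ y, (∏ j, weight lam (y j)) * g (y i) ∂power n (m.restrict (Ioo 0 1))
      = (∫⁻ t in Ioo 0 1, weight lam t * g t ∂m) * freeWeight lam m ^ (n - 1) := by
    rw [freeWeight, ← lintegral_power_single (measurable_weight lam) hm i]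
    refine lintegral_congr fun y => ?_
    rw [← Finset.mul_prod_erase _ _ (Finset.mem_univ i)]
    ring
  simp [h1]

lemma freeOut_cost_le {m : Measure ℝ} [IsFiniteMeasure m] (hm : Balanced m) (hl : 0 ≤ lam)
    (hl1 : lam ≤ 1) (n : ℕ) : freeOut n lam m cost
      ≤ 2 * (n * ((∫⁻ t in Ioo 0 1, weight lam t * cost t ∂m) * freeWeight lam m ^ (n - 1))) := by
  rw [← lintegral_freeBox_sum measurable_cost]
  calc _ ≤ ∫⁻ y in freeBox n, weight lam (agree y) * ∑ i, cost (y i) ∂power n m := by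
        refine setLIntegral_mono' measurableSet_freeBox fun y hy => ?_
        gcongr
        exact cost_varOut_le hy
    _ ≤ _ := lintegral_freeBox_le hl hl1 hm (by fun_prop) fun y => by simp only [cost_reflect]

/-- The recursion without the intermediate normalization. -/
noncomputable def step (k N : ℕ) (lam : ℝ) (μ : Measure ℝ) : Measure ℝ :=
  tiltedLaw (power N (clauseRaw (k - 1) lam μ)) lam agree varOut

lemma Good.step (hR : Regime k N θ) (h : Good k θ μ) (hl : 0 ≤ lam) (hl1 : lam ≤ 1) :
    Good k θ (step k N lam μ) := by
  obtain ⟨b, T, K, hB⟩ := h.messageBounds hR hl hl1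
  have := hB.finite
  have hθ := hR.theta_pos
  have hθ1 := hR.small_zero
  have hs2 := hR.small_two
  have hk := hR.k_ge
  obtain ⟨hf, hT⟩ := hB.forced_pos hR
  have hK := hB.pow_le hR
  have hK2 : K ^ N ≤ 2 / 3 * θ * T ^ N := by
    have : θ / 2 * (1 + 100 * (k ^ 2 * θ)) ≤ 2 / 3 * θ := by nlinarith
    exact hK.trans (by gcongr)
  have hf2 : 9 / 10 * T ^ N ≤ T ^ N - K ^ N := by nlinarith
  refine ⟨isProbabilityMeasure_tiltedLaw (by fun_prop) (hB.tiltedMass_ne_zero hR)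
    (hB.tiltedMass_ne_top hR hl hl1 N), balanced_varLaw hB.balanced, ?_, ?_⟩
  · have h1 := setLIntegral_varLaw (n := N) (lam := lam) hB.balanced (φ := fun _ => 1) measurable_const
    rw [setLIntegral_one] at h1
    unfold NAESat.step
    rw [h1]
    refine hB.inv_mul_le hR hl hl1 hθ.le ((hB.freeOut_le hl hl1 N).trans ?_)
    refine ENNReal.ofReal_le_ofReal ?_
    nlinarith
  · unfold NAESat.step
    rw [setLIntegral_varLaw hB.balanced measurable_cost]
    refine hB.inv_mul_le hR hl hl1 (by positivity) ((freeOut_cost_le hB.balanced hl hl1 N).trans ?_)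
    rw [hB.free_eq]
    calc _ ≤ 2 * (ENNReal.ofReal N * (ENNReal.ofReal (18 * k * θ ^ 2) * ENNReal.ofReal K ^ (N - 1))) := by
          gcongr
          · simp
          · exact hB.cost_le
      _ = ENNReal.ofReal (2 * (N * (18 * k * θ ^ 2 * K ^ (N - 1)))) := by
          rw [ENNReal.ofReal_mul (p := 2) two_pos.le, ENNReal.ofReal_mul (p := (N : ℝ)) (by positivity),
            ENNReal.ofReal_mul (p := 18 * k * θ ^ 2) (by positivity), ENNReal.ofReal_pow hB.K_nonneg]
          simp
      _ ≤ _ := by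
          refine ENNReal.ofReal_le_ofReal ?_
          have h3 : K ^ (N - 1) ≤ 2 * K ^ N := by
            have h4 : K ^ N = K ^ (N - 1) * K := by
              rw [← pow_succ, Nat.sub_add_cancel hR.N_pos]
            have h5 := hB.K_ge hR
            have h6 : 0 ≤ K ^ (N - 1) := pow_nonneg hB.K_nonneg _
            rw [h4]; nlinarith
          have h7 : (N : ℝ) * θ ≤ k := by
            have := hR.upper
            have := Real.log_two_lt_d9
            nlinarith
          have h8 : K ^ (N - 1) ≤ 4 / 3 * θ * T ^ N := by linarith
          calc 2 * (N * (18 * k * θ ^ 2 * K ^ (N - 1)))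
              ≤ 2 * (N * (18 * k * θ ^ 2 * (4 / 3 * θ * T ^ N))) := by gcongr
            _ = 48 * k * θ ^ 2 * T ^ N * (N * θ) := by ring
            _ ≤ 48 * k * θ ^ 2 * T ^ N * k := by gcongr
            _ = 48 * (k ^ 2 * θ ^ 2 * T ^ N) := by ring
            _ ≤ (k ^ 2 * (9 / 5)) * (k ^ 2 * θ ^ 2 * T ^ N) := by
                have : (48 : ℝ) ≤ k ^ 2 * (9 / 5) := by nlinarith
                gcongr
            _ = k ^ 4 * θ ^ 2 * (2 * (9 / 10 * T ^ N)) := by ring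
            _ ≤ _ := by gcongr

end Bounds

section Contraction

variable {k N : ℕ} {θ lam : ℝ} {μ ν : Measure ℝ}

lemma clauseRaw_near_of_good (hR : Regime k N θ) (hμ : Good k θ μ) (hν : Good k θ ν) (hl : 0 ≤ lam)
    {ε : ℝ}
    (h : Near (ENNReal.ofReal ε) (μ.restrict (Ioo 0 1)) (ν.restrict (Ioo 0 1)))
    (h' : Near (ENNReal.ofReal ε) (ν.restrict (Ioo 0 1)) (μ.restrict (Ioo 0 1)))
    {φ : ℝ → ℝ≥0∞} (hφ : Measurable φ) (hφ1 : ∀ t, φ t ≤ 1) :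
    ∫⁻ t, weight lam t * φ t ∂clauseRaw (k - 1) lam μ
      ≤ ∫⁻ t, weight lam t * φ t ∂clauseRaw (k - 1) lam ν + ENNReal.ofReal (24 * k * θ * ε) := by
  have := hμ.prob
  have := hν.prob
  have hθ := hR.theta_pos
  have hn : 0 < k - 1 := by have := hR.large; omega
  refine (clauseRaw_near hn hμ.balanced hν.balanced hl h h' ENNReal.ofReal_ne_top
    (hμ.mass_ne_zero_le hθ.le) (hν.mass_ne_zero_le hθ.le) hφ hφ1).trans ?_
  gcongr
  have h3 : ((k - 1 : ℕ) : ℝ≥0∞) ≤ ENNReal.ofReal k := by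
    rw [ENNReal.ofReal_natCast]
    exact_mod_cast Nat.sub_le k 1
  have h4 : ENNReal.ofReal ((1 + θ) / 2) ^ (k - 1 - 1) ≤ ENNReal.ofReal (3 * θ) := by
    rw [← ENNReal.ofReal_pow (by positivity)]
    exact ENNReal.ofReal_le_ofReal (hR.pow_ne_zero_le hθ.le le_rfl)
  calc _ ≤ 8 * (ENNReal.ofReal k * ENNReal.ofReal (3 * θ) * ENNReal.ofReal ε) := by gcongr
    _ = ENNReal.ofReal (8 * (k * (3 * θ) * ε)) := by
        rw [ENNReal.ofReal_mul (p := 8) (by norm_num), ENNReal.ofReal_mul (p := k * (3 * θ)) (by positivity),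
          ENNReal.ofReal_mul (p := (k : ℝ)) (by positivity)]
        simp
    _ = _ := by congr 1; ring

lemma freeMeasure_near_of_good (hR : Regime k N θ) (hμ : Good k θ μ) (hν : Good k θ ν) (hl : 0 ≤ lam)
    {ε : ℝ}
    (h : Near (ENNReal.ofReal ε) (μ.restrict (Ioo 0 1)) (ν.restrict (Ioo 0 1)))
    (h' : Near (ENNReal.ofReal ε) (ν.restrict (Ioo 0 1)) (μ.restrict (Ioo 0 1))) :
    Near (ENNReal.ofReal (24 * k * θ * ε)) (freeMeasure lam (clauseRaw (k - 1) lam μ))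
      (freeMeasure lam (clauseRaw (k - 1) lam ν)) := by
  intro φ hφ hφ1
  have key := clauseRaw_near_of_good hR hμ hν hl h h' (φ := (Ioo 0 1).indicator φ)
    (hφ.indicator measurableSet_Ioo)
    (fun t => (indicator_le_self' (fun _ _ => bot_le) t).trans (hφ1 t))
  have he (m : Measure ℝ) : ∫⁻ t, weight lam t * (Ioo 0 1).indicator φ t ∂m
      = ∫⁻ t in Ioo 0 1, weight lam t * φ t ∂m := by
    rw [← lintegral_indicator measurableSet_Ioo]
    refine lintegral_congr fun t => ?_
    by_cases ht : t ∈ Ioo (0 : ℝ) 1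
    · rw [indicator_of_mem ht, indicator_of_mem ht]
    · rw [indicator_of_notMem ht, indicator_of_notMem ht, mul_zero]
  rwa [he, he, ← lintegral_freeMeasure hφ, ← lintegral_freeMeasure hφ] at key

lemma freeOut_mono {m : Measure ℝ} {n : ℕ} {φ ψ : ℝ → ℝ≥0∞} (h : ∀ t, φ t ≤ ψ t) :
    freeOut n lam m φ ≤ freeOut n lam m ψ := lintegral_mono fun _ => by gcongr; exact h _

lemma MessageBounds.tiltedMass_toReal {m : Measure ℝ} {b T K : ℝ} (h : MessageBounds k θ lam m b T K)
    (hR : Regime k N θ) (hl : 0 ≤ lam) (hl1 : lam ≤ 1) (n : ℕ) :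
    (tiltedMass (power n m) lam agree).toReal
      = 2 * (T ^ n - K ^ n) + (freeOut n lam m fun _ => 1).toReal := by
  have := h.finite
  have hKT : K ^ n ≤ T ^ n := pow_le_pow_left₀ h.K_nonneg (h.K_le_T hR) n
  rw [tiltedMass_agree h.balanced, h.forced_eq hR, ENNReal.toReal_add (by finiteness)
    (ne_top_of_le_ne_top (by finiteness) (h.freeOut_le hl hl1 n)), ENNReal.toReal_mul,
    ENNReal.toReal_ofReal (by linarith)]
  simp

lemma MessageBounds.compare (hR : Regime k N θ) (hμ : Good k θ μ) (hν : Good k θ ν) (hl : 0 ≤ lam)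
    {ε : ℝ} (hε : 0 ≤ ε)
    (h : Near (ENNReal.ofReal ε) (μ.restrict (Ioo 0 1)) (ν.restrict (Ioo 0 1)))
    (h' : Near (ENNReal.ofReal ε) (ν.restrict (Ioo 0 1)) (μ.restrict (Ioo 0 1)))
    {b T K b' T' K' : ℝ} (hB : MessageBounds k θ lam (clauseRaw (k - 1) lam μ) b T K)
    (hB' : MessageBounds k θ lam (clauseRaw (k - 1) lam ν) b' T' K') :
    T ≤ T' + 24 * k * θ * ε ∧ K ≤ K' + 24 * k * θ * ε := by
  have hθ := hR.theta_pos
  have hδ0 : 0 ≤ 24 * k * θ * ε := by positivity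
  have h1 := clauseRaw_near_of_good hR hμ hν hl h h' (φ := fun _ => 1) measurable_const
    fun _ => le_rfl
  have h2 := freeMeasure_near_of_good hR hμ hν hl h h' (fun _ => 1) measurable_const
    fun _ => le_rfl
  simp only [mul_one, lintegral_const, one_mul, freeMeasure_univ] at h1 h2
  change allWeight _ _ ≤ allWeight _ _ + _ at h1
  rw [hB.all_eq, hB'.all_eq, ← ENNReal.ofReal_add (by linarith [hB'.T_pos hR]) hδ0,
    ENNReal.ofReal_le_ofReal_iff (by linarith [hB'.T_pos hR])] at h1
  rw [hB.free_eq, hB'.free_eq, ← ENNReal.ofReal_add hB'.K_nonneg hδ0,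
    ENNReal.ofReal_le_ofReal_iff (by linarith [hB'.K_nonneg])] at h2
  exact ⟨h1, h2⟩

lemma MessageBounds.freeOut_compare (hl : 0 ≤ lam) (hl1 : lam ≤ 1) {m m' : Measure ℝ}
    {b T K b' T' K' δ A : ℝ} (hB : MessageBounds k θ lam m b T K)
    (hB' : MessageBounds k θ lam m' b' T' K') (hδ : 0 ≤ δ)
    (hnear : Near (ENNReal.ofReal δ) (freeMeasure lam m) (freeMeasure lam m'))
    (hmaxK : max K K' ^ (N - 1) ≤ A) {φ : ℝ → ℝ≥0∞} (hφ : Measurable φ) (hφ1 : ∀ t, φ t ≤ 1) :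
    (freeOut N lam m φ).toReal ≤ (freeOut N lam m' φ).toReal + 2 * (N * A * δ) := by
  have := hB.finite
  have := hB'.finite
  have h0 : 0 ≤ max K K' := hB.K_nonneg.trans (le_max_left _ _)
  have hA : 0 ≤ A := (pow_nonneg h0 _).trans hmaxK
  have h1 := freeOut_near (n := N) hl hl1 hB.balanced hB'.balanced hnear
    (M := ENNReal.ofReal (max K K')) ENNReal.ofReal_ne_top
    (by rw [hB.free_eq]; exact ENNReal.ofReal_le_ofReal (le_max_left _ _))
    (by rw [hB'.free_eq]; exact ENNReal.ofReal_le_ofReal (le_max_right _ _)) hφ hφ1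
  have h2 : 2 * (N * ENNReal.ofReal (max K K') ^ (N - 1) * ENNReal.ofReal δ)
      ≤ ENNReal.ofReal (2 * (N * A * δ)) := by
    calc _ = ENNReal.ofReal (2 * (N * max K K' ^ (N - 1) * δ)) := by
          rw [ENNReal.ofReal_mul (p := 2) two_pos.le,
            ENNReal.ofReal_mul (p := N * max K K' ^ (N - 1)) (by positivity),
            ENNReal.ofReal_mul (p := (N : ℝ)) (by positivity), ENNReal.ofReal_pow h0]
          simp
      _ ≤ _ := ENNReal.ofReal_le_ofReal (by gcongr)
  have h3 : freeOut N lam m' φ ≠ ∞ :=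
    ne_top_of_le_ne_top (by finiteness) ((freeOut_mono hφ1).trans (hB'.freeOut_le hl hl1 N))
  have h4 := ENNReal.toReal_mono (by finiteness) (h1.trans (add_le_add le_rfl h2))
  rwa [ENNReal.toReal_add h3 (by finiteness), ENNReal.toReal_ofReal (by positivity)] at h4

lemma inv_mul_le_inv_mul_add {A A' Z Z' e c θ : ℝ} (hZ : 0 < Z) (hZ' : 0 < Z') (hA' : 0 ≤ A')
    (hA : A ≤ A' + e) (hθ : A' ≤ θ * Z') (hd : Z' - Z ≤ c * Z) (hc : 0 ≤ c) :
    Z⁻¹ * A ≤ Z'⁻¹ * A' + (Z⁻¹ * e + θ * c) := by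
  have g1 : Z'⁻¹ * A' ≤ θ := by rw [inv_mul_le_iff₀ hZ']; linarith
  have g2 : (Z' - Z) * Z⁻¹ ≤ c := by
    rw [← div_eq_mul_inv, div_le_iff₀ hZ]
    exact hd
  have g0 : 0 ≤ Z'⁻¹ * A' := by positivity
  have g3 := mul_le_mul_of_nonneg_left g2 g0
  have g4 := mul_le_mul_of_nonneg_right g1 hc
  have g5 := mul_le_mul_of_nonneg_left hA (inv_nonneg.2 hZ.le)
  have g6 : Z⁻¹ * (A' + e) = Z'⁻¹ * A' + (Z⁻¹ * e + Z'⁻¹ * A' * ((Z' - Z) * Z⁻¹)) := by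
    field_simp
    ring
  linarith

lemma Regime.N_theta_le (hR : Regime k N θ) : N * θ ≤ k := by
  have := hR.upper
  have := Real.log_two_lt_d9
  have := hR.k_ge
  nlinarith

lemma Regime.pow_pred_le (hR : Regime k N θ) {a A : ℝ} (ha : 1 / 2 ≤ a) (hA : a ^ N ≤ A) :
    a ^ (N - 1) ≤ 2 * A := by
  have h4 : a ^ N = a ^ (N - 1) * a := by rw [← pow_succ, Nat.sub_add_cancel hR.N_pos]
  have h6 : 0 ≤ a ^ (N - 1) := pow_nonneg (by linarith) _
  nlinarith

lemma abs_pow_sub_pow_le_of_near {a a' δ A : ℝ} (ha : 0 ≤ a) (ha' : 0 ≤ a') (h : a ≤ a' + δ)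
    (h' : a' ≤ a + δ) (hA : max a a' ^ (N - 1) ≤ A) : |a ^ N - a' ^ N| ≤ δ * N * A := by
  refine (abs_pow_sub_pow_le a a' N).trans ?_
  rw [abs_of_nonneg ha, abs_of_nonneg ha']
  have h1 : |a - a'| ≤ δ := abs_le.2 ⟨by linarith, by linarith⟩
  have h2 : 0 ≤ δ := (abs_nonneg _).trans h1
  have h3 : 0 ≤ max a a' := ha.trans (le_max_left _ _)
  gcongr

set_option maxHeartbeats 400000 in
/-- The recursion is a contraction. -/
lemma Good.contract (hR : Regime k N θ) (hμ : Good k θ μ) (hν : Good k θ ν) (hl : 0 ≤ lam)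
    (hl1 : lam ≤ 1) {ε : ℝ} (hε : 0 ≤ ε)
    (h : Near (ENNReal.ofReal ε) (μ.restrict (Ioo 0 1)) (ν.restrict (Ioo 0 1)))
    (h' : Near (ENNReal.ofReal ε) (ν.restrict (Ioo 0 1)) (μ.restrict (Ioo 0 1))) :
    Near (ENNReal.ofReal (ε / 2)) ((NAESat.step k N lam μ).restrict (Ioo 0 1))
      ((NAESat.step k N lam ν).restrict (Ioo 0 1)) := by
  intro φ hφ hφ1
  obtain ⟨b, T, K, hB⟩ := hμ.messageBounds hR hl hl1
  obtain ⟨b', T', K', hB'⟩ := hν.messageBounds hR hl hl1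
  have hθ := hR.theta_pos
  have hs0 := hR.small_zero
  have hs2 := hR.small_two
  have hnear := freeMeasure_near_of_good hR hμ hν hl h h'
  have hnear' := freeMeasure_near_of_good hR hν hμ hl h' h
  obtain ⟨hT1, hK1⟩ := hB.compare hR hμ hν hl hε h h' hB'
  obtain ⟨hT2, hK2⟩ := hB'.compare hR hν hμ hl hε h' h hB
  have hNd : N * (24 * k * θ * ε) ≤ 24 * k ^ 2 * ε := by
    have h7 := hR.N_theta_le
    calc N * (24 * k * θ * ε) = 24 * k * ε * (N * θ) := by ring
      _ ≤ 24 * k * ε * k := by gcongr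
      _ = _ := by ring
  have hδ0 : 0 ≤ 24 * k * θ * ε := by positivity
  have hN0 : 0 ≤ N * (24 * k * θ * ε) := by positivity
  generalize 24 * k * θ * ε = δ at *
  obtain ⟨hf, hP0⟩ := hB.forced_pos hR
  obtain ⟨hf', hP0'⟩ := hB'.forced_pos hR
  have hP2 : T' ^ N ≤ 2 * T ^ N := hR.pow_le_two_mul (by linarith [hB'.T_pos hR]) hB'.T_le hB.T_ge
  have hcoef : θ / 2 * (1 + 100 * (k ^ 2 * θ)) ≤ 2 / 3 * θ := by nlinarith
  have hKP : K ^ N ≤ θ * T ^ N :=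
    (hB.pow_le hR).trans (mul_le_mul_of_nonneg_right (by linarith) hP0.le)
  have hKP' : K' ^ N ≤ θ * T ^ N :=
    (hR.pow_le hB'.K_nonneg hB'.K_le hB.T_ge).trans
      (mul_le_mul_of_nonneg_right (by linarith) hP0.le)
  have hKP'' : K' ^ N ≤ 2 / 3 * θ * T' ^ N := (hB'.pow_le hR).trans (by gcongr)
  have hmaxK : max K K' ^ (N - 1) ≤ 2 * (θ * T ^ N) := by
    rcases max_cases K K' with ⟨hc, -⟩ | ⟨hc, -⟩ <;> rw [hc]
    · exact hR.pow_pred_le (hB.K_ge hR) hKP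
    · exact hR.pow_pred_le (hB'.K_ge hR) hKP'
  have hmaxT : max T T' ^ (N - 1) ≤ 4 * T ^ N := by
    rcases max_cases T T' with ⟨hc, -⟩ | ⟨hc, -⟩ <;> rw [hc]
    · linarith [hR.pow_pred_le (hB.T_pos hR) (le_refl (T ^ N))]
    · linarith [hR.pow_pred_le (hB'.T_pos hR) hP2]
  have hTd := abs_pow_sub_pow_le_of_near (by linarith [hB.T_pos hR] : 0 ≤ T)
    (by linarith [hB'.T_pos hR] : 0 ≤ T') hT1 hT2 hmaxT
  have hKd := abs_pow_sub_pow_le_of_near hB.K_nonneg hB'.K_nonneg hK1 hK2 hmaxK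
  have hA := hB.freeOut_compare hl hl1 hB' hδ0 hnear hmaxK hφ hφ1
  have hmaxK' : max K' K ^ (N - 1) ≤ 2 * (θ * T ^ N) := by rwa [max_comm]
  have hw2 := hB'.freeOut_compare hl hl1 hB hδ0 hnear' hmaxK' (φ := fun _ => 1)
    measurable_const fun _ => le_rfl
  have hfA' : freeOut N lam (clauseRaw (k - 1) lam ν) φ ≠ ∞ :=
    ne_top_of_le_ne_top (by finiteness) ((freeOut_mono hφ1).trans (hB'.freeOut_le hl hl1 N))
  have hAw := ENNReal.toReal_mono (ne_top_of_le_ne_top (by finiteness) (hB'.freeOut_le hl hl1 N))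
      (freeOut_mono (n := N) (lam := lam) (m := clauseRaw (k - 1) lam ν) hφ1)
  have hwK := ENNReal.toReal_le_of_le_ofReal (by have := hB'.K_nonneg; positivity)
    (hB'.freeOut_le hl hl1 N)
  have hZ := hB.tiltedMass_toReal hR hl hl1 N
  have hZ' := hB'.tiltedMass_toReal hR hl hl1 N
  have hfA : freeOut N lam (clauseRaw (k - 1) lam μ) φ ≠ ∞ :=
    ne_top_of_le_ne_top (by finiteness) ((freeOut_mono hφ1).trans (hB.freeOut_le hl hl1 N))
  have hz := hB.tiltedMass_ne_zero hR
  have hz' := hB'.tiltedMass_ne_zero hR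
  have hw0 : 0 ≤ (freeOut N lam (clauseRaw (k - 1) lam μ) fun _ => 1).toReal := ENNReal.toReal_nonneg
  have := hB.finite
  have := hB'.finite
  unfold NAESat.step
  rw [setLIntegral_varLaw hB.balanced hφ, setLIntegral_varLaw hB'.balanced hφ]
  have hl1' := ENNReal.mul_ne_top (ENNReal.inv_ne_top.2 hz) hfA
  have hl2' := ENNReal.mul_ne_top (ENNReal.inv_ne_top.2 hz') hfA'
  rw [← ENNReal.toReal_le_toReal hl1' (by finiteness), ENNReal.toReal_add hl2' (by finiteness),
    ENNReal.toReal_mul, ENNReal.toReal_mul, ENNReal.toReal_inv, ENNReal.toReal_inv,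
    ENNReal.toReal_ofReal (by positivity), hZ, hZ']
  have hA0 : 0 ≤ (freeOut N lam (clauseRaw (k - 1) lam ν) φ).toReal := ENNReal.toReal_nonneg
  generalize (freeOut N lam (clauseRaw (k - 1) lam μ) φ).toReal = A at *
  generalize (freeOut N lam (clauseRaw (k - 1) lam ν) φ).toReal = A' at *
  generalize (freeOut N lam (clauseRaw (k - 1) lam μ) fun _ => 1).toReal = w at *
  generalize (freeOut N lam (clauseRaw (k - 1) lam ν) fun _ => 1).toReal = w' at *
  generalize T ^ N = P at *
  generalize T' ^ N = P' at *
  generalize K ^ N = Q at *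
  generalize K' ^ N = Q' at *
  have hθs : θ ≤ 1 / 10 := by linarith
  have hZP : P ≤ 2 * (P - Q) + w := by nlinarith
  have hZ0 : 0 < 2 * (P - Q) + w := hP0.trans_le hZP
  have hZ0' : 0 < 2 * (P' - Q') + w' := by nlinarith
  have hA'Z' : A' ≤ θ * (2 * (P' - Q') + w') := by
    nlinarith
  have hcross : N * δ * (θ * P) ≤ N * δ * P := by
    gcongr
    nlinarith
  have hZdiff : 2 * (P' - Q') + w' - (2 * (P - Q) + w) ≤ 16 * (N * δ) * (2 * (P - Q) + w) := by
    have h1 := (abs_le.1 hTd).1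
    have h2 := (abs_le.1 hKd).2
    have h3 : 16 * (N * δ) * P ≤ 16 * (N * δ) * (2 * (P - Q) + w) := by gcongr
    have h4 : 2 * (N * (2 * (θ * P)) * δ) = 4 * (N * δ * (θ * P)) := by ring
    have h5 : δ * N * (2 * (θ * P)) = 2 * (N * δ * (θ * P)) := by ring
    have h6 : δ * N * (4 * P) = 4 * (N * δ * P) := by ring
    have h7 : 16 * (N * δ) * P = 16 * (N * δ * P) := by ring
    linarith
  refine (inv_mul_le_inv_mul_add hZ0 hZ0' hA0 hA hA'Z' hZdiff (by positivity)).trans ?_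
  gcongr
  have h4 : (2 * (P - Q) + w)⁻¹ * (2 * (N * (2 * (θ * P)) * δ)) ≤ 4 * θ * (N * δ) := by
    rw [inv_mul_le_iff₀ hZ0]
    calc 2 * (N * (2 * (θ * P)) * δ) = P * (4 * θ * (N * δ)) := by ring
      _ ≤ _ := by gcongr
  calc _ ≤ 4 * θ * (N * δ) + θ * (16 * (N * δ)) := by gcongr
    _ = 20 * θ * (N * δ) := by ring
    _ ≤ 20 * θ * (24 * k ^ 2 * ε) := by gcongr
    _ = 480 * (k ^ 2 * θ) * ε := by ring
    _ ≤ 1 / 2 * ε := by gcongr; linarith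
    _ = ε / 2 := by ring

end Contraction

section Scaling

lemma tiltedLaw_smul {Ω : Type*} [MeasurableSpace Ω] {ν : Measure Ω} {lam : ℝ} {g f : Ω → ℝ} {c : ℝ≥0∞}
    (h0 : c ≠ 0) (h1 : c ≠ ∞) : tiltedLaw (c • ν) lam g f = tiltedLaw ν lam g f := by
  unfold tiltedLaw tiltedMass
  rw [lintegral_smul_measure, withDensity_smul_measure, Measure.map_smul, smul_smul, smul_eq_mul,
    ENNReal.mul_inv (Or.inl h0) (Or.inl h1), mul_right_comm, ENNReal.inv_mul_cancel h0 h1, one_mul]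

lemma varRec_clauseRec {k d : ℕ} {lam : ℝ} {μ : Measure ℝ} [IsProbabilityMeasure μ] (hk : 0 < k - 1)
    (hμ : Balanced μ) (hl : 0 ≤ lam) (hl1 : lam ≤ 1) :
    varRec d lam (clauseRec k lam μ) = step k (d - 1) lam μ := by
  have := isFiniteMeasure_clauseRaw hk hμ hl hl1
  have h0 := clauseMass_ne_zero hk hμ hl
  have h1 := clauseMass_ne_top hk hμ hl hl1
  rw [clauseRec_eq]
  unfold varRec step
  rw [power_smul (ENNReal.inv_ne_top.2 h0)]
  exact tiltedLaw_smul (pow_ne_zero _ (ENNReal.inv_ne_zero.2 h1))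
    (ENNReal.pow_ne_top (ENNReal.inv_ne_top.2 h0))

end Scaling

section Countable

variable {μ ν : Measure ℝ} {n : ℕ}

lemma ae_mem_range {Ω : Type*} [MeasurableSpace Ω] {ν : Measure Ω} {S : Set Ω} (hS : S.Countable)
    (h : ∀ᵐ ω ∂ν, ω ∈ S) {f : Ω → ℝ} (hf : Measurable f) :
    ∃ T : Set ℝ, T.Countable ∧ ∀ᵐ t ∂ν.map f, t ∈ T := by
  refine ⟨f '' S, hS.image f, ?_⟩
  refine (ae_map_iff hf.aemeasurable (hS.image f).measurableSet).2 ?_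
  filter_upwards [h] with ω hω using mem_image_of_mem f hω

lemma countable_power [IsFiniteMeasure μ] {S : Set ℝ} (hS : S.Countable) (h : ∀ᵐ t ∂μ, t ∈ S) :
    ∃ T : Set (Fin n → ℝ), T.Countable ∧ ∀ᵐ x ∂power n μ, x ∈ T := by
  refine ⟨univ.pi fun _ => S, countable_univ_pi fun _ => hS, ?_⟩
  filter_upwards [ae_power (n := n) h] with x hx
  exact fun i _ => hx i

lemma countable_tiltedLaw {Ω : Type*} [MeasurableSpace Ω] {ν : Measure Ω} {S : Set Ω} (hS : S.Countable)
    (h : ∀ᵐ ω ∂ν, ω ∈ S) {lam : ℝ} {g f : Ω → ℝ} (hf : Measurable f) :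
    ∃ T : Set ℝ, T.Countable ∧ ∀ᵐ t ∂tiltedLaw ν lam g f, t ∈ T := by
  obtain ⟨T, hT, h1⟩ := ae_mem_range (ν := ν.withDensity fun ω => weight lam (g ω)) hS
    ((withDensity_absolutelyContinuous _ _).ae_le h) hf
  exact ⟨T, hT, Measure.ae_smul_measure h1 _⟩

lemma lintegral_eq_tsum {S : Set ℝ} (hS : S.Countable) (h : ∀ᵐ t ∂μ, t ∈ S) (φ : ℝ → ℝ≥0∞) :
    ∫⁻ t, φ t ∂μ = ∑' t : S, φ t * μ {(t : ℝ)} := by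
  rw [← lintegral_countable _ hS, Measure.restrict_eq_self_of_ae_mem h]

/-- Total variation distance, atom by atom. -/
noncomputable def atomDist (μ ν : Measure ℝ) : ℝ≥0∞ := ∑' x : ℝ, ENNReal.ofReal |μ.real {x} - ν.real {x}|

lemma atomDist_comm : atomDist μ ν = atomDist ν μ := by
  unfold atomDist
  simp only [abs_sub_comm]

lemma near_atomDist [IsFiniteMeasure μ] [IsFiniteMeasure ν] {S : Set ℝ} (hS : S.Countable)
    (hμ : ∀ᵐ t ∂μ, t ∈ S) (hν : ∀ᵐ t ∂ν, t ∈ S) : Near (atomDist μ ν) μ ν := by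
  intro φ _ hφ1
  rw [lintegral_eq_tsum hS hμ, lintegral_eq_tsum hS hν]
  calc _ ≤ ∑' t : S, (φ t * ν {(t : ℝ)} + ENNReal.ofReal |μ.real {(t : ℝ)} - ν.real {(t : ℝ)}|) := by
        refine ENNReal.tsum_le_tsum fun t => ?_
        have h1 : μ {(t : ℝ)} ≤ ν {(t : ℝ)} + ENNReal.ofReal |μ.real {(t : ℝ)} - ν.real {(t : ℝ)}| := by
          rw [← ofReal_measureReal (μ := μ), ← ofReal_measureReal (μ := ν),
            ← ENNReal.ofReal_add measureReal_nonneg (abs_nonneg _)]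
          refine ENNReal.ofReal_le_ofReal ?_
          linarith [le_abs_self (μ.real {(t : ℝ)} - ν.real {(t : ℝ)})]
        calc _ ≤ φ t * (ν {(t : ℝ)} + ENNReal.ofReal |μ.real {(t : ℝ)} - ν.real {(t : ℝ)}|) := by gcongr
          _ ≤ _ := by
            rw [mul_add]
            gcongr
            exact mul_le_of_le_one_left bot_le (hφ1 _)
    _ = ∑' t : S, φ t * ν {(t : ℝ)}
        + ∑' t : S, ENNReal.ofReal |μ.real {(t : ℝ)} - ν.real {(t : ℝ)}| := ENNReal.tsum_add
    _ ≤ _ := by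
        gcongr
        exact ENNReal.tsum_comp_le_tsum_of_injective Subtype.val_injective
          fun x : ℝ => ENNReal.ofReal |μ.real {x} - ν.real {x}|

lemma sum_atoms_le [IsFiniteMeasure μ] [IsFiniteMeasure ν] {ε : ℝ} (hε : 0 ≤ ε)
    (h : Near (ENNReal.ofReal ε) μ ν) (h' : Near (ENNReal.ofReal ε) ν μ) (F : Finset ℝ) :
    ∑ x ∈ F, |μ.real {x} - ν.real {x}| ≤ 2 * ε := by
  have key {μ ν : Measure ℝ} [IsFiniteMeasure μ] [IsFiniteMeasure ν]
      (h : Near (ENNReal.ofReal ε) μ ν) (G : Finset ℝ) :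
      ∑ x ∈ G, (μ.real {x} - ν.real {x}) ≤ ε := by
    have h1 := h ((G : Set ℝ).indicator 1) (measurable_one.indicator G.measurableSet) fun x => by
      by_cases hx : x ∈ (G : Set ℝ) <;> simp [hx]
    rw [lintegral_indicator_one G.measurableSet, lintegral_indicator_one G.measurableSet] at h1
    have h2 := ENNReal.toReal_mono (by finiteness) h1
    rw [ENNReal.toReal_add (by finiteness) (by finiteness), ENNReal.toReal_ofReal hε] at h2
    rw [Finset.sum_sub_distrib, sum_measureReal_singleton, sum_measureReal_singleton]
    simp only [Measure.real]
    linarith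
  rw [← Finset.sum_filter_add_sum_filter_not F fun x => ν.real {x} ≤ μ.real {x}]
  have h1 := key h (F.filter fun x => ν.real {x} ≤ μ.real {x})
  have h2 := key h' (F.filter fun x => ¬ν.real {x} ≤ μ.real {x})
  have h3 : ∀ x ∈ F.filter (fun x => ν.real {x} ≤ μ.real {x}),
      |μ.real {x} - ν.real {x}| = μ.real {x} - ν.real {x} :=
    fun x hx => abs_of_nonneg (sub_nonneg.2 (Finset.mem_filter.1 hx).2)
  have h4 : ∀ x ∈ F.filter (fun x => ¬ν.real {x} ≤ μ.real {x}),
      |μ.real {x} - ν.real {x}| = ν.real {x} - μ.real {x} := fun x hx => by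
    have := (Finset.mem_filter.1 hx).2
    rw [abs_of_neg (by linarith), neg_sub]
  rw [Finset.sum_congr rfl h3, Finset.sum_congr rfl h4]
  linarith

end Countable

section Iteration

variable {k d : ℕ} {θ lam : ℝ}

lemma lintegral_iterLaw_zero {φ : ℝ → ℝ≥0∞} (hφ : Measurable φ) :
    ∫⁻ t, φ t ∂iterLaw k d lam 0 = 2⁻¹ * φ 0 + 2⁻¹ * φ 1 := by
  unfold iterLaw
  rw [lintegral_add_measure, lintegral_smul_measure, lintegral_smul_measure, lintegral_dirac' _ hφ,
    lintegral_dirac' _ hφ]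
  rfl

lemma iterLaw_zero_free {φ : ℝ → ℝ≥0∞} (hφ : Measurable φ) :
    ∫⁻ t in Ioo 0 1, φ t ∂iterLaw k d lam 0 = 0 := by
  rw [← lintegral_indicator measurableSet_Ioo,
    lintegral_iterLaw_zero (hφ.indicator measurableSet_Ioo)]
  simp

lemma good_iterLaw_zero : Good k θ (iterLaw k d lam 0) := by
  have h1 : IsProbabilityMeasure (iterLaw k d lam 0) := by
    constructor
    rw [← lintegral_one, lintegral_iterLaw_zero measurable_const, mul_one, ENNReal.inv_two_add_inv_two]
  refine ⟨h1, ⟨?_, ?_⟩, ?_, ?_⟩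
  · unfold iterLaw
    refine ae_add_measure_iff.2 ⟨Measure.ae_smul_measure ?_ _, Measure.ae_smul_measure ?_ _⟩ <;>
    exact (ae_dirac_iff measurableSet_Icc).2 (by simp)
  · have hm : Measurable fun t : ℝ => 1 - t := by fun_prop
    unfold iterLaw
    rw [Measure.map_add _ _ (by fun_prop), Measure.map_smul, Measure.map_smul,
      Measure.map_dirac' hm, Measure.map_dirac' hm, sub_zero, sub_self, add_comm]
  · rw [← setLIntegral_one, iterLaw_zero_free measurable_const]
    exact bot_le
  · rw [iterLaw_zero_free measurable_cost]
    exact bot_le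

variable (hR : Regime k (d - 1) θ) (hl : 0 ≤ lam) (hl1 : lam ≤ 1)
include hR hl hl1

lemma iterLaw_succ_of_good {l : ℕ} (h : Good k θ (iterLaw k d lam l)) :
    iterLaw k d lam (l + 1) = step k (d - 1) lam (iterLaw k d lam l) := by
  have := h.prob
  have := hR.large
  exact varRec_clauseRec (by omega) h.balanced hl hl1

lemma good_iterLaw (l : ℕ) : Good k θ (iterLaw k d lam l) := by
  induction l with
  | zero => exact good_iterLaw_zero
  | succ l ih =>
    rw [iterLaw_succ_of_good hR hl hl1 ih]
    exact ih.step hR hl hl1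

lemma iterLaw_succ (l : ℕ) :
    iterLaw k d lam (l + 1) = step k (d - 1) lam (iterLaw k d lam l) :=
  iterLaw_succ_of_good hR hl hl1 (good_iterLaw hR hl hl1 l)

lemma near_iterLaw_free (l j : ℕ) :
    Near (ENNReal.ofReal ((1 / 2) ^ l)) ((iterLaw k d lam l).restrict (Ioo 0 1))
        ((iterLaw k d lam (l + j)).restrict (Ioo 0 1)) ∧
    Near (ENNReal.ofReal ((1 / 2) ^ l)) ((iterLaw k d lam (l + j)).restrict (Ioo 0 1))
        ((iterLaw k d lam l).restrict (Ioo 0 1)) := by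
  induction l with
  | zero =>
    have key (i j : ℕ) : Near (ENNReal.ofReal ((1 / 2) ^ 0)) ((iterLaw k d lam i).restrict (Ioo 0 1))
        ((iterLaw k d lam j).restrict (Ioo 0 1)) := by
      intro φ _ hφ1
      have := (good_iterLaw (d := d) hR hl hl1 i).prob
      calc _ ≤ ∫⁻ _ in Ioo 0 1, 1 ∂iterLaw k d lam i := lintegral_mono hφ1
        _ ≤ 1 := by rw [setLIntegral_one]; exact prob_le_one
        _ ≤ _ := by simp
    exact ⟨key _ _, key _ _⟩
  | succ l ih =>
    rw [add_right_comm, iterLaw_succ hR hl hl1, iterLaw_succ hR hl hl1, pow_succ, mul_one_div]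
    have g1 := good_iterLaw (d := d) hR hl hl1 l
    have g2 := good_iterLaw (d := d) hR hl hl1 (l + j)
    exact ⟨g1.contract hR g2 hl hl1 (by positivity) ih.1 ih.2,
      g2.contract hR g1 hl hl1 (by positivity) ih.2 ih.1⟩

lemma near_iterLaw (l j : ℕ) :
    Near (ENNReal.ofReal (3 * (1 / 2) ^ l)) (iterLaw k d lam l) (iterLaw k d lam (l + j)) ∧
    Near (ENNReal.ofReal (3 * (1 / 2) ^ l)) (iterLaw k d lam (l + j)) (iterLaw k d lam l) := by
  have g1 := good_iterLaw (d := d) hR hl hl1 l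
  have g2 := good_iterLaw (d := d) hR hl hl1 (l + j)
  have := g1.prob
  have := g2.prob
  obtain ⟨h1, h2⟩ := near_iterLaw_free (d := d) hR hl hl1 l j
  rw [ENNReal.ofReal_mul (by norm_num)]
  simp only [ENNReal.ofReal_ofNat]
  exact ⟨g1.balanced.near g2.balanced h1 h2, g2.balanced.near g1.balanced h2 h1⟩

lemma countable_iterLaw (l : ℕ) :
    ∃ S : Set ℝ, S.Countable ∧ ∀ᵐ t ∂iterLaw k d lam l, t ∈ S := by
  induction l with
  | zero =>
    refine ⟨{0, 1}, by simp, ?_⟩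
    unfold iterLaw
    refine ae_add_measure_iff.2 ⟨Measure.ae_smul_measure ?_ _, Measure.ae_smul_measure ?_ _⟩ <;>
    exact (ae_dirac_iff (by measurability)).2 (by simp)
  | succ l ih =>
    rw [iterLaw_succ hR hl hl1]
    obtain ⟨S, hS, h⟩ := ih
    have g := good_iterLaw (d := d) hR hl hl1 l
    have := g.prob
    have hk : 0 < k - 1 := by have := hR.large; omega
    have := isFiniteMeasure_clauseRaw hk g.balanced hl hl1
    obtain ⟨S1, hS1, h1⟩ := countable_power (n := k - 1) hS h
    obtain ⟨S2, hS2, h2⟩ := ae_mem_range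
      (ν := (power (k - 1) (iterLaw k d lam l)).withDensity fun x => weight lam (2 - agree x)) hS1
      ((withDensity_absolutelyContinuous _ _).ae_le h1) measurable_clauseOut
    obtain ⟨S3, hS3, h3⟩ := countable_power (n := d - 1) (μ := clauseRaw (k - 1) lam (iterLaw k d lam l))
      hS2 h2
    exact countable_tiltedLaw hS3 h3 measurable_varOut

/-- The limit of the atoms. -/
lemma exists_atom_limit : ∃ a : ℝ → ℝ, (∀ x, 0 ≤ a x) ∧
    (∀ x, Tendsto (fun l => (iterLaw k d lam l).real {x}) atTop (𝓝 (a x))) ∧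
    ∀ l, ∀ F : Finset ℝ, ∑ x ∈ F, |(iterLaw k d lam l).real {x} - a x| ≤ 6 * (1 / 2) ^ l := by
  have hsum (l j : ℕ) (F : Finset ℝ) :
      ∑ x ∈ F, |(iterLaw k d lam l).real {x} - (iterLaw k d lam (l + j)).real {x}|
        ≤ 6 * (1 / 2) ^ l := by
    have := (good_iterLaw (d := d) hR hl hl1 l).prob
    have := (good_iterLaw (d := d) hR hl hl1 (l + j)).prob
    obtain ⟨h1, h2⟩ := near_iterLaw (d := d) hR hl hl1 l j
    have := sum_atoms_le (by positivity) h1 h2 F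
    linarith
  have hlim0 : Tendsto (fun l : ℕ => 6 * (1 / 2 : ℝ) ^ l) atTop (𝓝 0) := by
    simpa using (tendsto_pow_atTop_nhds_zero_of_lt_one (by norm_num : (0 : ℝ) ≤ 1 / 2)
      (by norm_num)).const_mul 6
  have hc (x : ℝ) : ∃ a, Tendsto (fun l => (iterLaw k d lam l).real {x}) atTop (𝓝 a) := by
    refine cauchySeq_tendsto_of_complete (cauchySeq_of_le_tendsto_0' _ ?_ hlim0)
    intro n m hnm
    obtain ⟨j, rfl⟩ := Nat.exists_eq_add_of_le hnm
    simpa [Real.dist_eq] using hsum n j {x}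
  choose a ha using hc
  refine ⟨a, fun x => ge_of_tendsto' (ha x) fun l => measureReal_nonneg, ha, fun l F => ?_⟩
  have h1 : Tendsto (fun j => ∑ x ∈ F, |(iterLaw k d lam l).real {x} - (iterLaw k d lam (l + j)).real {x}|)
      atTop (𝓝 (∑ x ∈ F, |(iterLaw k d lam l).real {x} - a x|)) := by
    refine tendsto_finsetSum _ fun x _ => ?_
    have h2 : Tendsto (fun j => (iterLaw k d lam (l + j)).real {x}) atTop (𝓝 (a x)) := by
      have := (tendsto_add_atTop_iff_nat l).2 (ha x)
      simpa only [add_comm] using this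
    exact (h2.const_sub _).abs
  exact le_of_tendsto' h1 fun j => hsum l j F

end Iteration

section Limits

variable {μ : ℕ → Measure ℝ} {ν ν' : Measure ℝ} {ε : ℕ → ℝ≥0∞}

lemma tendsto_lintegral_of_near (hε : Tendsto ε atTop (𝓝 0)) (h : ∀ l, Near (ε l) (μ l) ν)
    (h' : ∀ l, Near (ε l) ν (μ l)) {φ : ℝ → ℝ≥0∞} (hφ : Measurable φ) {c : ℝ≥0∞} (hc : c ≠ ∞)
    (hφc : ∀ t, φ t ≤ c) :
    Tendsto (fun l => ∫⁻ t, φ t ∂μ l) atTop (𝓝 (∫⁻ t, φ t ∂ν)) := by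
  have hcε : Tendsto (fun l => c * ε l) atTop (𝓝 0) := by
    simpa using ENNReal.Tendsto.const_mul hε (Or.inr hc)
  refine tendsto_of_tendsto_of_tendsto_of_le_of_le
    (g := fun l => ∫⁻ t, φ t ∂ν - c * ε l) (h := fun l => ∫⁻ t, φ t ∂ν + c * ε l) ?_ ?_ ?_ ?_
  · simpa using ENNReal.Tendsto.sub (tendsto_const_nhds (x := ∫⁻ t, φ t ∂ν)) hcε
      (Or.inr ENNReal.zero_ne_top)
  · simpa using (tendsto_const_nhds (x := ∫⁻ t, φ t ∂ν)).add hcε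
  · intro l
    exact tsub_le_iff_right.2 ((h' l).scaled hc hφ hφc)
  · intro l
    exact (h l).scaled hc hφ hφc

lemma eq_of_near (hε : Tendsto ε atTop (𝓝 0)) (h1 : ∀ l, Near (ε l) (μ l) ν)
    (h1' : ∀ l, Near (ε l) ν (μ l)) (h2 : ∀ l, Near (ε l) (μ l) ν') (h2' : ∀ l, Near (ε l) ν' (μ l)) :
    ν = ν' := by
  ext s hs
  rw [← lintegral_indicator_one hs, ← lintegral_indicator_one hs]
  have hb (t : ℝ) : s.indicator (1 : ℝ → ℝ≥0∞) t ≤ 1 := by by_cases ht : t ∈ s <;> simp [ht]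
  exact tendsto_nhds_unique
    (tendsto_lintegral_of_near hε h1 h1' (measurable_one.indicator hs) ENNReal.one_ne_top hb)
    (tendsto_lintegral_of_near hε h2 h2' (measurable_one.indicator hs) ENNReal.one_ne_top hb)

lemma Near.restrict {δ : ℝ≥0∞} {μ ν : Measure ℝ} (h : Near δ μ ν) {s : Set ℝ} (hs : MeasurableSet s) :
    Near δ (μ.restrict s) (ν.restrict s) := by
  intro φ hφ hφ1
  rw [← lintegral_indicator hs, ← lintegral_indicator hs]
  exact h _ (hφ.indicator hs) fun t => (indicator_le_self _ _ t).trans (hφ1 t)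

lemma Good.of_near (hε : Tendsto ε atTop (𝓝 0)) (h : ∀ l, Near (ε l) (μ l) ν)
    (h' : ∀ l, Near (ε l) ν (μ l)) {k : ℕ} {θ : ℝ} (hμ : ∀ l, Good k θ (μ l)) : Good k θ ν := by
  have hlim {φ : ℝ → ℝ≥0∞} (hφ : Measurable φ) (hφ1 : ∀ t, φ t ≤ 1) :=
    tendsto_lintegral_of_near hε h h' hφ ENNReal.one_ne_top hφ1
  have hind {s : Set ℝ} (hs : MeasurableSet s) : Tendsto (fun l => μ l s) atTop (𝓝 (ν s)) := by
    have := hlim (φ := s.indicator 1) (measurable_one.indicator hs) fun t => by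
      by_cases ht : t ∈ s <;> simp [ht]
    simpa [lintegral_indicator_one hs] using this
  refine ⟨⟨?_⟩, ⟨?_, ?_⟩, ?_, ?_⟩
  · have h1 := hind MeasurableSet.univ
    have h2 (l : ℕ) : μ l univ = 1 := by have := (hμ l).prob; exact measure_univ
    simp only [h2] at h1
    exact tendsto_nhds_unique h1 tendsto_const_nhds
  · have h1 := hind (measurableSet_Icc (a := (0 : ℝ)) (b := 1)).compl
    have h2 (l : ℕ) : μ l (Icc 0 1)ᶜ = 0 := (hμ l).balanced.supp
    simp only [h2] at h1
    exact tendsto_nhds_unique h1 tendsto_const_nhds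
  · have hm : Measurable fun t : ℝ => 1 - t := by fun_prop
    ext s hs
    rw [Measure.map_apply hm hs]
    refine tendsto_nhds_unique (hind (hm hs)) ?_
    refine (hind hs).congr fun l => ?_
    conv_lhs => rw [← (hμ l).balanced.symm]
    rw [Measure.map_apply hm hs]
  · exact le_of_tendsto' (hind measurableSet_Ioo) fun l => (hμ l).free_le
  · have h1 (n : ℕ) : ∫⁻ t in Ioo 0 1, min (cost t) n ∂ν ≤ ENNReal.ofReal (k ^ 4 * θ ^ 2) := by
      refine le_of_tendsto' (tendsto_lintegral_of_near hε
        (fun l => (h l).restrict measurableSet_Ioo) (fun l => (h' l).restrict measurableSet_Ioo)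
        (measurable_cost.min measurable_const) (ENNReal.natCast_ne_top n) fun t => min_le_right _ _) ?_
      intro l
      exact (lintegral_mono fun t => min_le_left _ _).trans (hμ l).cost_le
    have h2 (t : ℝ) : cost t = ⨆ n : ℕ, min (cost t) n := by
      rw [← inf_iSup_eq, ENNReal.iSup_natCast, inf_top_eq]
    calc _ = ∫⁻ t in Ioo 0 1, ⨆ n : ℕ, min (cost t) n ∂ν := lintegral_congr fun t => h2 t
      _ = ⨆ n : ℕ, ∫⁻ t in Ioo 0 1, min (cost t) n ∂ν := by
        refine lintegral_iSup (fun n => measurable_cost.min measurable_const) ?_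
        intro n m hnm t
        exact min_le_min le_rfl (by exact_mod_cast hnm)
      _ ≤ _ := iSup_le h1

end Limits

section Limit

variable {k d : ℕ} {θ lam : ℝ} (hR : Regime k (d - 1) θ) (hl : 0 ≤ lam) (hl1 : lam ≤ 1)
include hR hl hl1

/-- Everything about the convergence of the laws `μ_l` to `varLaw`. -/
lemma varLaw_limit :
    (∀ l, atomDist (iterLaw k d lam l) (varLaw k d lam) ≤ ENNReal.ofReal (6 * (1 / 2) ^ l)) ∧
    (∀ l, Near (ENNReal.ofReal (6 * (1 / 2) ^ l)) (iterLaw k d lam l) (varLaw k d lam)) ∧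
    (∀ l, Near (ENNReal.ofReal (6 * (1 / 2) ^ l)) (varLaw k d lam) (iterLaw k d lam l)) := by
  obtain ⟨a, ha0, ha, hsum⟩ := exists_atom_limit (d := d) hR hl hl1
  have hp (l : ℕ) := (good_iterLaw (d := d) hR hl hl1 l).prob
  have heq : varLaw k d lam = Measure.sum fun x : ℝ => ENNReal.ofReal (a x) • Measure.dirac x := by
    unfold varLaw
    congr 1
    funext x
    congr 1
    refine Tendsto.limUnder_eq ?_
    refine (ENNReal.tendsto_ofReal (ha x)).congr fun l => ?_
    exact ofReal_measureReal
  have happly {s : Set ℝ} (hs : MeasurableSet s) :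
      varLaw k d lam s = ∑' x, ENNReal.ofReal (a x) * s.indicator 1 x := by
    rw [heq, Measure.sum_apply _ hs]
    simp [Measure.dirac_apply' _ hs]
  have hatom (x : ℝ) : varLaw k d lam {x} = ENNReal.ofReal (a x) := by
    rw [happly (measurableSet_singleton x), tsum_eq_single x]
    · simp
    · intro y hy
      simp [hy]
  have hfin : varLaw k d lam univ ≤ ENNReal.ofReal 7 := by
    rw [happly MeasurableSet.univ, ENNReal.tsum_eq_iSup_sum]
    refine iSup_le fun F => ?_
    simp only [indicator_univ, Pi.one_apply, mul_one]
    rw [← ENNReal.ofReal_sum_of_nonneg fun x _ => ha0 x]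
    refine ENNReal.ofReal_le_ofReal ?_
    have h1 : ∑ x ∈ F, (iterLaw k d lam 0).real {x} ≤ 1 := by
      rw [sum_measureReal_singleton]
      exact measureReal_le_one
    have h2 := hsum 0 F
    have h3 : ∑ x ∈ F, a x ≤ ∑ x ∈ F, ((iterLaw k d lam 0).real {x}
        + |(iterLaw k d lam 0).real {x} - a x|) := by
      refine Finset.sum_le_sum fun x _ => ?_
      linarith [neg_abs_le ((iterLaw k d lam 0).real {x} - a x)]
    rw [Finset.sum_add_distrib] at h3
    norm_num at h2
    linarith
  have hfinite : IsFiniteMeasure (varLaw k d lam) := ⟨hfin.trans_lt ENNReal.ofReal_lt_top⟩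
  have hdist (l : ℕ) :
      atomDist (iterLaw k d lam l) (varLaw k d lam) ≤ ENNReal.ofReal (6 * (1 / 2) ^ l) := by
    unfold atomDist
    have h1 (x : ℝ) : (varLaw k d lam).real {x} = a x := by
      rw [Measure.real, hatom, ENNReal.toReal_ofReal (ha0 x)]
    simp only [h1]
    rw [ENNReal.tsum_eq_iSup_sum]
    refine iSup_le fun F => ?_
    rw [← ENNReal.ofReal_sum_of_nonneg fun x _ => abs_nonneg _]
    exact ENNReal.ofReal_le_ofReal (hsum l F)
  choose S hS hSae using fun l => countable_iterLaw (d := d) hR hl hl1 l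
  have hU : (⋃ l, S l).Countable := countable_iUnion hS
  have hUl (l : ℕ) : ∀ᵐ t ∂iterLaw k d lam l, t ∈ ⋃ l, S l := by
    filter_upwards [hSae l] with t ht using mem_iUnion.2 ⟨l, ht⟩
  have hUv : ∀ᵐ t ∂varLaw k d lam, t ∈ ⋃ l, S l := by
    refine (happly hU.measurableSet.compl).trans ?_
    refine ENNReal.tsum_eq_zero.2 fun x => ?_
    by_cases hx : x ∈ ⋃ l, S l
    · rw [indicator_of_notMem (notMem_compl_iff.2 hx), mul_zero]
    · have h1 (l : ℕ) : (iterLaw k d lam l).real {x} = 0 := by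
        have : iterLaw k d lam l {x} = 0 :=
          measure_mono_null (singleton_subset_iff.2 hx) (hUl l)
        simp [Measure.real, this]
      have h2 := ha x
      simp only [h1] at h2
      simp [tendsto_nhds_unique h2 tendsto_const_nhds]
  have hmono {δ δ' : ℝ≥0∞} {μ ν : Measure ℝ} (h : Near δ μ ν) (hd : δ ≤ δ') : Near δ' μ ν :=
    fun φ hφ hφ1 => (h φ hφ hφ1).trans (by gcongr)
  refine ⟨hdist, fun l => hmono (near_atomDist hU (hUl l) hUv) (hdist l),
    fun l => hmono (near_atomDist hU hUv (hUl l)) ?_⟩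
  rw [atomDist_comm]
  exact hdist l

omit hR hl hl1 in
lemma tendsto_rate (c : ℝ) : Tendsto (fun l : ℕ => ENNReal.ofReal (c * (1 / 2) ^ l)) atTop (𝓝 0) := by
  have := ENNReal.tendsto_ofReal ((tendsto_pow_atTop_nhds_zero_of_lt_one
    (by norm_num : (0 : ℝ) ≤ 1 / 2) (by norm_num)).const_mul c)
  simpa using this

lemma good_varLaw : Good k θ (varLaw k d lam) := by
  obtain ⟨-, h, h'⟩ := varLaw_limit (d := d) hR hl hl1
  exact Good.of_near (tendsto_rate 6) h h' fun l => good_iterLaw hR hl hl1 l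

lemma tendsto_atomDist :
    Tendsto (fun l => atomDist (iterLaw k d lam l) (varLaw k d lam)) atTop (𝓝 0) :=
  tendsto_of_tendsto_of_tendsto_of_le_of_le tendsto_const_nhds (tendsto_rate 6) (fun _ => bot_le)
    (varLaw_limit (d := d) hR hl hl1).1

lemma step_varLaw : step k (d - 1) lam (varLaw k d lam) = varLaw k d lam := by
  obtain ⟨-, h, h'⟩ := varLaw_limit (d := d) hR hl hl1
  have hg := good_varLaw (d := d) hR hl hl1
  have hgs := hg.step hR hl hl1
  have hrate (l : ℕ) : 3 * ENNReal.ofReal (6 * (1 / 2) ^ l / 2) = ENNReal.ofReal (9 * (1 / 2) ^ l) := by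
    rw [show (3 : ℝ≥0∞) = ENNReal.ofReal 3 by simp, ← ENNReal.ofReal_mul (by norm_num)]
    congr 1
    ring
  have key (l : ℕ) : Near (ENNReal.ofReal (9 * (1 / 2) ^ l)) (iterLaw k d lam (l + 1))
        (step k (d - 1) lam (varLaw k d lam)) ∧
      Near (ENNReal.ofReal (9 * (1 / 2) ^ l)) (step k (d - 1) lam (varLaw k d lam))
        (iterLaw k d lam (l + 1)) := by
    have gl := good_iterLaw (d := d) hR hl hl1 l
    have gl' := good_iterLaw (d := d) hR hl hl1 (l + 1)
    have := hgs.prob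
    have := gl'.prob
    have h1 := gl.contract hR hg hl hl1 (by positivity) ((h l).restrict measurableSet_Ioo)
      ((h' l).restrict measurableSet_Ioo)
    have h2 := hg.contract hR gl hl hl1 (by positivity) ((h' l).restrict measurableSet_Ioo)
      ((h l).restrict measurableSet_Ioo)
    rw [← iterLaw_succ hR hl hl1] at h1 h2
    rw [← hrate]
    exact ⟨gl'.balanced.near hgs.balanced h1 h2, hgs.balanced.near gl'.balanced h2 h1⟩
  have hmono {c c' : ℝ} {l : ℕ} {μ ν : Measure ℝ} (h : Near (ENNReal.ofReal (c * (1 / 2) ^ l)) μ ν)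
      (hd : c ≤ c') : Near (ENNReal.ofReal (c' * (1 / 2) ^ l)) μ ν :=
    fun φ hφ hφ1 => (h φ hφ hφ1).trans (by gcongr)
  have hsucc {μ ν : Measure ℝ} {l : ℕ} (h : Near (ENNReal.ofReal (6 * (1 / 2) ^ (l + 1))) μ ν) :
      Near (ENNReal.ofReal (9 * (1 / 2) ^ l)) μ ν := by
    refine hmono (c := 3) ?_ (by norm_num)
    rwa [show (3 : ℝ) * (1 / 2) ^ l = 6 * (1 / 2) ^ (l + 1) by rw [pow_succ]; ring]
  exact eq_of_near (μ := fun l => iterLaw k d lam (l + 1)) (tendsto_rate 9) (fun l => (key l).1)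
    (fun l => (key l).2) (fun l => hsucc (h (l + 1))) (fun l => hsucc (h' (l + 1)))

end Limit

section Expansion

variable {n : ℕ} {x : Fin n → ℝ}

lemma prod_indicator_one (s : Finset (Fin n)) (A : Set ℝ) [DecidablePred (· ∈ A)] :
    ∏ j ∈ s, A.indicator (1 : ℝ → ℝ≥0∞) (x j) = if ∀ j ∈ s, x j ∈ A then 1 else 0 := by
  simp only [indicator_apply, Pi.one_apply]
  rw [Finset.prod_ite_zero]
  simp

/-- The part of an integrand carried by configurations with at most one free entry and all other
entries equal. -/
noncomputable def mainPart (n : ℕ) (c1 c0 : ℝ≥0∞) (g1 g0 : ℝ → ℝ≥0∞) (x : Fin n → ℝ) : ℝ≥0∞ :=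
  c1 * ∏ i, ({1} : Set ℝ).indicator 1 (x i) + c0 * ∏ i, ({0} : Set ℝ).indicator 1 (x i)
    + (∑ i, (Ioo 0 1).indicator g1 (x i) * ∏ j ∈ Finset.univ.erase i, ({1} : Set ℝ).indicator 1 (x j)
      + ∑ i, (Ioo 0 1).indicator g0 (x i) * ∏ j ∈ Finset.univ.erase i, ({0} : Set ℝ).indicator 1 (x j))

/-- A bound for the rest. -/
noncomputable def restPart (n : ℕ) (h : ℝ → ℝ≥0∞) (x : Fin n → ℝ) : ℝ≥0∞ :=
  ∑ i, ∑ j ∈ Finset.univ.erase i, ((Ioo 0 1).indicator h (x i) * ((Ioo 0 1).indicator 1 (x j)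
      * ∏ l ∈ (Finset.univ.erase i).erase j, ({0}ᶜ : Set ℝ).indicator 1 (x l))
    + (Ioo 0 1).indicator h (x i) * ((Ioo 0 1).indicator 1 (x j)
      * ∏ l ∈ (Finset.univ.erase i).erase j, ({1}ᶜ : Set ℝ).indicator 1 (x l)))

variable {G : (Fin n → ℝ) → ℝ≥0∞} {g1 g0 h : ℝ → ℝ≥0∞}

lemma mainPart_free {c1 c0 : ℝ≥0∞} {i : Fin n} (hi : x i ∈ Ioo (0 : ℝ) 1) :
    mainPart n c1 c0 g1 g0 x = (if ∀ j ≠ i, x j = 1 then g1 (x i) else 0)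
      + if ∀ j ≠ i, x j = 0 then g0 (x i) else 0 := by
  classical
  have hz (a : ℝ) (ha : a = 0 ∨ a = 1) : x i ≠ a := by
    rintro rfl
    rcases ha with h | h <;> simp [h] at hi
  have h1 (a : ℝ) (ha : a = 0 ∨ a = 1) : ∏ i, ({a} : Set ℝ).indicator (1 : ℝ → ℝ≥0∞) (x i) = 0 := by
    rw [prod_indicator_one, if_neg]
    intro h
    exact hz a ha (h i (Finset.mem_univ i))
  have h2 (a : ℝ) (ha : a = 0 ∨ a = 1) (g : ℝ → ℝ≥0∞) : ∑ i, (Ioo 0 1).indicator g (x i)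
      * ∏ j ∈ Finset.univ.erase i, ({a} : Set ℝ).indicator (1 : ℝ → ℝ≥0∞) (x j)
      = if ∀ j ≠ i, x j = a then g (x i) else 0 := by
    rw [Finset.sum_eq_single i]
    · rw [prod_indicator_one, indicator_of_mem hi]
      simp
    · intro j _ hj
      rw [prod_indicator_one, if_neg, mul_zero]
      intro h
      exact hz a ha (h i (Finset.mem_erase.2 ⟨hj.symm, Finset.mem_univ i⟩))
    · simp
  unfold mainPart
  rw [h1 1 (Or.inr rfl), h1 0 (Or.inl rfl), h2 1 (Or.inr rfl), h2 0 (Or.inl rfl)]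
  simp

lemma mainPart_forced {c1 c0 : ℝ≥0∞} (hx : ∀ i, x i ∉ Ioo (0 : ℝ) 1) :
    mainPart n c1 c0 g1 g0 x = (if ∀ j, x j = 1 then c1 else 0) + if ∀ j, x j = 0 then c0 else 0 := by
  classical
  unfold mainPart
  simp only [indicator_of_notMem (hx _), zero_mul, Finset.sum_const_zero, add_zero]
  rw [prod_indicator_one, prod_indicator_one]
  simp

variable (hn : 2 ≤ n) (hmix : ∀ x, (∃ i, x i = 0) → (∃ i, x i = 1) → G x = 0)
  (hg1 : ∀ i x, x i ∈ Ioo (0 : ℝ) 1 → (∀ j ≠ i, x j = 1) → G x = g1 (x i))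
  (hg0 : ∀ i x, x i ∈ Ioo (0 : ℝ) 1 → (∀ j ≠ i, x j = 0) → G x = g0 (x i))

include hn hg1 hg0 in
lemma mainPart_le (x : Fin n → ℝ) : mainPart n (G fun _ => 1) (G fun _ => 0) g1 g0 x ≤ G x := by
  by_cases hf : ∃ i, x i ∈ Ioo (0 : ℝ) 1
  · obtain ⟨i, hi⟩ := hf
    have : Nontrivial (Fin n) := Fin.nontrivial_iff_two_le.2 hn
    obtain ⟨j, hj⟩ := exists_ne i
    rw [mainPart_free hi]
    split_ifs with h1 h2 h2
    · exact absurd ((h1 j hj).symm.trans (h2 j hj)) one_ne_zero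
    · rw [add_zero, hg1 i x hi h1]
    · rw [zero_add, hg0 i x hi h2]
    · simp
  · push Not at hf
    rw [mainPart_forced hf]
    split_ifs with h1 h2 h2
    · exact absurd ((h1 ⟨0, by omega⟩).symm.trans (h2 ⟨0, by omega⟩)) one_ne_zero
    · rw [add_zero, show x = fun _ => 1 from funext h1]
    · rw [zero_add, show x = fun _ => 0 from funext h2]
    · simp

include hmix hg1 hg0 in
lemma le_mainPart_add (hh : ∀ x, (∀ i, x i ∈ Icc (0 : ℝ) 1) → ∀ i, x i ∈ Ioo (0 : ℝ) 1 → G x ≤ h (x i))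
    (hx : ∀ i, x i ∈ Icc (0 : ℝ) 1) :
    G x ≤ mainPart n (G fun _ => 1) (G fun _ => 0) g1 g0 x + restPart n h x := by
  by_cases hm : (∃ i, x i = 0) ∧ ∃ i, x i = 1
  · rw [hmix x hm.1 hm.2]
    exact bot_le
  have hcase (s : Set (Fin n)) (hs : ∀ j ∈ s, x j ∉ Ioo (0 : ℝ) 1) :
      (∀ j ∈ s, x j = 1) ∨ ∀ j ∈ s, x j = 0 := by
    have h01 (j : Fin n) (hj : j ∈ s) : x j = 0 ∨ x j = 1 := by
      have := hs j hj
      by_contra hc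
      push Not at hc
      exact this ⟨lt_of_le_of_ne (hx j).1 hc.1.symm, lt_of_le_of_ne (hx j).2 hc.2⟩
    by_cases h1 : ∃ i, x i = 1
    · refine Or.inl fun j hj => (h01 j hj).resolve_left fun h0 => hm ⟨⟨j, h0⟩, h1⟩
    · exact Or.inr fun j hj => (h01 j hj).resolve_right fun h0 => h1 ⟨j, h0⟩
  by_cases hf : ∃ i, x i ∈ Ioo (0 : ℝ) 1
  · obtain ⟨i, hi⟩ := hf
    by_cases hj : ∃ j ≠ i, x j ∈ Ioo (0 : ℝ) 1
    · obtain ⟨j, hji, hj⟩ := hj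
      refine le_add_left ?_
      calc G x ≤ h (x i) * 1 := by rw [mul_one]; exact hh x hx i hi
        _ ≤ h (x i) * (∏ l ∈ (Finset.univ.erase i).erase j, ({0}ᶜ : Set ℝ).indicator 1 (x l)
            + ∏ l ∈ (Finset.univ.erase i).erase j, ({1}ᶜ : Set ℝ).indicator 1 (x l)) := by
          gcongr
          exact one_le_noZero_add_noOne hm _
        _ = (Ioo 0 1).indicator h (x i) * ((Ioo 0 1).indicator 1 (x j)
              * ∏ l ∈ (Finset.univ.erase i).erase j, ({0}ᶜ : Set ℝ).indicator 1 (x l))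
            + (Ioo 0 1).indicator h (x i) * ((Ioo 0 1).indicator 1 (x j)
              * ∏ l ∈ (Finset.univ.erase i).erase j, ({1}ᶜ : Set ℝ).indicator 1 (x l)) := by
          rw [indicator_of_mem hi, indicator_of_mem hj, Pi.one_apply, one_mul, one_mul, mul_add]
        _ ≤ _ := by
          unfold restPart
          refine le_trans ?_ (Finset.single_le_sum (fun _ _ => bot_le) (Finset.mem_univ i))
          exact Finset.single_le_sum (f := fun j => (Ioo 0 1).indicator h (x i) * ((Ioo 0 1).indicator 1 (x j)
              * ∏ l ∈ (Finset.univ.erase i).erase j, ({0}ᶜ : Set ℝ).indicator 1 (x l))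
            + (Ioo 0 1).indicator h (x i) * ((Ioo 0 1).indicator 1 (x j)
              * ∏ l ∈ (Finset.univ.erase i).erase j, ({1}ᶜ : Set ℝ).indicator 1 (x l)))
            (fun _ _ => bot_le) (Finset.mem_erase.2 ⟨hji, Finset.mem_univ j⟩)
    · push Not at hj
      refine le_add_right ?_
      rw [mainPart_free hi]
      rcases hcase {j | j ≠ i} hj with h1 | h1
      · replace h1 : ∀ j ≠ i, x j = 1 := h1
        rw [if_pos h1, hg1 i x hi h1]
        exact le_add_right le_rfl
      · replace h1 : ∀ j ≠ i, x j = 0 := h1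
        rw [if_pos h1, hg0 i x hi h1]
        exact le_add_left le_rfl
  · push Not at hf
    refine le_add_right ?_
    rw [mainPart_forced hf]
    rcases hcase univ fun j _ => hf j with h1 | h1
    · rw [if_pos fun j => h1 j trivial, show x = fun _ => 1 from funext fun j => h1 j trivial]
      exact le_add_right le_rfl
    · rw [if_pos fun j => h1 j trivial, show x = fun _ => 0 from funext fun j => h1 j trivial]
      exact le_add_left le_rfl

variable {μ : Measure ℝ} [IsFiniteMeasure μ]

lemma lintegral_mainPart (hμ : Balanced μ) (hm1 : Measurable g1) (hm0 : Measurable g0) {c1 c0 : ℝ≥0∞} :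
    ∫⁻ x, mainPart n c1 c0 g1 g0 x ∂power n μ = (c1 + c0) * μ {1} ^ n
      + n * ((∫⁻ t in Ioo 0 1, g1 t ∂μ + ∫⁻ t in Ioo 0 1, g0 t ∂μ) * μ {1} ^ (n - 1)) := by
  have hI (a : ℝ) : Measurable (({a} : Set ℝ).indicator (1 : ℝ → ℝ≥0∞)) :=
    measurable_one.indicator (measurableSet_singleton a)
  have hF {g : ℝ → ℝ≥0∞} (hg : Measurable g) : Measurable ((Ioo (0 : ℝ) 1).indicator g) :=
    hg.indicator measurableSet_Ioo
  have h1 (a : ℝ) : ∫⁻ x, ∏ i, ({a} : Set ℝ).indicator (1 : ℝ → ℝ≥0∞) (x i) ∂power n μ = μ {a} ^ n := by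
    rw [lintegral_power_prod_const (hI a), lintegral_indicator_one (measurableSet_singleton a)]
  have h2 (a : ℝ) {g : ℝ → ℝ≥0∞} (hg : Measurable g) :
      ∫⁻ x : Fin n → ℝ, ∑ i, (Ioo 0 1).indicator g (x i)
        * ∏ j ∈ Finset.univ.erase i, ({a} : Set ℝ).indicator (1 : ℝ → ℝ≥0∞) (x j) ∂power n μ
      = n * ((∫⁻ t in Ioo 0 1, g t ∂μ) * μ {a} ^ (n - 1)) := by
    have := hF hg
    have := hI a
    rw [lintegral_finsetSum _ fun i _ => by fun_prop]
    simp only [lintegral_power_single (hI a) (hF hg), lintegral_indicator_one (measurableSet_singleton a),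
      lintegral_indicator measurableSet_Ioo]
    simp
  have := hF hm1
  have := hF hm0
  have := hI 0
  have := hI 1
  unfold mainPart
  rw [lintegral_add_left (by fun_prop), lintegral_add_left (by fun_prop),
    lintegral_add_left (by fun_prop), lintegral_const_mul _ (by fun_prop),
    lintegral_const_mul _ (by fun_prop), h1, h1, h2 _ hm1, h2 _ hm0, hμ.atom]
  ring

lemma lintegral_restPart (hμ : Balanced μ) (hh : Measurable h) :
    ∫⁻ x, restPart n h x ∂power n μ ≤ n * (n * (2 * ((∫⁻ t in Ioo 0 1, h t ∂μ)
      * (μ (Ioo 0 1) * μ {0}ᶜ ^ (n - 2))))) := by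
  have hI (a : ℝ) : Measurable (({a}ᶜ : Set ℝ).indicator (1 : ℝ → ℝ≥0∞)) :=
    measurable_one.indicator (measurableSet_singleton a).compl
  have hF : Measurable ((Ioo (0 : ℝ) 1).indicator h) := hh.indicator measurableSet_Ioo
  have hF1 : Measurable ((Ioo (0 : ℝ) 1).indicator (1 : ℝ → ℝ≥0∞)) := measurable_one.indicator measurableSet_Ioo
  have h0 := hI 0
  have h1 := hI 1
  have key (a : ℝ) {i j : Fin n} (hij : j ≠ i) :
      ∫⁻ x, (Ioo 0 1).indicator h (x i) * ((Ioo 0 1).indicator 1 (x j)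
      * ∏ l ∈ (Finset.univ.erase i).erase j, ({a}ᶜ : Set ℝ).indicator 1 (x l)) ∂power n μ
      = (∫⁻ t in Ioo 0 1, h t ∂μ) * (μ (Ioo 0 1) * μ {a}ᶜ ^ (n - 2)) := by
    rw [lintegral_power_pair (hI a) hF hF1 hij, lintegral_indicator_one (measurableSet_singleton a).compl,
      lintegral_indicator_one measurableSet_Ioo, lintegral_indicator measurableSet_Ioo]
  unfold restPart
  rw [lintegral_finsetSum _ fun i _ => by fun_prop]
  refine (Finset.sum_le_card_nsmul _ _ (n * (2 * ((∫⁻ t in Ioo 0 1, h t ∂μ)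
      * (μ (Ioo 0 1) * μ {0}ᶜ ^ (n - 2))))) fun i _ => ?_).trans_eq (by simp)
  rw [lintegral_finsetSum _ fun i _ => by fun_prop]
  refine (Finset.sum_le_card_nsmul _ _ (2 * ((∫⁻ t in Ioo 0 1, h t ∂μ)
      * (μ (Ioo 0 1) * μ {0}ᶜ ^ (n - 2)))) fun j hj => ?_).trans ?_
  · rw [lintegral_add_left (by fun_prop), key 0 (Finset.ne_of_mem_erase hj),
      key 1 (Finset.ne_of_mem_erase hj), hμ.mass_ne_one, ← hμ.mass_ne_zero, two_mul]
  · rw [nsmul_eq_mul]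
    gcongr
    exact (Finset.card_le_univ _).trans_eq (Fintype.card_fin n)

include hn hmix hg1 hg0 in
/-- First order expansion of an integral which vanishes on contradictory configurations. -/
lemma lintegral_expansion (hμ : Balanced μ) (hm1 : Measurable g1) (hm0 : Measurable g0)
    (hmh : Measurable h)
    (hh : ∀ x, (∀ i, x i ∈ Icc (0 : ℝ) 1) → ∀ i, x i ∈ Ioo (0 : ℝ) 1 → G x ≤ h (x i)) :
    (G (fun _ => 1) + G fun _ => 0) * μ {1} ^ n
      + n * ((∫⁻ t in Ioo 0 1, g1 t ∂μ + ∫⁻ t in Ioo 0 1, g0 t ∂μ) * μ {1} ^ (n - 1))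
      ≤ ∫⁻ x, G x ∂power n μ ∧
    ∫⁻ x, G x ∂power n μ ≤ (G (fun _ => 1) + G fun _ => 0) * μ {1} ^ n
      + n * ((∫⁻ t in Ioo 0 1, g1 t ∂μ + ∫⁻ t in Ioo 0 1, g0 t ∂μ) * μ {1} ^ (n - 1))
      + n * (n * (2 * ((∫⁻ t in Ioo 0 1, h t ∂μ) * (μ (Ioo 0 1) * μ {0}ᶜ ^ (n - 2))))) := by
  rw [← lintegral_mainPart hμ hm1 hm0]
  refine ⟨lintegral_mono fun x => mainPart_le hn hg1 hg0 x, ?_⟩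
  calc _ ≤ ∫⁻ x, mainPart n (G fun _ => 1) (G fun _ => 0) g1 g0 x + restPart n h x ∂power n μ := by
        refine lintegral_mono_ae ?_
        filter_upwards [hμ.ae_power] with x hx using le_mainPart_add hmix hg1 hg0 hh hx
    _ = ∫⁻ x, mainPart n (G fun _ => 1) (G fun _ => 0) g1 g0 x ∂power n μ
        + ∫⁻ x, restPart n h x ∂power n μ := by
        refine lintegral_add_right _ ?_
        have := hmh.indicator (measurableSet_Ioo (a := (0 : ℝ)) (b := 1))
        have hF1 : Measurable ((Ioo (0 : ℝ) 1).indicator (1 : ℝ → ℝ≥0∞)) :=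
          measurable_one.indicator measurableSet_Ioo
        have hI (a : ℝ) : Measurable (({a}ᶜ : Set ℝ).indicator (1 : ℝ → ℝ≥0∞)) :=
          measurable_one.indicator (measurableSet_singleton a).compl
        have h0 := hI 0
        have h1 := hI 1
        unfold restPart
        fun_prop
    _ ≤ _ := by
        gcongr
        exact lintegral_restPart hμ hmh

end Expansion

section Apply

variable {k N : ℕ} {θ lam : ℝ} {μ : Measure ℝ}

lemma Good.lintegral_one_add_cost_le (hR : Regime k N θ) (h : Good k θ μ) :
    ∫⁻ t in Ioo 0 1, (1 + cost t) ∂μ ≤ ENNReal.ofReal (2 * θ) := by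
  have h1 := hR.theta_pos
  rw [lintegral_add_left measurable_const, setLIntegral_one]
  refine (add_le_add h.free_le h.cost_le).trans ?_
  rw [← ENNReal.ofReal_add h1.le (by positivity)]
  refine ENNReal.ofReal_le_ofReal ?_
  have h2 : (k : ℝ) ^ 4 * θ ≤ (k : ℝ) ^ 12 * θ := by
    gcongr
    · linarith [hR.k_ge]
    · norm_num
  nlinarith [hR.small]

lemma Regime.free_pow_le (hR : Regime k N θ) {n : ℕ} (hn : k - 1 ≤ n) :
    ((1 + θ) / 2) ^ (n - 2) ≤ 6 * θ := by
  have h0 := hR.theta_pos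
  have h1 := hR.pow_ne_zero_le h0.le le_rfl
  have h2 := hR.small_zero
  have h3 := hR.large
  obtain ⟨j, hj⟩ : ∃ j, k = j + 3 := ⟨k - 3, by omega⟩
  have h4 : ((1 + θ) / 2) ^ (n - 2) ≤ ((1 + θ) / 2) ^ j :=
    pow_le_pow_of_le_one (by positivity) (by linarith) (by omega)
  rw [show k - 1 - 1 = j + 1 by omega, pow_succ] at h1
  have h5 : 0 ≤ ((1 + θ) / 2) ^ j := by positivity
  nlinarith

lemma Good.expansion (hR : Regime k N θ) (h : Good k θ μ) {n : ℕ} (hn : k - 1 ≤ n) (hnk : n ≤ k)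
    {G : (Fin n → ℝ) → ℝ≥0∞} {g1 g0 : ℝ → ℝ≥0∞}
    (hmix : ∀ x, (∃ i, x i = 0) → (∃ i, x i = 1) → G x = 0)
    (hg1 : ∀ i x, x i ∈ Ioo (0 : ℝ) 1 → (∀ j ≠ i, x j = 1) → G x = g1 (x i))
    (hg0 : ∀ i x, x i ∈ Ioo (0 : ℝ) 1 → (∀ j ≠ i, x j = 0) → G x = g0 (x i))
    (hm1 : Measurable g1) (hm0 : Measurable g0)
    (hh : ∀ x, (∀ i, x i ∈ Icc (0 : ℝ) 1) → ∀ i, x i ∈ Ioo (0 : ℝ) 1 → G x ≤ 1 + cost (x i))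
    {c j : ℝ} (hc : (G (fun _ => 1) + G fun _ => 0) = ENNReal.ofReal c) (hc0 : 0 ≤ c)
    (hj : ∫⁻ t in Ioo 0 1, g1 t ∂μ + ∫⁻ t in Ioo 0 1, g0 t ∂μ = ENNReal.ofReal j) (hj0 : 0 ≤ j) :
    ∃ I : ℝ, ∫⁻ x, G x ∂power n μ = ENNReal.ofReal I ∧ 0 ≤ I ∧
      c * μ.real {1} ^ n + n * (j * μ.real {1} ^ (n - 1)) ≤ I ∧
      I ≤ c * μ.real {1} ^ n + n * (j * μ.real {1} ^ (n - 1)) + 24 * k ^ 2 * θ ^ 3 := by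
  have := h.prob
  have hk := hR.large
  have hθ := hR.theta_pos
  obtain ⟨hlow, hupp⟩ := lintegral_expansion (by omega) hmix hg1 hg0 h.balanced hm1 hm0
    (measurable_const.add measurable_cost) hh
  have hmain : (G (fun _ => 1) + G fun _ => 0) * μ {1} ^ n
      + n * ((∫⁻ t in Ioo 0 1, g1 t ∂μ + ∫⁻ t in Ioo 0 1, g0 t ∂μ) * μ {1} ^ (n - 1))
      = ENNReal.ofReal (c * μ.real {1} ^ n + n * (j * μ.real {1} ^ (n - 1))) := by
    rw [hc, hj, ← ofReal_measureReal (μ := μ) (s := {1}), ← ENNReal.ofReal_pow measureReal_nonneg,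
      ← ENNReal.ofReal_pow measureReal_nonneg, ← ENNReal.ofReal_mul hc0, ← ENNReal.ofReal_mul hj0,
      ← ENNReal.ofReal_natCast n, ← ENNReal.ofReal_mul (by positivity), ← ENNReal.ofReal_add]
    · positivity
    · positivity
  have hrest : n * (n * (2 * ((∫⁻ t in Ioo 0 1, (1 + cost t) ∂μ)
      * (μ (Ioo 0 1) * μ {0}ᶜ ^ (n - 2))))) ≤ ENNReal.ofReal (24 * k ^ 2 * θ ^ 3) := by
    calc _ ≤ ENNReal.ofReal k * (ENNReal.ofReal k * (ENNReal.ofReal 2 * (ENNReal.ofReal (2 * θ)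
          * (ENNReal.ofReal θ * ENNReal.ofReal ((1 + θ) / 2) ^ (n - 2))))) := by
          have h1 : (n : ℝ≥0∞) ≤ ENNReal.ofReal k := by
            rw [ENNReal.ofReal_natCast]
            exact_mod_cast hnk
          have h2 := h.lintegral_one_add_cost_le hR
          have h3 := h.free_le
          have h4 := h.mass_ne_zero_le hθ.le
          have h5 : (2 : ℝ≥0∞) = ENNReal.ofReal 2 := by simp
          rw [h5]
          gcongr
      _ = ENNReal.ofReal (k * (k * (2 * (2 * θ * (θ * ((1 + θ) / 2) ^ (n - 2)))))) := by
          rw [← ENNReal.ofReal_pow (by positivity), ← ENNReal.ofReal_mul (by positivity),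
            ← ENNReal.ofReal_mul (by positivity), ← ENNReal.ofReal_mul (by positivity),
            ← ENNReal.ofReal_mul (by positivity), ← ENNReal.ofReal_mul (by positivity)]
      _ ≤ _ := by
          refine ENNReal.ofReal_le_ofReal ?_
          have h1 := hR.free_pow_le hn
          calc (k : ℝ) * (k * (2 * (2 * θ * (θ * ((1 + θ) / 2) ^ (n - 2)))))
              ≤ k * (k * (2 * (2 * θ * (θ * (6 * θ))))) := by gcongr
            _ = _ := by ring
  rw [hmain] at hlow hupp
  have hmain0 : 0 ≤ c * μ.real {1} ^ n + n * (j * μ.real {1} ^ (n - 1)) := by positivity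
  have hrest0 : 0 ≤ 24 * k ^ 2 * θ ^ 3 := by positivity
  have hupp' := hupp.trans (add_le_add le_rfl hrest)
  rw [← ENNReal.ofReal_add hmain0 hrest0] at hupp'
  have hfin : ∫⁻ x, G x ∂power n μ ≠ ∞ := ne_top_of_le_ne_top ENNReal.ofReal_ne_top hupp'
  refine ⟨(∫⁻ x, G x ∂power n μ).toReal, (ENNReal.ofReal_toReal hfin).symm, ENNReal.toReal_nonneg,
    (ENNReal.ofReal_le_iff_le_toReal hfin).1 hlow, ?_⟩
  exact ENNReal.toReal_le_of_le_ofReal (by positivity) hupp'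

section Values

variable {n : ℕ} {x : Fin n → ℝ} {i : Fin n} (hn : 2 ≤ n)
include hn

lemma prod_of_others_one (h : ∀ j ≠ i, x j = 1) :
    ∏ j, x j = x i ∧ ∏ j, (1 - x j) = 0 := by
  have : Nontrivial (Fin n) := Fin.nontrivial_iff_two_le.2 hn
  obtain ⟨j, hj⟩ := exists_ne i
  refine ⟨Finset.prod_eq_single i (fun j _ hj => h j hj) (by simp), ?_⟩
  exact Finset.prod_eq_zero (Finset.mem_univ j) (by rw [h j hj, sub_self])

lemma prod_of_others_zero (h : ∀ j ≠ i, x j = 0) :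
    ∏ j, x j = 0 ∧ ∏ j, (1 - x j) = 1 - x i := by
  have : Nontrivial (Fin n) := Fin.nontrivial_iff_two_le.2 hn
  obtain ⟨j, hj⟩ := exists_ne i
  refine ⟨Finset.prod_eq_zero (Finset.mem_univ j) (h j hj), ?_⟩
  exact Finset.prod_eq_single i (fun j _ hj => by rw [h j hj, sub_zero]) (by simp)

end Values

section Bounds

variable {n : ℕ} {x : Fin n → ℝ}

lemma agree_le_max (hn : 2 ≤ n) (hx : ∀ i, x i ∈ Icc (0 : ℝ) 1) (i : Fin n) :
    agree x ≤ max (x i) (1 - x i) := by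
  have : Nontrivial (Fin n) := Fin.nontrivial_iff_two_le.2 hn
  obtain ⟨j, hj⟩ := exists_ne i
  have h1 : ∏ j, x j = x i * ∏ j ∈ Finset.univ.erase i, x j :=
    (Finset.mul_prod_erase _ _ (Finset.mem_univ i)).symm
  have h2 : ∏ j, (1 - x j) = (1 - x i) * ∏ j ∈ Finset.univ.erase i, (1 - x j) :=
    (Finset.mul_prod_erase _ (fun j => 1 - x j) (Finset.mem_univ i)).symm
  have h3 := prod_mem_Icc (s := Finset.univ.erase i) hx
  have h4 := prod_mem_Icc (s := Finset.univ.erase i) (reflect_mem hx)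
  have hj' := Finset.mem_erase.2 ⟨hj, Finset.mem_univ j⟩
  have h7 := prod_le_of_mem hx hj'
  have h8 := prod_le_of_mem (reflect_mem hx) hj'
  have h9 := le_max_left (x i) (1 - x i)
  have h10 := le_max_right (x i) (1 - x i)
  have h5 := (hx i).1
  unfold agree
  rw [h1, h2]
  generalize ∏ j ∈ Finset.univ.erase i, x j = P at *
  generalize ∏ j ∈ Finset.univ.erase i, (1 - x j) = Q at *
  generalize max (x i) (1 - x i) = M at *
  have h11 : x i * P ≤ M * P := mul_le_mul_of_nonneg_right h9 h3.1
  have h12 : (1 - x i) * Q ≤ M * Q := mul_le_mul_of_nonneg_right h10 h4.1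
  have h13 : M * (P + Q) ≤ M * 1 := mul_le_mul_of_nonneg_left (by linarith) (h5.trans h9)
  linarith

lemma neg_log_one_sub_agree_le (hn : 2 ≤ n) (hx : ∀ i, x i ∈ Icc (0 : ℝ) 1) {i : Fin n}
    (hi : x i ∈ Ioo (0 : ℝ) 1) :
    -Real.log (1 - agree x) ≤ Real.log 2 + |Real.log ((1 - x i) / x i)| := by
  have h1 := agree_le_max hn hx i
  have h2 := hi.1
  have h3 := hi.2
  rcases le_total (x i) (1 - x i) with h | h
  · rw [max_eq_right h] at h1
    have := Real.log_le_log h2 (show x i ≤ 1 - agree x by linarith)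
    linarith [neg_log_le hi]
  · rw [max_eq_left h] at h1
    have := Real.log_le_log (show 0 < 1 - x i by linarith) (show 1 - x i ≤ 1 - agree x by linarith)
    linarith [neg_log_one_sub_le hi]

end Bounds

variable (hR : Regime k N θ) (h : Good k θ μ) (hl : 0 ≤ lam) (hl1 : lam ≤ 1)

lemma setLIntegral_free_eq (hR : Regime k N θ) (h : Good k θ μ) {g : ℝ → ℝ≥0∞}
    (hg : ∀ t ∈ Ioo (0 : ℝ) 1, g t ≤ 1 + cost t) :
    ∃ j : ℝ, 0 ≤ j ∧ j ≤ 2 * θ ∧ ∫⁻ t in Ioo 0 1, g t ∂μ = ENNReal.ofReal j := by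
  have h1 := (setLIntegral_mono' measurableSet_Ioo hg).trans (h.lintegral_one_add_cost_le hR)
  exact ⟨_, ENNReal.toReal_nonneg, ENNReal.toReal_le_of_le_ofReal (by linarith [hR.theta_pos]) h1,
    (ENNReal.ofReal_toReal (ne_top_of_le_ne_top ENNReal.ofReal_ne_top h1)).symm⟩

include hR h hl in
/-- The probabilities that a clause forces its variable, respectively is violated. -/
lemma Good.expansion_mass :
    ∃ J τ σ : ℝ, 0 ≤ J ∧ J ≤ 2 * θ ∧
      allWeight lam (clauseRaw (k - 1) lam μ) = ENNReal.ofReal (1 - τ) ∧ 0 ≤ τ ∧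
      tiltedMass (power k μ) lam (fun x => 1 - agree x) = ENNReal.ofReal (1 - σ) ∧ 0 ≤ σ ∧
      1 * μ.real {1} ^ (k - 1) + (k - 1 : ℕ) * (J * μ.real {1} ^ (k - 1 - 1)) ≤ τ ∧
      τ ≤ 1 * μ.real {1} ^ (k - 1) + (k - 1 : ℕ) * (J * μ.real {1} ^ (k - 1 - 1)) + 24 * k ^ 2 * θ ^ 3 ∧
      2 * μ.real {1} ^ k + k * (2 * J * μ.real {1} ^ (k - 1)) ≤ σ ∧
      σ ≤ 2 * μ.real {1} ^ k + k * (2 * J * μ.real {1} ^ (k - 1)) + 24 * k ^ 2 * θ ^ 3 := by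
  have hk := hR.large
  have := h.prob
  have hn : 2 ≤ k - 1 := by omega
  have mg : Measurable fun t : ℝ => 1 - weight lam (1 - t) := by fun_prop
  have mg' : Measurable fun t : ℝ => 1 - weight lam t := by fun_prop
  obtain ⟨J, hJ0, hJ1, hJ⟩ := setLIntegral_free_eq hR h (g := fun t => 1 - weight lam (1 - t))
    fun t _ => tsub_le_self.trans le_self_add
  have hJ' : ∫⁻ t in Ioo 0 1, (1 - weight lam t) ∂μ = ENNReal.ofReal J := by
    rw [← hJ, ← h.balanced.setLIntegral_reflect mg]
    simp
  have hsub {n : ℕ} {F : (Fin n → ℝ) → ℝ} (hF : Measurable F)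
      (hF0 : ∀ x, (∀ i, x i ∈ Icc (0 : ℝ) 1) → F x ∈ Icc (0 : ℝ) 1) {I : ℝ} (hI0 : 0 ≤ I)
      (hI : ∫⁻ x, (1 - weight lam (F x)) ∂power n μ = ENNReal.ofReal I) :
      ∫⁻ x, weight lam (F x) ∂power n μ = ENNReal.ofReal (1 - I) := by
    have h1 : ∫⁻ x, (1 - weight lam (F x)) ∂power n μ + ∫⁻ x, weight lam (F x) ∂power n μ = 1 := by
      rw [← lintegral_add_left (by fun_prop)]
      calc _ = ∫⁻ _, 1 ∂power n μ := by
            refine lintegral_congr_ae ?_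
            filter_upwards [h.balanced.ae_power] with x hx
            exact tsub_add_cancel_of_le (weight_le_one hl (hF0 x hx).1 (hF0 x hx).2)
        _ = 1 := by simp
    rw [hI] at h1
    rw [ENNReal.ofReal_sub _ hI0, ENNReal.ofReal_one, ← h1,
      ENNReal.add_sub_cancel_left ENNReal.ofReal_ne_top]
  obtain ⟨τ, hτ, hτ0, hτ1, hτ2⟩ := h.expansion hR (n := k - 1) le_rfl (Nat.sub_le k 1)
    (G := fun x => 1 - weight lam (1 - ∏ i, x i)) (g1 := fun t => 1 - weight lam (1 - t))
    (g0 := fun _ => 0)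
    (by
      rintro x ⟨i, hi⟩ -
      simp [Finset.prod_eq_zero (Finset.mem_univ i) hi, weight_one])
    (fun i x _ hx => by rw [(prod_of_others_one hn hx).1])
    (fun i x _ hx => by rw [(prod_of_others_zero hn hx).1, sub_zero, weight_one, tsub_self])
    mg measurable_const (fun x _ i _ => tsub_le_self.trans le_self_add) (c := 1)
    (by
      have h1 : k - 1 ≠ 0 := by omega
      simp [zero_pow h1, weight_zero, weight_one])
    zero_le_one (j := J) (by simpa using hJ) hJ0
  obtain ⟨σ, hσ, hσ0, hσ1, hσ2⟩ := h.expansion hR (n := k) (Nat.sub_le k 1) le_rfl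
    (G := fun x => 1 - weight lam (1 - agree x)) (g1 := fun t => 1 - weight lam (1 - t))
    (g0 := fun t => 1 - weight lam t)
    (by
      intro x h0 h1
      simp [agree_eq_zero h0 h1, weight_one])
    (fun i x _ hx => by
      obtain ⟨h1, h2⟩ := prod_of_others_one (by omega : 2 ≤ k) hx
      rw [agree, h1, h2, add_zero])
    (fun i x _ hx => by
      obtain ⟨h1, h2⟩ := prod_of_others_zero (by omega : 2 ≤ k) hx
      rw [agree, h1, h2, zero_add, sub_sub_cancel])
    mg mg' (fun x _ i _ => tsub_le_self.trans le_self_add) (c := 2)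
    (by
      have h1 : k ≠ 0 := by omega
      simp [zero_pow h1, agree, weight_zero, one_add_one_eq_two])
    zero_le_two (j := 2 * J) (by rw [hJ, hJ', ← ENNReal.ofReal_add hJ0 hJ0, two_mul]) (by positivity)
  refine ⟨J, τ, σ, hJ0, hJ1, ?_, hτ0, ?_, hσ0, hτ1, hτ2, hσ1, hσ2⟩
  · rw [allWeight_clauseRaw (by omega) h.balanced]
    exact hsub (by fun_prop) (fun x hx => by
      have := prod_mem_Icc (s := Finset.univ) hx
      exact ⟨by linarith [this.2], by linarith [this.1]⟩) hτ0 hτ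
  · exact hsub (F := fun x : Fin k → ℝ => 1 - agree x) (measurable_const.sub measurable_agree) (fun x hx =>
      ⟨by linarith [agree_le_one (by omega) hx], by linarith [agree_nonneg hx]⟩) hσ0 hσ

/-- The positive part of the log-likelihood ratio of a message. -/
noncomputable def logRatio (t : ℝ) : ℝ≥0∞ := ENNReal.ofReal (Real.log ((1 - t) / t))

lemma measurable_logRatio : Measurable logRatio := by
  unfold logRatio
  fun_prop

lemma logRatio_zero : logRatio 0 = 0 := by simp [logRatio]

lemma logRatio_one : logRatio 1 = 0 := by simp [logRatio]

include hR h hl in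
/-- The entropic counterpart of `Good.expansion_mass`. -/
lemma Good.expansion_entropy :
    ∃ J κ Λ : ℝ, 0 ≤ J ∧ J ≤ 2 * θ ∧ 0 ≤ κ ∧ 0 ≤ Λ ∧
      ∫⁻ t, weight lam t * logRatio t ∂clauseRaw (k - 1) lam μ = ENNReal.ofReal κ ∧
      ∫⁻ x, weight lam (1 - agree x) * ENNReal.ofReal (-Real.log (1 - agree x)) ∂power k μ
        = ENNReal.ofReal Λ ∧
      (k - 1 : ℕ) * (J * μ.real {1} ^ (k - 1 - 1)) ≤ κ ∧
      κ ≤ (k - 1 : ℕ) * (J * μ.real {1} ^ (k - 1 - 1)) + 24 * k ^ 2 * θ ^ 3 ∧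
      k * (2 * J * μ.real {1} ^ (k - 1)) ≤ Λ ∧
      Λ ≤ k * (2 * J * μ.real {1} ^ (k - 1)) + 24 * k ^ 2 * θ ^ 3 := by
  have hk := hR.large
  have := h.prob
  have hn : 2 ≤ k - 1 := by omega
  have mg : Measurable fun t : ℝ => weight lam (1 - t) * ENNReal.ofReal (-Real.log (1 - t)) := by fun_prop
  have mg' : Measurable fun t : ℝ => weight lam t * ENNReal.ofReal (-Real.log t) := by fun_prop
  obtain ⟨J, hJ0, hJ1, hJ⟩ := setLIntegral_free_eq hR h
    (g := fun t => weight lam (1 - t) * ENNReal.ofReal (-Real.log (1 - t))) fun t ht => by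
      have h1 : weight lam (1 - t) ≤ 1 :=
        weight_le_one hl (by linarith [ht.2]) (by linarith [ht.1])
      refine (mul_le_of_le_one_left bot_le h1).trans ?_
      exact (ENNReal.ofReal_le_ofReal (neg_log_one_sub_le ht)).trans ofReal_log_two_add_le
  have hJ' : ∫⁻ t in Ioo 0 1, weight lam t * ENNReal.ofReal (-Real.log t) ∂μ = ENNReal.ofReal J := by
    rw [← hJ, ← h.balanced.setLIntegral_reflect mg]
    simp
  have hle (t : ℝ) (ht : t ∈ Ioo (0 : ℝ) 1) {w : ℝ} (hw : w ∈ Icc (0 : ℝ) 1) {a : ℝ}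
      (ha : a ≤ Real.log 2 + |Real.log ((1 - t) / t)|) :
      weight lam w * ENNReal.ofReal a ≤ 1 + cost t :=
    (mul_le_of_le_one_left bot_le (weight_le_one hl hw.1 hw.2)).trans
      ((ENNReal.ofReal_le_ofReal ha).trans ofReal_log_two_add_le)
  obtain ⟨κ, hκ, hκ0, hκ1, hκ2⟩ := h.expansion hR (n := k - 1) le_rfl (Nat.sub_le k 1)
    (G := fun x => weight lam (1 - ∏ i, x i) * logRatio (clauseOut x))
    (g1 := fun t => weight lam (1 - t) * ENNReal.ofReal (-Real.log (1 - t)))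
    (g0 := fun _ => 0)
    (by
      intro x h0 h1
      norm_num [clauseOut_mixed h0 h1, logRatio])
    (fun i x hi hx => by
      have hx' (j : Fin (k - 1)) : x j ∈ Icc (0 : ℝ) 1 := by
        by_cases hj : j = i
        · rw [hj]; exact Ioo_subset_Icc_self hi
        · simp [hx j hj]
      obtain ⟨h1, h2⟩ := prod_of_others_one hn hx
      rw [logRatio, clauseOut_ratio (by omega) hx', h1, h2, sub_zero, one_div, Real.log_inv])
    (fun i x hi hx => by
      have hx' (j : Fin (k - 1)) : x j ∈ Icc (0 : ℝ) 1 := by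
        by_cases hj : j = i
        · rw [hj]; exact Ioo_subset_Icc_self hi
        · simp [hx j hj]
      obtain ⟨h1, h2⟩ := prod_of_others_zero hn hx
      rw [logRatio, clauseOut_ratio (by omega) hx', h1, h2, sub_sub_cancel, sub_zero, div_one,
        ENNReal.ofReal_of_nonpos (Real.log_nonpos hi.1.le hi.2.le), mul_zero])
    mg measurable_const (fun x hx i hi => by
      have h3 := prod_mem_Icc (s := Finset.univ) hx
      have h4 := prod_mem_Icc (s := Finset.univ) (reflect_mem hx)
      obtain ⟨h5, h6, h7, h8⟩ := clause_log_bounds hx hi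
      refine hle (x i) hi ⟨h5.le, by linarith [h3.1]⟩ ?_
      rw [clauseOut_ratio (by omega) hx, Real.log_div h6.ne' h5.ne']
      have := Real.log_nonpos h6.le (by linarith [h4.1])
      linarith) (c := 0)
    (by
      have h1 : k - 1 ≠ 0 := by omega
      norm_num [zero_pow h1, clauseOut, agree, weight_zero, logRatio])
    le_rfl (j := J) (by simpa using hJ) hJ0
  obtain ⟨Λ, hΛ, hΛ0, hΛ1, hΛ2⟩ := h.expansion hR (n := k) (Nat.sub_le k 1) le_rfl
    (G := fun x => weight lam (1 - agree x) * ENNReal.ofReal (-Real.log (1 - agree x)))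
    (g1 := fun t => weight lam (1 - t) * ENNReal.ofReal (-Real.log (1 - t)))
    (g0 := fun t => weight lam t * ENNReal.ofReal (-Real.log t))
    (by
      intro x h0 h1
      simp [agree_eq_zero h0 h1])
    (fun i x _ hx => by
      obtain ⟨h1, h2⟩ := prod_of_others_one (by omega : 2 ≤ k) hx
      rw [agree, h1, h2, add_zero])
    (fun i x _ hx => by
      obtain ⟨h1, h2⟩ := prod_of_others_zero (by omega : 2 ≤ k) hx
      rw [agree, h1, h2, zero_add, sub_sub_cancel])
    mg mg' (fun x hx i hi => hle (x i) hi
      ⟨by linarith [agree_le_one (by omega) hx], by linarith [agree_nonneg hx]⟩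
      (neg_log_one_sub_agree_le (by omega) hx hi)) (c := 0)
    (by
      have h1 : k ≠ 0 := by omega
      simp [zero_pow h1, agree])
    le_rfl (j := 2 * J) (by rw [hJ, hJ', ← ENNReal.ofReal_add hJ0 hJ0, two_mul]) (by positivity)
  rw [zero_mul, zero_add] at hκ1 hκ2 hΛ1 hΛ2
  exact ⟨J, κ, Λ, hJ0, hJ1, hκ0, hΛ0, by
    rw [lintegral_clauseRaw_weight (by omega) h.balanced measurable_logRatio, hκ], hΛ, hκ1, hκ2, hΛ1, hΛ2⟩

end Apply

attribute [fun_prop] measurable_agree measurable_clauseOut measurable_varOut measurable_logRatio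
  measurable_cost

section Edge

variable {n : ℕ} {lam : ℝ} {μ : Measure ℝ}

@[fun_prop]
lemma measurable_edgeAgree : Measurable edgeAgree := by
  unfold edgeAgree
  fun_prop

lemma edgeAgree_mem {p : ℝ × ℝ} (h1 : p.1 ∈ Icc (0 : ℝ) 1) (h2 : p.2 ∈ Icc (0 : ℝ) 1) :
    edgeAgree p ∈ Icc (0 : ℝ) 1 := by
  obtain ⟨h1, h1'⟩ := h1
  obtain ⟨h2, h2'⟩ := h2
  constructor <;> unfold edgeAgree <;> nlinarith [mul_nonneg h1 h2]

lemma agree_cons (a : ℝ) (x : Fin n → ℝ) :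
    agree (Fin.cons a x : Fin (n + 1) → ℝ) = a * ∏ i, x i + (1 - a) * ∏ i, (1 - x i) := by
  simp [agree, Fin.prod_univ_succ]

lemma agree_mul_edgeAgree {a : ℝ} {x : Fin n → ℝ} (hn : 0 < n) (hx : ∀ i, x i ∈ Icc (0 : ℝ) 1) :
    (2 - agree x) * edgeAgree (a, clauseOut x) = 1 - agree (Fin.cons a x : Fin (n + 1) → ℝ) := by
  rw [agree_cons, edgeAgree]
  have h1 := clauseOut_mul hn hx
  have h2 := clauseOut_mul' hn hx
  linear_combination a * h1 + (1 - a) * h2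

lemma agree_mul_varOut {a : ℝ} {y : Fin n → ℝ} (hy : ∀ i, y i ∈ Icc (0 : ℝ) 1) :
    agree y * edgeAgree (varOut y, a) = agree (Fin.cons a y : Fin (n + 1) → ℝ) := by
  have h1 := (prod_mem_Icc (s := Finset.univ) hy).1
  have h2 := (prod_mem_Icc (s := Finset.univ) (reflect_mem hy)).1
  rw [agree_cons, edgeAgree]
  by_cases h : agree y = 0
  · rw [h, zero_mul]
    unfold agree at h
    rw [show ∏ i, y i = 0 by linarith, show ∏ i, (1 - y i) = 0 by linarith]
    simp
  · have h3 : agree y * varOut y = ∏ i, y i := mul_div_cancel₀ _ h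
    have h4 : agree y = ∏ i, y i + ∏ i, (1 - y i) := rfl
    linear_combination (2 * a - 1) * h3 + (1 - a) * h4

variable [IsProbabilityMeasure μ]

/-- Joining a fresh variable to the message of a clause reconstitutes the clause. -/
lemma lintegral_edge (hn : 0 < n) (hμ : Balanced μ) (hl : 0 ≤ lam) (hl1 : lam ≤ 1)
    {Φ : ℝ × ℝ → ℝ≥0∞} (hΦ : Measurable Φ) :
    ∫⁻ p, weight lam (edgeAgree p) * Φ p ∂μ.prod (clauseRaw n lam μ)
      = ∫⁻ x, weight lam (1 - agree x) * Φ (x 0, clauseOut (Fin.tail x)) ∂power (n + 1) μ := by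
  have := isFiniteMeasure_clauseRaw hn hμ hl hl1
  have ht : Measurable fun x : Fin (n + 1) → ℝ => clauseOut (Fin.tail x) :=
    measurable_clauseOut.comp (measurable_pi_lambda _ fun i => measurable_pi_apply i.succ)
  rw [lintegral_prod _ (by fun_prop), lintegral_power_succ (by fun_prop)]
  refine lintegral_congr_ae ?_
  filter_upwards [hμ.supp] with a ha
  rw [lintegral_clauseRaw (by fun_prop)]
  refine lintegral_congr_ae ?_
  filter_upwards [hμ.ae_power (n := n)] with x hx
  rw [← mul_assoc, ← weight_mul (by linarith [agree_le_one hn hx])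
    (edgeAgree_mem ha (clauseOut_mem hn hx)).1, agree_mul_edgeAgree hn hx]
  simp

/-- Removing one message at a variable. -/
lemma lintegral_var_edge {m : Measure ℝ} [IsFiniteMeasure m] (hm : Balanced m)
    (h0 : tiltedMass (power n m) lam agree ≠ 0) (h1 : tiltedMass (power n m) lam agree ≠ ∞)
    {φ : ℝ → ℝ≥0∞} (hφ : Measurable φ) :
    ∫⁻ y, weight lam (agree y) * φ (y 0) ∂power (n + 1) m
      = tiltedMass (power n m) lam agree
        * ∫⁻ p, weight lam (edgeAgree p) * φ p.2 ∂(tiltedLaw (power n m) lam agree varOut).prod m := by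
  have := isProbabilityMeasure_tiltedLaw (ν := power n m) (lam := lam) measurable_varOut h0 h1
  rw [lintegral_power_succ (by fun_prop), lintegral_prod_symm _ (by fun_prop),
    ← lintegral_const_mul _ (by fun_prop)]
  refine lintegral_congr_ae ?_
  filter_upwards [hm.supp] with a ha
  rw [lintegral_tiltedLaw measurable_agree measurable_varOut (by fun_prop), ← mul_assoc,
    ENNReal.mul_inv_cancel h0 h1, one_mul]
  refine lintegral_congr_ae ?_
  filter_upwards [hm.ae_power (n := n)] with y hy
  rw [← mul_assoc, ← weight_mul (agree_nonneg hy) (edgeAgree_mem (varOut_mem hy) ha).1,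
    agree_mul_varOut hy]
  simp

lemma agree_comp_perm (σ : Equiv.Perm (Fin n)) (x : Fin n → ℝ) : agree (fun i => x (σ i)) = agree x := by
  unfold agree
  rw [Equiv.prod_comp σ x, Equiv.prod_comp σ fun i => 1 - x i]

/-- Exchangeability of the messages at a variable. -/
lemma lintegral_agree_sum {m : Measure ℝ} [IsFiniteMeasure m] {φ : ℝ → ℝ≥0∞} (hφ : Measurable φ) :
    ∫⁻ y, weight lam (agree y) * ∑ i, φ (y i) ∂power (n + 1) m
      = (n + 1 : ℕ) * ∫⁻ y, weight lam (agree y) * φ (y 0) ∂power (n + 1) m := by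
  have key (i : Fin (n + 1)) : ∫⁻ y, weight lam (agree y) * φ (y i) ∂power (n + 1) m
      = ∫⁻ y, weight lam (agree y) * φ (y 0) ∂power (n + 1) m := by
    rw [← lintegral_power_comp_perm (Equiv.swap 0 i) (by fun_prop)]
    simp only [agree_comp_perm, Equiv.swap_apply_right]
  simp only [Finset.mul_sum]
  rw [lintegral_finsetSum _ fun i _ => by fun_prop]
  simp [key]

end Edge

section Peak

variable {n : ℕ} {lam : ℝ}

/-- Minus the logarithm of the larger of the two probabilities of a message. -/
noncomputable def peak (t : ℝ) : ℝ≥0∞ := ENNReal.ofReal (-Real.log (max t (1 - t)))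

@[fun_prop]
lemma measurable_peak : Measurable peak := by
  unfold peak
  fun_prop

lemma peak_reflect (t : ℝ) : peak (1 - t) = peak t := by
  unfold peak
  rw [sub_sub_cancel, max_comm]

lemma half_le_max (t : ℝ) : 1 / 2 ≤ max t (1 - t) := by
  rcases le_total t (1 - t) with h | h
  · rw [max_eq_right h]; linarith
  · rw [max_eq_left h]; linarith

lemma neg_log_max_nonneg {t : ℝ} (ht : t ∈ Icc (0 : ℝ) 1) : 0 ≤ -Real.log (max t (1 - t)) :=
  neg_nonneg.2 (Real.log_nonpos (by linarith [half_le_max t]) (max_le ht.2 (by linarith [ht.1])))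

lemma peak_add_logRatio {t : ℝ} (h0 : 0 < t) (h1 : t ≤ 1) :
    ENNReal.ofReal (-Real.log t) = peak t + logRatio t := by
  unfold peak logRatio
  rcases eq_or_lt_of_le h1 with rfl | h1
  · simp
  rcases le_total t (1 - t) with h | h
  · rw [max_eq_right h, ← ENNReal.ofReal_add]
    · rw [Real.log_div (by linarith) h0.ne']
      congr 1
      ring
    · exact neg_nonneg.2 (Real.log_nonpos (by linarith) (by linarith))
    · exact Real.log_nonneg ((one_le_div h0).2 h)
  · rw [max_eq_left h, ENNReal.ofReal_of_nonpos (p := Real.log ((1 - t) / t)), add_zero]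
    exact Real.log_nonpos (div_nonneg (by linarith) h0.le) ((div_le_one h0).2 h)

lemma log_two_sub_agree_le (hn : 0 < n) {x : Fin n → ℝ} (hx : ∀ i, x i ∈ Icc (0 : ℝ) 1) :
    ENNReal.ofReal (Real.log (2 - agree x)) ≤ peak (clauseOut x) ∧
    peak (clauseOut x) ≤ ENNReal.ofReal (Real.log (2 - agree x))
      + (freeBox n).indicator (fun _ => ENNReal.ofReal (Real.log 2)) x := by
  have h1 := prod_mem_Icc (s := Finset.univ) hx
  have h2 := prod_mem_Icc (s := Finset.univ) (reflect_mem hx)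
  have h3 := agree_le_one hn hx
  have h4 : agree x = ∏ i, x i + ∏ i, (1 - x i) := rfl
  have h5 : max (clauseOut x) (1 - clauseOut x) = max (1 - ∏ i, x i) (1 - ∏ i, (1 - x i)) / (2 - agree x) := by
    rw [eq_div_iff (by linarith), max_mul_of_nonneg _ _ (by linarith), mul_comm, clauseOut_mul hn hx,
      mul_comm (1 - clauseOut x), clauseOut_mul' hn hx]
  have h6 : 1 / 2 ≤ max (1 - ∏ i, x i) (1 - ∏ i, (1 - x i)) := by
    rcases le_total (∏ i, x i) (1 / 2) with h | h
    · exact le_max_of_le_left (by linarith)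
    · exact le_max_of_le_right (by linarith)
  have h7 : max (1 - ∏ i, x i) (1 - ∏ i, (1 - x i)) ≤ 1 := max_le (by linarith [h1.1]) (by linarith [h2.1])
  have h8 : 0 ≤ Real.log (2 - agree x) := Real.log_nonneg (by linarith)
  unfold peak
  rw [h5, Real.log_div (by linarith) (by linarith)]
  have h9 := Real.log_nonpos (by linarith) h7
  refine ⟨ENNReal.ofReal_le_ofReal (by linarith), ?_⟩
  by_cases hb : x ∈ freeBox n
  · rw [indicator_of_mem hb, ← ENNReal.ofReal_add h8 (Real.log_nonneg one_le_two)]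
    refine ENNReal.ofReal_le_ofReal ?_
    have h10 := Real.log_le_log (by norm_num) h6
    rw [one_div, Real.log_inv] at h10
    linarith
  · rw [indicator_of_notMem hb, add_zero]
    refine ENNReal.ofReal_le_ofReal ?_
    have h10 : max (1 - ∏ i, x i) (1 - ∏ i, (1 - x i)) = 1 := by
      rw [mem_freeBox] at hb
      push Not at hb
      obtain ⟨i, hi⟩ := hb
      refine le_antisymm h7 ?_
      by_cases h0 : x i = 0
      · refine le_max_of_le_left ?_
        rw [Finset.prod_eq_zero (Finset.mem_univ i) h0, sub_zero]
      · have : x i = 1 := by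
          by_contra h1
          exact hi ⟨lt_of_le_of_ne (hx i).1 (Ne.symm h0), lt_of_le_of_ne (hx i).2 h1⟩
        refine le_max_of_le_right ?_
        rw [Finset.prod_eq_zero (Finset.mem_univ i) (by rw [this, sub_self]), sub_zero]
    rw [h10, Real.log_one]
    linarith

variable {μ : Measure ℝ} [IsProbabilityMeasure μ]

/-- The mean of `log (2 - agree)` for a clause without one of its variables. -/
noncomputable def cavityLog (n : ℕ) (lam : ℝ) (μ : Measure ℝ) : ℝ≥0∞ :=
  ∫⁻ x, weight lam (1 - agree x) * ENNReal.ofReal (Real.log (2 - agree (Fin.tail x : Fin n → ℝ)))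
    ∂power (n + 1) μ

lemma measurable_tail : Measurable (Fin.tail : (Fin (n + 1) → ℝ) → Fin n → ℝ) :=
  measurable_pi_lambda _ fun i => measurable_pi_apply i.succ

lemma lintegral_edge_peak (hn : 0 < n) (hμ : Balanced μ) (hl : 0 ≤ lam) (hl1 : lam ≤ 1) :
    cavityLog n lam μ ≤ ∫⁻ p, weight lam (edgeAgree p) * peak p.2 ∂μ.prod (clauseRaw n lam μ) ∧
    ∫⁻ p, weight lam (edgeAgree p) * peak p.2 ∂μ.prod (clauseRaw n lam μ)
      ≤ cavityLog n lam μ + ENNReal.ofReal (Real.log 2) * μ (Ioo 0 1) ^ n := by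
  have ht := measurable_tail (n := n)
  have htl (x : Fin (n + 1) → ℝ) (hx : ∀ i, x i ∈ Icc (0 : ℝ) 1) (i : Fin n) :
      (Fin.tail x : Fin n → ℝ) i ∈ Icc (0 : ℝ) 1 := hx i.succ
  have hind : Measurable ((freeBox n).indicator fun _ => ENNReal.ofReal (Real.log 2)) :=
    measurable_const.indicator measurableSet_freeBox
  rw [lintegral_edge (Φ := fun p => peak p.2) hn hμ hl hl1 (by fun_prop)]
  constructor
  · refine lintegral_mono_ae ?_
    filter_upwards [hμ.ae_power (n := n + 1)] with x hx
    gcongr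
    exact (log_two_sub_agree_le hn (htl x hx)).1
  · calc _ ≤ ∫⁻ x, (weight lam (1 - agree x)
          * ENNReal.ofReal (Real.log (2 - agree (Fin.tail x : Fin n → ℝ)))
          + (freeBox n).indicator (fun _ => ENNReal.ofReal (Real.log 2)) (Fin.tail x)) ∂power (n + 1) μ := by
          refine lintegral_mono_ae ?_
          filter_upwards [hμ.ae_power (n := n + 1)] with x hx
          have h1 : weight lam (1 - agree x) ≤ 1 := weight_le_one hl
            (by linarith [agree_le_one n.succ_pos hx]) (by linarith [agree_nonneg hx])
          calc _ ≤ weight lam (1 - agree x) * (ENNReal.ofReal (Real.log (2 - agree (Fin.tail x : Fin n → ℝ)))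
                + (freeBox n).indicator (fun _ => ENNReal.ofReal (Real.log 2)) (Fin.tail x)) := by
                gcongr
                exact (log_two_sub_agree_le hn (htl x hx)).2
            _ ≤ _ := by
                rw [mul_add]
                gcongr
                exact mul_le_of_le_one_left bot_le h1
      _ = cavityLog n lam μ + ∫⁻ x : Fin (n + 1) → ℝ,
          (freeBox n).indicator (fun _ => ENNReal.ofReal (Real.log 2)) (Fin.tail x) ∂power (n + 1) μ := by
          exact lintegral_add_right _ (hind.comp ht)
      _ = _ := by
          have h2 : Measurable fun x : Fin (n + 1) → ℝ =>
            (freeBox n).indicator (fun _ => ENNReal.ofReal (Real.log 2)) (Fin.tail x) := hind.comp ht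
          rw [lintegral_power_succ h2]
          simp only [Fin.tail_cons, lintegral_indicator measurableSet_freeBox, lintegral_const,
            measure_univ, mul_one, Measure.restrict_apply MeasurableSet.univ, univ_inter]
          congr 2
          have := lintegral_freeBox_prod (m := μ) (n := n) (f := fun _ => 1) measurable_const
          simpa using this

lemma lintegral_edge_log (hn : 0 < n) (hμ : Balanced μ) (hl : 0 ≤ lam) (hl1 : lam ≤ 1) :
    ∫⁻ p, weight lam (edgeAgree p) * ENNReal.ofReal (-Real.log (edgeAgree p)) ∂μ.prod (clauseRaw n lam μ)
      = ∫⁻ x, weight lam (1 - agree x) * ENNReal.ofReal (-Real.log (1 - agree x)) ∂power (n + 1) μ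
        + cavityLog n lam μ := by
  have ht := measurable_tail (n := n)
  rw [lintegral_edge (Φ := fun p => ENNReal.ofReal (-Real.log (edgeAgree p))) hn hμ hl hl1 (by fun_prop),
    cavityLog, ← lintegral_add_left (by fun_prop)]
  refine lintegral_congr_ae ?_
  filter_upwards [hμ.ae_power (n := n + 1)] with x hx
  by_cases h0 : 1 - agree x = 0
  · simp [h0, weight_zero]
  have htl (i : Fin n) : (Fin.tail x : Fin n → ℝ) i ∈ Icc (0 : ℝ) 1 := hx i.succ
  have h1 := agree_le_one n.succ_pos hx
  have h2 := agree_nonneg hx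
  have h3 := agree_le_one hn htl
  have h4 := agree_mul_edgeAgree (a := x 0) hn htl
  rw [Fin.cons_self_tail] at h4
  have h5 : edgeAgree (x 0, clauseOut (Fin.tail x)) = (1 - agree x) / (2 - agree (Fin.tail x : Fin n → ℝ)) := by
    rw [eq_div_iff (by linarith), mul_comm, h4]
  rw [← mul_add, h5, Real.log_div h0 (by linarith), show ∀ a b : ℝ, -(a - b) = -a + b by intros; ring,
    ENNReal.ofReal_add]
  · exact neg_nonneg.2 (Real.log_nonpos (by linarith) (by linarith))
  · exact Real.log_nonneg (by linarith)

lemma cavityLog_le (hn : 0 < n) (hμ : Balanced μ) (hl : 0 ≤ lam) : cavityLog n lam μ ≤ 1 := by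
  have h1 : cavityLog n lam μ ≤ ∫⁻ _, 1 ∂power (n + 1) μ := by
    refine lintegral_mono_ae ?_
    filter_upwards [hμ.ae_power (n := n + 1)] with x hx
    refine mul_le_one' (weight_le_one hl (by linarith [agree_le_one n.succ_pos hx])
      (by linarith [agree_nonneg hx])) ?_
    have htl (i : Fin n) : (Fin.tail x : Fin n → ℝ) i ∈ Icc (0 : ℝ) 1 := hx i.succ
    rw [← ENNReal.ofReal_one]
    refine ENNReal.ofReal_le_ofReal ?_
    have h3 := agree_le_one hn htl
    have := Real.log_le_sub_one_of_pos (show 0 < 2 - agree (Fin.tail x : Fin n → ℝ) by linarith)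
    linarith [agree_nonneg htl]
  simpa using h1

end Peak

section Var

variable {n : ℕ} {lam : ℝ} {m : Measure ℝ} [IsFiniteMeasure m]

lemma neg_log_agree_bounds {y : Fin n → ℝ} (hy : y ∈ freeBox n) :
    ∑ i, -Real.log (max (y i) (1 - y i)) ≤ -Real.log (agree y) + Real.log 2 ∧
    -Real.log (agree y) + Real.log 2 ≤ ∑ i, -Real.log (max (y i) (1 - y i))
      + ∑ i, |Real.log ((1 - y i) / y i)| := by
  have hpos (i : Fin n) : 0 < max (y i) (1 - y i) := by linarith [half_le_max (y i)]
  have hM : 0 < ∏ i, max (y i) (1 - y i) := Finset.prod_pos fun i _ => hpos i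
  have hlogM : ∑ i, -Real.log (max (y i) (1 - y i)) = -Real.log (∏ i, max (y i) (1 - y i)) := by
    rw [Real.log_prod fun i _ => (hpos i).ne', Finset.sum_neg_distrib]
  have ha := agree_pos_of_freeBox hy
  rw [mem_freeBox] at hy
  have hP : ∏ i, y i ≤ ∏ i, max (y i) (1 - y i) :=
    Finset.prod_le_prod (fun i _ => (hy i).1.le) fun i _ => le_max_left _ _
  have hQ : ∏ i, (1 - y i) ≤ ∏ i, max (y i) (1 - y i) :=
    Finset.prod_le_prod (fun i _ => by linarith [(hy i).2]) fun i _ => le_max_right _ _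
  set S := ∑ i, |Real.log ((1 - y i) / y i)| with hS
  have hone {a b : ℝ} (ha : 0 < a) (hb : 0 < b) :
      max a b * Real.exp (-|Real.log (b / a)|) ≤ a := by
    rcases le_total a b with h | h
    · rw [max_eq_right h, abs_of_nonneg (Real.log_nonneg ((one_le_div ha).2 h)), Real.exp_neg,
        Real.exp_log (by positivity)]
      field_simp
      exact le_rfl
    · rw [max_eq_left h]
      exact mul_le_of_le_one_right ha.le (Real.exp_le_one_iff.2 (neg_nonpos.2 (abs_nonneg _)))
  have hexp : Real.exp (-S) = ∏ i, Real.exp (-|Real.log ((1 - y i) / y i)|) := by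
    rw [← Real.exp_sum, hS, Finset.sum_neg_distrib]
  have hP' : (∏ i, max (y i) (1 - y i)) * Real.exp (-S) ≤ ∏ i, y i := by
    rw [hexp, ← Finset.prod_mul_distrib]
    refine Finset.prod_le_prod (fun i _ => by have := hpos i; positivity) fun i _ => ?_
    exact hone (hy i).1 (by linarith [(hy i).2])
  have hQ' : (∏ i, max (y i) (1 - y i)) * Real.exp (-S) ≤ ∏ i, (1 - y i) := by
    rw [hexp, ← Finset.prod_mul_distrib]
    refine Finset.prod_le_prod (fun i _ => by have := hpos i; positivity) fun i _ => ?_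
    have h1 : 0 < 1 - y i := by linarith [(hy i).2]
    rw [max_comm, ← abs_log_reflect, sub_sub_cancel]
    exact hone h1 (hy i).1
  have hagree : agree y = ∏ i, y i + ∏ i, (1 - y i) := rfl
  rw [hlogM]
  constructor
  · have := Real.log_le_log ha (show agree y ≤ 2 * ∏ i, max (y i) (1 - y i) by linarith)
    rw [Real.log_mul two_ne_zero hM.ne'] at this
    linarith
  · have := Real.log_le_log (by positivity)
      (show 2 * ((∏ i, max (y i) (1 - y i)) * Real.exp (-S)) ≤ agree y by linarith)
    rw [Real.log_mul two_ne_zero (by positivity), Real.log_mul hM.ne' (Real.exp_pos _).ne',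
      Real.log_exp] at this
    linarith

/-- The part of the entropy of a variable due to the forcing clauses. -/
noncomputable def forcedLog (n : ℕ) (lam : ℝ) (m : Measure ℝ) : ℝ≥0∞ :=
  ∫⁻ y in forced n, (∏ i, weight lam (y i)) * ∑ i, logRatio (y i) ∂power n m

lemma forcedLog_add (hm : Balanced m) :
    forcedLog n lam m + n * ((∫⁻ t, weight lam t * logRatio t ∂m) * freeWeight lam m ^ (n - 1))
      = n * ((∫⁻ t, weight lam t * logRatio t ∂m) * allWeight lam m ^ (n - 1)) := by
  have hI : ∫⁻ t, weight lam t * logRatio t ∂m = ∫⁻ t in Ioo 0 1, weight lam t * logRatio t ∂m := by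
    rw [hm.lintegral_eq, logRatio_zero, logRatio_one]
    simp
  have hml : Measurable fun t => weight lam t * logRatio t := by fun_prop
  have h1 := setLIntegral_forced_add (m := m) (n := n)
    (P := fun y => (∏ i, weight lam (y i)) * ∑ i, logRatio (y i)) fun y ⟨i, hi⟩ => by
      rw [Finset.prod_eq_zero (Finset.mem_univ i) (by rw [hi, weight_zero]), zero_mul]
  rw [lintegral_freeBox_sum measurable_logRatio, ← hI] at h1
  rw [forcedLog, h1]
  simp only [Finset.mul_sum]
  rw [lintegral_finsetSum _ fun i _ => by fun_prop]
  have h2 (i : Fin n) : ∫⁻ y, (∏ j, weight lam (y j)) * logRatio (y i) ∂power n m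
      = (∫⁻ t, weight lam t * logRatio t ∂m) * allWeight lam m ^ (n - 1) := by
    rw [allWeight, ← lintegral_power_single (measurable_weight lam) hml i]
    refine lintegral_congr fun y => ?_
    rw [← Finset.mul_prod_erase _ _ (Finset.mem_univ i)]
    ring
  simp [h2]

/-- The entropy of a variable, decomposed. -/
lemma lintegral_agree_log (hn : 0 < n) (hm : Balanced m) (hl : 0 ≤ lam) (hl1 : lam ≤ 1) :
    ∫⁻ y, weight lam (agree y) * ∑ i, peak (y i) ∂power n m + 2 * forcedLog n lam m
      ≤ ∫⁻ y, weight lam (agree y) * ENNReal.ofReal (-Real.log (agree y)) ∂power n m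
        + ENNReal.ofReal (Real.log 2) * freeOut n lam m (fun _ => 1) ∧
    ∫⁻ y, weight lam (agree y) * ENNReal.ofReal (-Real.log (agree y)) ∂power n m
        + ENNReal.ofReal (Real.log 2) * freeOut n lam m (fun _ => 1)
      ≤ ∫⁻ y, weight lam (agree y) * ∑ i, peak (y i) ∂power n m + 2 * forcedLog n lam m
        + 2 * (n * ((∫⁻ t in Ioo 0 1, weight lam t * cost t ∂m) * freeWeight lam m ^ (n - 1))) := by
  have hG : Measurable fun y : Fin n → ℝ => weight lam (agree y) * ENNReal.ofReal (-Real.log (agree y)) := by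
    fun_prop
  have hH : Measurable fun y : Fin n → ℝ => weight lam (agree y) * ∑ i, peak (y i) := by fun_prop
  have hmix {F : (Fin n → ℝ) → ℝ≥0∞} (y : Fin n → ℝ) (h0 : ∃ i, y i = 0) (h1 : ∃ i, y i = 1) :
      weight lam (agree y) * F y = 0 := by
    rw [agree_eq_zero h0 h1, weight_zero, zero_mul]
  have hf : ∫⁻ y in forced n, weight lam (agree y) * ENNReal.ofReal (-Real.log (agree y)) ∂power n m
      = ∫⁻ y in forced n, weight lam (agree y) * ∑ i, peak (y i) ∂power n m + forcedLog n lam m := by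
    rw [forcedLog, ← lintegral_add_left hH]
    refine setLIntegral_congr_fun_ae measurableSet_forced ?_
    filter_upwards [hm.ae_power (n := n)] with y hy hyf
    have hpos (i : Fin n) : 0 < y i := lt_of_le_of_ne (hy i).1 (Ne.symm (mem_noZero.1 hyf.1 i))
    rw [agree_forced hy hyf, weight_prod _ fun i => (hy i).1, ← mul_add, ← Finset.sum_add_distrib,
      Real.log_prod fun i _ => (hpos i).ne', ← Finset.sum_neg_distrib,
      ENNReal.ofReal_sum_of_nonneg fun i _ => neg_nonneg.2 (Real.log_nonpos (hy i).1 (hy i).2)]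
    congr 1
    exact Finset.sum_congr rfl fun i _ => peak_add_logRatio (hpos i) (hy i).2
  rw [lintegral_var_split hm hG hmix, lintegral_var_split hm hH hmix]
  simp only [agree_reflect, peak_reflect]
  rw [hf]
  have hlog2 : 0 ≤ Real.log 2 := Real.log_nonneg one_le_two
  have hbox : ∫⁻ y in freeBox n, weight lam (agree y) * ENNReal.ofReal (-Real.log (agree y)) ∂power n m
      + ENNReal.ofReal (Real.log 2) * freeOut n lam m (fun _ => 1)
      = ∫⁻ y in freeBox n, weight lam (agree y)
        * ENNReal.ofReal (-Real.log (agree y) + Real.log 2) ∂power n m := by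
    rw [freeOut, ← lintegral_const_mul _ (by fun_prop), ← lintegral_add_left hG]
    refine setLIntegral_congr_fun measurableSet_freeBox fun y hy => ?_
    have h1 := agree_le_one hn (mem_Icc_of_mem_freeBox hy)
    have h2 := agree_pos_of_freeBox hy
    rw [ENNReal.ofReal_add (neg_nonneg.2 (Real.log_nonpos h2.le h1)) hlog2]
    ring
  have hpk (y : Fin n → ℝ) (hy : y ∈ freeBox n) :
      ∑ i, peak (y i) = ENNReal.ofReal (∑ i, -Real.log (max (y i) (1 - y i))) :=
    (ENNReal.ofReal_sum_of_nonneg fun i _ => neg_log_max_nonneg (mem_Icc_of_mem_freeBox hy i)).symm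
  have hlow : ∫⁻ y in freeBox n, weight lam (agree y) * ∑ i, peak (y i) ∂power n m
      ≤ ∫⁻ y in freeBox n, weight lam (agree y)
        * ENNReal.ofReal (-Real.log (agree y) + Real.log 2) ∂power n m := by
    refine setLIntegral_mono' measurableSet_freeBox fun y hy => ?_
    rw [hpk y hy]
    gcongr
    exact (neg_log_agree_bounds hy).1
  have hupp : ∫⁻ y in freeBox n, weight lam (agree y)
        * ENNReal.ofReal (-Real.log (agree y) + Real.log 2) ∂power n m
      ≤ ∫⁻ y in freeBox n, weight lam (agree y) * ∑ i, peak (y i) ∂power n m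
        + 2 * (n * ((∫⁻ t in Ioo 0 1, weight lam t * cost t ∂m) * freeWeight lam m ^ (n - 1))) := by
    calc _ ≤ ∫⁻ y in freeBox n, (weight lam (agree y) * ∑ i, peak (y i)
          + weight lam (agree y) * ∑ i, cost (y i)) ∂power n m := by
          refine setLIntegral_mono' measurableSet_freeBox fun y hy => ?_
          rw [hpk y hy, ← mul_add]
          gcongr
          refine (ENNReal.ofReal_le_ofReal (neg_log_agree_bounds hy).2).trans ?_
          rw [ENNReal.ofReal_add (Finset.sum_nonneg fun i _ =>
              neg_log_max_nonneg (mem_Icc_of_mem_freeBox hy i))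
            (Finset.sum_nonneg fun i _ => abs_nonneg _),
            ENNReal.ofReal_sum_of_nonneg (f := fun i => |Real.log ((1 - y i) / y i)|)
              fun i _ => abs_nonneg _]
          gcongr with i
          exact ofReal_abs_le_cost _
      _ = ∫⁻ y in freeBox n, weight lam (agree y) * ∑ i, peak (y i) ∂power n m
          + ∫⁻ y in freeBox n, weight lam (agree y) * ∑ i, cost (y i) ∂power n m :=
          lintegral_add_left hH _
      _ ≤ _ := by
          gcongr
          refine (lintegral_freeBox_le hl hl1 hm (by fun_prop) fun y => by simp only [cost_reflect]).trans ?_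
          rw [lintegral_freeBox_sum measurable_cost]
  constructor
  · calc _ = 2 * ∫⁻ y in forced n, weight lam (agree y) * ∑ i, peak (y i) ∂power n m
          + 2 * forcedLog n lam m
          + ∫⁻ y in freeBox n, weight lam (agree y) * ∑ i, peak (y i) ∂power n m := by ring
      _ ≤ 2 * ∫⁻ y in forced n, weight lam (agree y) * ∑ i, peak (y i) ∂power n m
          + 2 * forcedLog n lam m + ∫⁻ y in freeBox n, weight lam (agree y)
            * ENNReal.ofReal (-Real.log (agree y) + Real.log 2) ∂power n m := by gcongr
      _ = _ := by rw [← hbox]; ring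
  · calc _ = 2 * ∫⁻ y in forced n, weight lam (agree y) * ∑ i, peak (y i) ∂power n m
          + 2 * forcedLog n lam m + ∫⁻ y in freeBox n, weight lam (agree y)
            * ENNReal.ofReal (-Real.log (agree y) + Real.log 2) ∂power n m := by rw [← hbox]; ring
      _ ≤ 2 * ∫⁻ y in forced n, weight lam (agree y) * ∑ i, peak (y i) ∂power n m
          + 2 * forcedLog n lam m
          + (∫⁻ y in freeBox n, weight lam (agree y) * ∑ i, peak (y i) ∂power n m
            + 2 * (n * ((∫⁻ t in Ioo 0 1, weight lam t * cost t ∂m) * freeWeight lam m ^ (n - 1)))) := by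
          gcongr
      _ = _ := by ring

end Var

section FreeMass

variable {n : ℕ} {lam : ℝ} {m : Measure ℝ} [IsFiniteMeasure m]

lemma weight_add_ge (hl : 0 ≤ lam) (hl1 : lam ≤ 1) {a b : ℝ} (ha : 0 < a) (hb : 0 < b) :
    ENNReal.ofReal (2 ^ lam) * (weight lam a + weight lam b) ≤ 2 * weight lam (a + b) := by
  rw [weight_of_pos ha, weight_of_pos hb, weight_of_pos (by positivity), ← ENNReal.ofReal_add
    (by positivity) (by positivity), ← ENNReal.ofReal_mul (by positivity),
    show (2 : ℝ≥0∞) = ENNReal.ofReal 2 by simp, ← ENNReal.ofReal_mul two_pos.le]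
  refine ENNReal.ofReal_le_ofReal ?_
  have h := (Real.concaveOn_rpow hl hl1).2 ha.le hb.le (by norm_num : (0 : ℝ) ≤ 1 / 2)
    (by norm_num : (0 : ℝ) ≤ 1 / 2) (by norm_num)
  simp only [smul_eq_mul] at h
  rw [← mul_add, ← mul_add] at h
  have h2 : (a + b) ^ lam = 2 ^ lam * (1 / 2 * (a + b)) ^ lam := by
    rw [← Real.mul_rpow two_pos.le (by positivity)]
    congr 1
    ring
  rw [h2]
  have h3 : (0 : ℝ) < 2 ^ lam := by positivity
  nlinarith

lemma one_le_ofReal_two_rpow (hl : 0 ≤ lam) : 1 ≤ ENNReal.ofReal (2 ^ lam) := by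
  rw [← ENNReal.ofReal_one]
  exact ENNReal.ofReal_le_ofReal (Real.one_le_rpow one_le_two hl)

lemma two_mul_weight_agree_le (hl : 0 ≤ lam) (hl1 : lam ≤ 1) {y : Fin n → ℝ} (hy : y ∈ freeBox n) :
    2 * weight lam (agree y) ≤ ENNReal.ofReal (2 ^ lam)
      * ((∏ i, weight lam (y i) + ∏ i, weight lam (1 - y i)) * (1 + ∑ i, cost (y i))) := by
  have hy' := mem_Icc_of_mem_freeBox hy
  by_cases h : ∀ i, y i = 1 / 2
  · have h1 : agree y = 2 * ∏ i, y i := by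
      unfold agree
      rw [two_mul]
      congr 1
      refine Finset.prod_congr rfl fun i _ => ?_
      rw [h i]
      norm_num
    have h2 : ∏ i, weight lam (1 - y i) = ∏ i, weight lam (y i) := by
      refine Finset.prod_congr rfl fun i _ => ?_
      rw [h i]
      norm_num
    rw [h1, weight_mul two_pos.le (prod_mem_Icc hy').1, weight_prod _ fun i => (hy' i).1,
      weight_of_pos two_pos, h2, ← two_mul, mul_left_comm]
    exact mul_le_mul_right (le_mul_of_one_le_right bot_le le_self_add) _
  · push Not at h
    obtain ⟨i, hi⟩ := h
    have h1 : 1 ≤ cost (y i) := by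
      unfold cost
      rw [if_neg hi]
      exact le_self_add
    have h2 : 2 ≤ 1 + ∑ i, cost (y i) := by
      rw [← one_add_one_eq_two]
      gcongr
      exact h1.trans (Finset.single_le_sum (f := fun i => cost (y i)) (fun _ _ => bot_le)
        (Finset.mem_univ i))
    calc _ ≤ 2 * (∏ i, weight lam (y i) + ∏ i, weight lam (1 - y i)) := by
          gcongr
          exact weight_agree_le hl hl1 hy'
      _ ≤ (∏ i, weight lam (y i) + ∏ i, weight lam (1 - y i)) * (1 + ∑ i, cost (y i)) := by
          rw [mul_comm]
          gcongr
      _ ≤ _ := le_mul_of_one_le_left bot_le (one_le_ofReal_two_rpow hl)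

lemma freeOut_bounds (hl : 0 ≤ lam) (hl1 : lam ≤ 1) (hm : Balanced m) :
    ENNReal.ofReal (2 ^ lam) * freeWeight lam m ^ n ≤ freeOut n lam m (fun _ => 1) ∧
    freeOut n lam m (fun _ => 1) ≤ ENNReal.ofReal (2 ^ lam) * (freeWeight lam m ^ n
      + n * ((∫⁻ t in Ioo 0 1, weight lam t * cost t ∂m) * freeWeight lam m ^ (n - 1))) := by
  have h2 : (2 : ℝ≥0∞) ≠ 0 := two_ne_zero
  have hr {F : (Fin n → ℝ) → ℝ≥0∞} (hF : Measurable F) (hrF : ∀ y, F (fun i => 1 - y i) = F y) :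
      ∫⁻ y in freeBox n, (∏ i, weight lam (y i) + ∏ i, weight lam (1 - y i)) * F y ∂power n m
        = 2 * ∫⁻ y in freeBox n, (∏ i, weight lam (y i)) * F y ∂power n m := by
    have hP : Measurable fun y : Fin n → ℝ => (∏ i, weight lam (y i)) * F y := by fun_prop
    simp only [add_mul]
    rw [lintegral_add_left hP, two_mul]
    congr 1
    rw [← lintegral_freeBox_reflect hm hP]
    simp only [hrF]
  have hw : ∫⁻ y in freeBox n, ∏ i, weight lam (y i) ∂power n m = freeWeight lam m ^ n :=
    lintegral_freeBox_prod (measurable_weight lam)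
  constructor
  · rw [← ENNReal.mul_le_mul_iff_right h2 ENNReal.ofNat_ne_top]
    calc _ = ENNReal.ofReal (2 ^ lam) * (2 * ∫⁻ y in freeBox n, (∏ i, weight lam (y i)) * 1 ∂power n m) := by
          simp only [mul_one, hw]
          ring
      _ = ∫⁻ y in freeBox n, ENNReal.ofReal (2 ^ lam)
          * ((∏ i, weight lam (y i) + ∏ i, weight lam (1 - y i)) * 1) ∂power n m := by
          rw [lintegral_const_mul _ (by fun_prop), hr measurable_const fun _ => rfl]
      _ ≤ ∫⁻ y in freeBox n, 2 * (weight lam (agree y) * 1) ∂power n m := by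
          refine setLIntegral_mono' measurableSet_freeBox fun y hy => ?_
          have hy' := mem_Icc_of_mem_freeBox hy
          rw [mul_one, mul_one, ← weight_prod _ fun i => (hy' i).1,
            ← weight_prod _ fun i => (reflect_mem hy' i).1]
          exact weight_add_ge hl hl1 (prod_pos_of_freeBox hy)
            (prod_pos_of_freeBox (reflect_mem_freeBox hy))
      _ = _ := lintegral_const_mul _ (by fun_prop)
  · rw [← ENNReal.mul_le_mul_iff_right h2 ENNReal.ofNat_ne_top]
    calc _ = ∫⁻ y in freeBox n, 2 * (weight lam (agree y) * 1) ∂power n m :=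
          (lintegral_const_mul _ (by fun_prop)).symm
      _ ≤ ∫⁻ y in freeBox n, ENNReal.ofReal (2 ^ lam)
          * ((∏ i, weight lam (y i) + ∏ i, weight lam (1 - y i)) * (1 + ∑ i, cost (y i))) ∂power n m := by
          refine setLIntegral_mono' measurableSet_freeBox fun y hy => ?_
          rw [mul_one]
          exact two_mul_weight_agree_le hl hl1 hy
      _ = ENNReal.ofReal (2 ^ lam)
          * (2 * ∫⁻ y in freeBox n, (∏ i, weight lam (y i)) * (1 + ∑ i, cost (y i)) ∂power n m) := by
          rw [lintegral_const_mul _ (by fun_prop), hr (by fun_prop) fun y => by simp only [cost_reflect]]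
      _ = _ := by
          simp only [mul_add (∏ i, weight lam _), mul_one]
          rw [lintegral_add_left (by fun_prop), hw, lintegral_freeBox_sum measurable_cost]
          ring

end FreeMass

section Scaling

variable {Ω : Type*} [MeasurableSpace Ω] {ν : Measure Ω} {lam : ℝ} {g : Ω → ℝ} {c : ℝ≥0∞}

lemma tiltedMass_smul : tiltedMass (c • ν) lam g = c * tiltedMass ν lam g :=
  lintegral_smul_measure _ _

lemma prod_smul_right {μ m : Measure ℝ} [IsFiniteMeasure μ] [IsFiniteMeasure m] (hc : c ≠ ∞) :
    μ.prod (c • m) = c • μ.prod m := by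
  have : IsFiniteMeasure (c • m) := Measure.smul_finite m hc
  ext s hs
  rw [Measure.prod_apply hs, Measure.smul_apply, Measure.prod_apply hs, smul_eq_mul,
    ← lintegral_const_mul _ (measurable_measure_prodMk_left hs)]
  rfl

end Scaling

section Balance

variable {k N : ℕ} {θ lam : ℝ} {μ : Measure ℝ} (hR : Regime k N θ) (h : Good k θ μ) (hl : 0 ≤ lam)
  (hl1 : lam ≤ 1)

lemma tiltedMass_edge (hk : 1 < k) [IsProbabilityMeasure μ] (hμ : Balanced μ) (hl : 0 ≤ lam)
    (hl1 : lam ≤ 1) : tiltedMass (μ.prod (clauseRaw (k - 1) lam μ)) lam edgeAgree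
      = tiltedMass (power k μ) lam fun x => 1 - agree x := by
  have h1 := lintegral_edge (n := k - 1) (by omega) hμ hl hl1 (Φ := fun _ => 1) measurable_const
  simp only [mul_one] at h1
  unfold tiltedMass
  rw [h1, Nat.sub_add_cancel hk.le]

lemma tiltedMass_edge_log (hk : 1 < k) [IsProbabilityMeasure μ] (hμ : Balanced μ) (hl : 0 ≤ lam)
    (hl1 : lam ≤ 1) :
    ∫⁻ p, weight lam (edgeAgree p) * ENNReal.ofReal (-Real.log (edgeAgree p)) ∂μ.prod (clauseRaw (k - 1) lam μ)
      = ∫⁻ x, weight lam (1 - agree x) * ENNReal.ofReal (-Real.log (1 - agree x)) ∂power k μ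
        + cavityLog (k - 1) lam μ := by
  rw [lintegral_edge_log (by omega) hμ hl hl1, Nat.sub_add_cancel hk.le]

include hR hl hl1 h in
/-- The entropy of a variable at a fixed point of the recursion, in terms of the entropy of an
edge. -/
lemma Good.variable_entropy (hfix : NAESat.step k N lam μ = μ) {b T K κ Z : ℝ}
    (hB : MessageBounds k θ lam (clauseRaw (k - 1) lam μ) b T K)
    (hκ : ∫⁻ t, weight lam t * logRatio t ∂clauseRaw (k - 1) lam μ = ENNReal.ofReal κ) (hκ0 : 0 ≤ κ)
    (hZ : tiltedMass (power k μ) lam (fun x => 1 - agree x) = ENNReal.ofReal Z) (hZ0 : 0 < Z) :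
    ∃ V Yf C D R : ℝ, 0 ≤ V ∧ 0 ≤ Yf ∧ 0 ≤ C ∧ 0 ≤ D ∧ D ≤ θ ^ 3 ∧ 0 ≤ R ∧
      R ≤ 36 * (N + 1) * k * θ ^ 2 * K ^ N ∧
      2 ^ lam * K ^ (N + 1) ≤ Yf ∧
      Yf ≤ 2 ^ lam * (K ^ (N + 1) + 18 * (N + 1) * k * θ ^ 2 * K ^ N) ∧
      0 < 2 * (T ^ (N + 1) - K ^ (N + 1)) + Yf ∧
      tiltedMass (power (N + 1) (clauseRaw (k - 1) lam μ)) lam agree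
        = ENNReal.ofReal (2 * (T ^ (N + 1) - K ^ (N + 1)) + Yf) ∧
      ∫⁻ y, weight lam (agree y) * ENNReal.ofReal (-Real.log (agree y))
        ∂power (N + 1) (clauseRaw (k - 1) lam μ) = ENNReal.ofReal V ∧
      cavityLog (k - 1) lam μ = ENNReal.ofReal C ∧
      V + Real.log 2 * Yf = (N + 1) * ((2 * (T ^ (N + 1) - K ^ (N + 1)) + Yf) * ((C + D) / Z))
        + 2 * ((N + 1) * (κ * (T ^ N - K ^ N))) + R := by
  have := h.prob
  have hk := hR.large
  have hk1 : 0 < k - 1 := by omega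
  have hμ := h.balanced
  have hm := hB.balanced
  have := hB.finite
  have hθ := hR.theta_pos
  have hK0 := hB.K_nonneg
  have hKT := hB.K_le_T hR
  have hT0 : 0 ≤ T := hK0.trans hKT
  set m := clauseRaw (k - 1) lam μ with hm_def
  have hlog2 : 0 ≤ Real.log 2 := Real.log_nonneg one_le_two
  -- the cavity entropy
  obtain ⟨hc1, hc2⟩ := lintegral_edge_peak (n := k - 1) hk1 hμ hl hl1
  have hCtop : cavityLog (k - 1) lam μ ≠ ∞ :=
    ne_top_of_le_ne_top ENNReal.one_ne_top (cavityLog_le hk1 hμ hl)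
  have hDle : ENNReal.ofReal (Real.log 2) * μ (Ioo 0 1) ^ (k - 1) ≤ ENNReal.ofReal (θ ^ 3) := by
    calc _ ≤ 1 * ENNReal.ofReal θ ^ (k - 1) := by
          gcongr
          · rw [← ENNReal.ofReal_one]
            exact ENNReal.ofReal_le_ofReal (by linarith [Real.log_two_lt_d9])
          · exact h.free_le
      _ = ENNReal.ofReal (θ ^ (k - 1)) := by rw [one_mul, ENNReal.ofReal_pow hθ.le]
      _ ≤ _ := by
          refine ENNReal.ofReal_le_ofReal (pow_le_pow_of_le_one hθ.le ?_ (by omega))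
          linarith [hR.small_zero]
  set P := ∫⁻ p, weight lam (edgeAgree p) * peak p.2 ∂μ.prod m with hP_def
  have hPle := hc2.trans (add_le_add le_rfl hDle)
  have hPtop : P ≠ ∞ := ne_top_of_le_ne_top (ENNReal.add_ne_top.2 ⟨hCtop, ENNReal.ofReal_ne_top⟩) hPle
  -- masses
  have hY0 := hB.tiltedMass_ne_zero hR
  have hYtop := hB.tiltedMass_ne_top hR hl hl1 N
  have hstep : tiltedLaw (power N m) lam agree varOut = μ := hfix
  have hfreetop (n : ℕ) : freeOut n lam m (fun _ => 1) ≠ ∞ :=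
    ne_top_of_le_ne_top ENNReal.ofReal_ne_top (hB.freeOut_le hl hl1 n)
  set Yf := (freeOut (N + 1) lam m fun _ => 1).toReal with hYf_def
  have hYf : freeOut (N + 1) lam m (fun _ => 1) = ENNReal.ofReal Yf :=
    (ENNReal.ofReal_toReal (hfreetop _)).symm
  have hTK : 0 ≤ T ^ (N + 1) - K ^ (N + 1) := sub_nonneg.2 (pow_le_pow_left₀ hK0 hKT _)
  have hTK' : 0 ≤ T ^ N - K ^ N := sub_nonneg.2 (pow_le_pow_left₀ hK0 hKT _)
  have hYf0 : 0 ≤ Yf := ENNReal.toReal_nonneg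
  have hY : tiltedMass (power (N + 1) m) lam agree
      = ENNReal.ofReal (2 * (T ^ (N + 1) - K ^ (N + 1)) + Yf) := by
    rw [tiltedMass_agree hm, hB.forced_eq hR, hYf, ENNReal.ofReal_add (by positivity) hYf0,
      ENNReal.ofReal_mul two_pos.le]
    simp
  have hYprod : tiltedMass (power (N + 1) m) lam agree
      = tiltedMass (power N m) lam agree * ENNReal.ofReal Z := by
    have h1 := lintegral_var_edge hm hY0 hYtop (φ := fun _ => 1) measurable_const
    simp only [mul_one] at h1
    rw [hstep] at h1
    rw [← hZ, ← tiltedMass_edge (by omega) hμ hl hl1]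
    exact h1
  have hYpos : 0 < 2 * (T ^ (N + 1) - K ^ (N + 1)) + Yf := by
    rw [← ENNReal.ofReal_pos, ← hY, hYprod]
    exact ENNReal.mul_pos hY0 (ENNReal.ofReal_pos.2 hZ0).ne'
  have hYN : tiltedMass (power N m) lam agree
      = ENNReal.ofReal ((2 * (T ^ (N + 1) - K ^ (N + 1)) + Yf) / Z) := by
    rw [ENNReal.ofReal_div_of_pos hZ0, ← hY, hYprod, ENNReal.mul_div_cancel_right
      (ENNReal.ofReal_pos.2 hZ0).ne' ENNReal.ofReal_ne_top]
  have hpeak : ∫⁻ y, weight lam (agree y) * ∑ i, peak (y i) ∂power (N + 1) m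
      = ENNReal.ofReal ((N + 1) * ((2 * (T ^ (N + 1) - K ^ (N + 1)) + Yf) / Z * P.toReal)) := by
    rw [lintegral_agree_sum measurable_peak, lintegral_var_edge hm hY0 hYtop measurable_peak, hstep, hYN,
      ← hP_def, ENNReal.ofReal_mul (by positivity), ENNReal.ofReal_mul (by positivity),
      ENNReal.ofReal_toReal hPtop]
    congr 1
    rw [← Nat.cast_succ, ENNReal.ofReal_natCast]
  have hforced : forcedLog (N + 1) lam m = ENNReal.ofReal ((N + 1) * (κ * (T ^ N - K ^ N))) := by
    have h1 := forcedLog_add (n := N + 1) (lam := lam) hm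
    rw [Nat.add_sub_cancel, hκ, hB.free_eq, hB.all_eq, ← ENNReal.ofReal_pow hK0, ← ENNReal.ofReal_pow hT0,
      ← ENNReal.ofReal_mul hκ0, ← ENNReal.ofReal_mul hκ0, ← ENNReal.ofReal_natCast,
      ← ENNReal.ofReal_mul (by positivity), ← ENNReal.ofReal_mul (by positivity)] at h1
    have h2 : ((N + 1 : ℕ) : ℝ) * (κ * (T ^ N - K ^ N))
        = (N + 1 : ℕ) * (κ * T ^ N) - (N + 1 : ℕ) * (κ * K ^ N) := by ring
    rw [← Nat.cast_succ, h2, ENNReal.ofReal_sub _ (by positivity), ← h1,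
      ENNReal.add_sub_cancel_right ENNReal.ofReal_ne_top]
  have hcost : (N + 1 : ℕ) * ((∫⁻ t in Ioo 0 1, weight lam t * cost t ∂m) * freeWeight lam m ^ (N + 1 - 1))
      ≤ ENNReal.ofReal (18 * (N + 1) * k * θ ^ 2 * K ^ N) := by
    rw [Nat.add_sub_cancel, hB.free_eq, ← ENNReal.ofReal_pow hK0, ← ENNReal.ofReal_natCast]
    calc _ ≤ ENNReal.ofReal (N + 1 : ℕ) * (ENNReal.ofReal (18 * k * θ ^ 2) * ENNReal.ofReal (K ^ N)) := by
          gcongr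
          exact hB.cost_le
      _ = ENNReal.ofReal ((N + 1 : ℕ) * (18 * k * θ ^ 2 * K ^ N)) := by
          rw [← ENNReal.ofReal_mul (p := 18 * k * θ ^ 2) (by positivity),
            ← ENNReal.ofReal_mul (by positivity)]
      _ = _ := by
          push_cast
          congr 1
          ring
  obtain ⟨hlow, hupp⟩ := lintegral_agree_log (n := N + 1) (by omega) hm hl hl1
  have hcost0 : 0 ≤ 18 * (N + 1) * k * θ ^ 2 * K ^ N := by positivity
  have hupp' := hupp.trans (add_le_add le_rfl (mul_le_mul_right hcost 2))
  set NV := ∫⁻ y, weight lam (agree y) * ENNReal.ofReal (-Real.log (agree y)) ∂power (N + 1) m with hNV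
  have htwo : (2 : ℝ≥0∞) = ENNReal.ofReal 2 := by simp
  have hPr := ENNReal.toReal_nonneg (a := P)
  set A := (N + 1) * ((2 * (T ^ (N + 1) - K ^ (N + 1)) + Yf) / Z * P.toReal) with hA
  set B := (N + 1) * (κ * (T ^ N - K ^ N)) with hBB
  have hA0 : 0 ≤ A := by positivity
  have hB0 : 0 ≤ B := by positivity
  rw [hpeak, hforced, hYf, htwo, ← ENNReal.ofReal_mul two_pos.le, ← ENNReal.ofReal_add hA0 (by positivity),
    ← ENNReal.ofReal_mul hlog2] at hlow hupp'
  rw [← ENNReal.ofReal_mul two_pos.le, ← ENNReal.ofReal_add (by positivity) (by positivity)] at hupp'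
  have hNVtop : NV ≠ ∞ := by
    refine ne_top_of_le_ne_top ENNReal.ofReal_ne_top (le_self_add.trans hupp')
  have hV : NV = ENNReal.ofReal NV.toReal := (ENNReal.ofReal_toReal hNVtop).symm
  have hV0 := ENNReal.toReal_nonneg (a := NV)
  rw [hV, ← ENNReal.ofReal_add hV0 (by positivity)] at hlow hupp'
  have hlow' := (ENNReal.ofReal_le_ofReal_iff (by positivity)).1 hlow
  have hupp'' := (ENNReal.ofReal_le_ofReal_iff (by positivity)).1 hupp'
  obtain ⟨hf1, hf2⟩ := freeOut_bounds (n := N + 1) hl hl1 hm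
  have h2lam : (0 : ℝ) ≤ 2 ^ lam := by positivity
  have hf2' := hf2.trans (mul_le_mul_right (add_le_add le_rfl hcost) _)
  rw [hB.free_eq, ← ENNReal.ofReal_pow hK0, hYf] at hf1 hf2'
  rw [← ENNReal.ofReal_mul h2lam, ENNReal.ofReal_le_ofReal_iff hYf0] at hf1
  rw [← ENNReal.ofReal_add (by positivity) hcost0, ← ENNReal.ofReal_mul h2lam,
    ENNReal.ofReal_le_ofReal_iff (by positivity)] at hf2'
  have hCP := ENNReal.toReal_mono hPtop hc1
  have hPC := ENNReal.toReal_mono (by finiteness) hPle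
  rw [ENNReal.toReal_add hCtop ENNReal.ofReal_ne_top, ENNReal.toReal_ofReal (by positivity)] at hPC
  refine ⟨NV.toReal, Yf, (cavityLog (k - 1) lam μ).toReal, P.toReal - (cavityLog (k - 1) lam μ).toReal,
    NV.toReal + Real.log 2 * Yf - (A + 2 * B), hV0, hYf0, ENNReal.toReal_nonneg, sub_nonneg.2 hCP,
    by linarith, by linarith, by linarith, hf1, hf2', hYpos, hY, hV, (ENNReal.ofReal_toReal hCtop).symm, ?_⟩
  rw [hA]
  field_simp
  ring

end Balance

section Real

variable {k N : ℕ} {θ : ℝ} (hR : Regime k N θ)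
include hR

namespace Regime

/-- Powers of the atom `p = (1 - q) / 2`. -/
lemma atom_pow {q : ℝ} :
    ((1 - q) / 2) ^ (k - 1 - 1) = 2 * θ * (1 - q) ^ (k - 1 - 1) ∧
    ((1 - q) / 2) ^ (k - 1) = θ * (1 - q) ^ (k - 1) ∧
    2 * ((1 - q) / 2) ^ k = θ * (1 - q) ^ (k - 1) * (1 - q) := by
  have hk := hR.large
  have h1 := hR.half_pow
  have h2 := hR.theta
  refine ⟨?_, ?_, ?_⟩
  · rw [← h1, div_eq_mul_one_div, mul_pow]; ring
  · rw [h2, div_eq_mul_one_div, mul_pow]; ring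
  · obtain ⟨j, hj⟩ : ∃ j, k = j + 1 := ⟨k - 1, by omega⟩
    rw [h2, hj, Nat.add_sub_cancel, div_eq_mul_one_div, mul_pow, pow_succ, pow_succ]; ring

lemma one_sub_pow {q : ℝ} (hq : 0 ≤ q) (hq1 : q ≤ θ) :
    1 - k * q ≤ (1 - q) ^ (k - 1) ∧ (1 - q) ^ (k - 1) ≤ 1 ∧ 0 ≤ (1 - q) ^ (k - 1 - 1) ∧
      (1 - q) ^ (k - 1 - 1) ≤ 1 ∧ (1 - q) ^ (k - 1) * (1 + (k - 1) * q) ≤ 1 ∧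
      1 - k ^ 2 * q ^ 2 ≤ (1 - q) ^ (k - 1) * (1 + (k - 1) * q) := by
  have hk := hR.large
  have hθ := hR.small_zero
  have hk1 : ((k - 1 : ℕ) : ℝ) = k - 1 := by rw [Nat.cast_sub (by omega)]; simp
  have hkge := hR.k_ge
  have h1 := one_add_mul_le_pow (a := -q) (by linarith) (k - 1)
  have h2 := one_add_mul_le_pow (a := q) (by linarith) (k - 1)
  rw [hk1] at h1 h2
  rw [← sub_eq_add_neg] at h1
  have h3 : 0 ≤ (1 - q) ^ (k - 1) := pow_nonneg (by linarith) _
  have h4 : (1 - q) ^ (k - 1) * (1 + q) ^ (k - 1) ≤ 1 := by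
    rw [← mul_pow]
    exact pow_le_one₀ (by nlinarith) (by nlinarith)
  refine ⟨by nlinarith, pow_le_one₀ (by linarith) (by linarith), pow_nonneg (by linarith) _,
    pow_le_one₀ (by linarith) (by linarith), ?_, ?_⟩
  · calc _ ≤ (1 - q) ^ (k - 1) * (1 + q) ^ (k - 1) := mul_le_mul_of_nonneg_left h2 h3
      _ ≤ 1 := h4
  · have h5 : 0 ≤ 1 + ((k : ℝ) - 1) * q := by nlinarith
    have h6 := mul_le_mul_of_nonneg_right h1 h5
    nlinarith

lemma k_theta_small : (k : ℝ) * θ ≤ 1 / 10 ^ 6 ∧ (k : ℝ) ^ 2 * θ ≤ 1 / 10 ^ 6 := by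
  have h1 := hR.small_one
  have h2 := hR.small_two
  constructor
  · linarith
  · linarith

lemma mass_bounds {q J τ σ : ℝ} (hq : 0 ≤ q) (hq1 : q ≤ θ) (hJ : 0 ≤ J) (hJ1 : J ≤ 2 * θ)
    (hτ : 1 * ((1 - q) / 2) ^ (k - 1) + (k - 1 : ℕ) * (J * ((1 - q) / 2) ^ (k - 1 - 1)) ≤ τ)
    (hτ' : τ ≤ 1 * ((1 - q) / 2) ^ (k - 1) + (k - 1 : ℕ) * (J * ((1 - q) / 2) ^ (k - 1 - 1))
      + 24 * k ^ 2 * θ ^ 3)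
    (hσ : 2 * ((1 - q) / 2) ^ k + k * (2 * J * ((1 - q) / 2) ^ (k - 1)) ≤ σ)
    (hσ' : σ ≤ 2 * ((1 - q) / 2) ^ k + k * (2 * J * ((1 - q) / 2) ^ (k - 1)) + 24 * k ^ 2 * θ ^ 3) :
    |τ - θ| ≤ 5 * k * θ ^ 2 ∧ |σ - θ| ≤ 5 * k * θ ^ 2 ∧
      |k * τ - (k - 1) * σ - θ| ≤ 30 * k ^ 3 * θ ^ 3 := by
  have hk := hR.large
  have hk1 : ((k - 1 : ℕ) : ℝ) = k - 1 := by rw [Nat.cast_sub (by omega)]; simp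
  have hkge := hR.k_ge
  have hk0 : (0 : ℝ) ≤ k := Nat.cast_nonneg k
  have hk10 : (0 : ℝ) ≤ k - 1 := by linarith
  have hθ := hR.theta_pos
  obtain ⟨hs1, hs2⟩ := hR.k_theta_small
  obtain ⟨e1, e2, e3⟩ := hR.atom_pow (q := q)
  obtain ⟨b1, b2, b3, b4, b5, b6⟩ := hR.one_sub_pow hq hq1
  have hsucc : (1 - q) ^ (k - 1) = (1 - q) ^ (k - 1 - 1) * (1 - q) := by
    rw [← pow_succ, Nat.sub_add_cancel (by omega)]
  rw [e1, e2, hk1] at hτ hτ'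
  rw [e2, e3] at hσ hσ'
  rw [hsucc] at hτ hτ' hσ hσ' b1 b2 b5 b6
  generalize (1 - q) ^ (k - 1 - 1) = a at *
  have hR0 : 24 * (k : ℝ) ^ 2 * θ ^ 3 ≤ k * θ ^ 2 / 2 := by
    have : (k : ℝ) * θ ^ 2 * (48 * (k * θ)) ≤ k * θ ^ 2 * 1 :=
      mul_le_mul_of_nonneg_left (by linarith) (by positivity)
    have e : 24 * (k : ℝ) ^ 2 * θ ^ 3 = k * θ ^ 2 * (48 * (k * θ)) / 2 := by ring
    rw [e]
    linarith
  have hkq : (k : ℝ) * q ≤ k * θ := by gcongr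
  have hJa : (k - 1) * (J * (2 * θ * a)) ≤ 4 * k * θ ^ 2 := by
    calc (k - 1) * (J * (2 * θ * a)) ≤ k * (2 * θ * (2 * θ * 1)) := by
          gcongr
          exact sub_le_self _ zero_le_one
      _ = _ := by ring
  have hJa0 : 0 ≤ (k - 1) * (J * (2 * θ * a)) := by
    positivity
  have h1q : 0 ≤ 1 - q := by linarith [hR.small_zero]
  have hJb : (k : ℝ) * (2 * J * (θ * (a * (1 - q)))) ≤ 4 * k * θ ^ 2 := by
    calc (k : ℝ) * (2 * J * (θ * (a * (1 - q)))) ≤ k * (2 * (2 * θ) * (θ * 1)) := by gcongr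
      _ = _ := by ring
  have hJb0 : 0 ≤ (k : ℝ) * (2 * J * (θ * (a * (1 - q)))) := by positivity
  have hA : θ - k * θ ^ 2 ≤ θ * (a * (1 - q)) := by
    have := mul_le_mul_of_nonneg_left ((sub_le_sub_left hkq 1).trans b1) hθ.le
    linarith
  have hA' : θ * (a * (1 - q)) ≤ θ := mul_le_of_le_one_right hθ.le b2
  have hB : θ - 2 * k * θ ^ 2 ≤ θ * (a * (1 - q)) * (1 - q) := by
    have : θ * (a * (1 - q)) * q ≤ θ * θ := by
      exact mul_le_mul hA' hq1 hq hθ.le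
    have h1 : θ * θ ≤ k * θ ^ 2 := by
      rw [← pow_two]
      exact le_mul_of_one_le_left (sq_nonneg θ) (by linarith)
    linarith
  have hB' : θ * (a * (1 - q)) * (1 - q) ≤ θ := by
    have : 0 ≤ θ * (a * (1 - q)) * q := by positivity
    linarith
  refine ⟨?_, ?_, ?_⟩
  · rw [abs_le]
    constructor <;> linarith
  · rw [abs_le]
    constructor <;> linarith
  · have hkτ := mul_le_mul_of_nonneg_left hτ hk0
    have hkτ' := mul_le_mul_of_nonneg_left hτ' hk0
    have hkσ := mul_le_mul_of_nonneg_left hσ hk10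
    have hkσ' := mul_le_mul_of_nonneg_left hσ' hk10
    have hmain : k * (1 * (θ * (a * (1 - q))) + (k - 1) * (J * (2 * θ * a)))
        - (k - 1) * (θ * (a * (1 - q)) * (1 - q) + k * (2 * J * (θ * (a * (1 - q)))))
        = θ * (a * (1 - q) * (1 + (k - 1) * q)) + 2 * (k * (k - 1) * (J * (θ * a) * q)) := by ring
    have hm1 : θ * (a * (1 - q) * (1 + (k - 1) * q)) ≤ θ :=
      mul_le_of_le_one_right hθ.le b5
    have hm2 : θ - k ^ 2 * θ ^ 3 ≤ θ * (a * (1 - q) * (1 + (k - 1) * q)) := by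
      have h1 : (k : ℝ) ^ 2 * q ^ 2 ≤ k ^ 2 * θ ^ 2 := by gcongr
      have h2 := mul_le_mul_of_nonneg_left ((sub_le_sub_left h1 1).trans b6) hθ.le
      linarith
    have hm3 : k * (k - 1) * (J * (θ * a) * q) ≤ 2 * k ^ 2 * θ ^ 3 := by
      calc k * (k - 1) * (J * (θ * a) * q) ≤ k * k * (2 * θ * (θ * 1) * θ) := by
            gcongr
            linarith
        _ = _ := by ring
    have hm4 : 0 ≤ k * (k - 1) * (J * (θ * a) * q) := by
      positivity
    have hk3 : (k : ℝ) ^ 2 * θ ^ 3 ≤ k ^ 3 * θ ^ 3 := by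
      gcongr
      · linarith
      · norm_num
    have e1 : (k : ℝ) * (24 * k ^ 2 * θ ^ 3) = 24 * (k ^ 3 * θ ^ 3) := by ring
    have e2 : ((k : ℝ) - 1) * (24 * k ^ 2 * θ ^ 3) ≤ 24 * (k ^ 3 * θ ^ 3) := by
      have : 0 ≤ 24 * (k : ℝ) ^ 2 * θ ^ 3 := by positivity
      linarith
    have hk0' : 0 ≤ (k : ℝ) ^ 3 * θ ^ 3 := by positivity
    rw [mul_add] at hkτ' hkσ'
    rw [e1] at hkτ'
    rw [abs_le]
    constructor <;> linarith

lemma entropy_bounds {q J κ Λ : ℝ} (hq : 0 ≤ q) (hq1 : q ≤ θ) (hJ : 0 ≤ J) (hJ1 : J ≤ 2 * θ)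
    (hκ : (k - 1 : ℕ) * (J * ((1 - q) / 2) ^ (k - 1 - 1)) ≤ κ)
    (hκ' : κ ≤ (k - 1 : ℕ) * (J * ((1 - q) / 2) ^ (k - 1 - 1)) + 24 * k ^ 2 * θ ^ 3)
    (hΛ : k * (2 * J * ((1 - q) / 2) ^ (k - 1)) ≤ Λ)
    (hΛ' : Λ ≤ k * (2 * J * ((1 - q) / 2) ^ (k - 1)) + 24 * k ^ 2 * θ ^ 3) :
    κ ≤ 5 * k * θ ^ 2 ∧ Λ ≤ 5 * k * θ ^ 2 ∧ |k * κ - (k - 1) * Λ| ≤ 30 * k ^ 3 * θ ^ 3 := by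
  have hk := hR.large
  have hk1 : ((k - 1 : ℕ) : ℝ) = k - 1 := by rw [Nat.cast_sub (by omega)]; simp
  have hkge := hR.k_ge
  have hk0 : (0 : ℝ) ≤ k := Nat.cast_nonneg k
  have hk10 : (0 : ℝ) ≤ k - 1 := by linarith
  have hθ := hR.theta_pos
  obtain ⟨hs1, hs2⟩ := hR.k_theta_small
  obtain ⟨e1, e2, e3⟩ := hR.atom_pow (q := q)
  obtain ⟨b1, b2, b3, b4, b5, b6⟩ := hR.one_sub_pow hq hq1
  have hsucc : (1 - q) ^ (k - 1) = (1 - q) ^ (k - 1 - 1) * (1 - q) := by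
    rw [← pow_succ, Nat.sub_add_cancel (by omega)]
  rw [e1, hk1] at hκ hκ'
  rw [e2] at hΛ hΛ'
  rw [hsucc] at hΛ hΛ' b1 b2
  generalize (1 - q) ^ (k - 1 - 1) = a at *
  have hR0 : 24 * (k : ℝ) ^ 2 * θ ^ 3 ≤ k * θ ^ 2 / 2 := by
    have : (k : ℝ) * θ ^ 2 * (48 * (k * θ)) ≤ k * θ ^ 2 * 1 :=
      mul_le_mul_of_nonneg_left (by linarith) (by positivity)
    have e : 24 * (k : ℝ) ^ 2 * θ ^ 3 = k * θ ^ 2 * (48 * (k * θ)) / 2 := by ring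
    rw [e]
    linarith
  have hJa : (k - 1) * (J * (2 * θ * a)) ≤ 4 * k * θ ^ 2 := by
    calc (k - 1) * (J * (2 * θ * a)) ≤ k * (2 * θ * (2 * θ * 1)) := by
          gcongr
          linarith
      _ = _ := by ring
  have h1q : 0 ≤ 1 - q := by linarith [hR.small_zero]
  have hJb : (k : ℝ) * (2 * J * (θ * (a * (1 - q)))) ≤ 4 * k * θ ^ 2 := by
    calc (k : ℝ) * (2 * J * (θ * (a * (1 - q)))) ≤ k * (2 * (2 * θ) * (θ * 1)) := by gcongr
      _ = _ := by ring
  have hpos : 0 ≤ (k : ℝ) * θ ^ 2 := by positivity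
  refine ⟨by linarith, by linarith, ?_⟩
  have hkκ := mul_le_mul_of_nonneg_left hκ hk0
  have hkκ' := mul_le_mul_of_nonneg_left hκ' hk0
  have hkΛ := mul_le_mul_of_nonneg_left hΛ hk10
  have hkΛ' := mul_le_mul_of_nonneg_left hΛ' hk10
  have hmain : k * ((k - 1) * (J * (2 * θ * a))) - (k - 1) * (k * (2 * J * (θ * (a * (1 - q)))))
      = 2 * (k * (k - 1) * (J * (θ * a) * q)) := by ring
  have hm3 : k * (k - 1) * (J * (θ * a) * q) ≤ 2 * k ^ 2 * θ ^ 3 := by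
    calc k * (k - 1) * (J * (θ * a) * q) ≤ k * k * (2 * θ * (θ * 1) * θ) := by
          gcongr
          linarith
      _ = _ := by ring
  have hm4 : 0 ≤ k * (k - 1) * (J * (θ * a) * q) := by
    positivity
  have hk3 : (k : ℝ) ^ 2 * θ ^ 3 ≤ k ^ 3 * θ ^ 3 := by
    gcongr
    · linarith
    · norm_num
  have e1 : (k : ℝ) * (24 * k ^ 2 * θ ^ 3) = 24 * (k ^ 3 * θ ^ 3) := by ring
  have e2 : ((k : ℝ) - 1) * (24 * k ^ 2 * θ ^ 3) ≤ 24 * (k ^ 3 * θ ^ 3) := by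
    have : 0 ≤ 24 * (k : ℝ) ^ 2 * θ ^ 3 := by positivity
    linarith
  have hk0' : 0 ≤ (k : ℝ) ^ 3 * θ ^ 3 := by positivity
  rw [mul_add, e1] at hkκ'
  rw [mul_add] at hkΛ'
  rw [abs_le]
  constructor <;> linarith

lemma log_bounds {τ σ : ℝ} (hτ : |τ - θ| ≤ 5 * k * θ ^ 2) (hσ : |σ - θ| ≤ 5 * k * θ ^ 2)
    (h : |k * τ - (k - 1) * σ - θ| ≤ 30 * k ^ 3 * θ ^ 3) :
    |k * Real.log (1 - τ) - (k - 1) * Real.log (1 - σ) + θ + θ ^ 2 / 2| ≤ 100 * k ^ 3 * θ ^ 3 := by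
  have hkge := hR.k_ge
  have hθ := hR.theta_pos
  obtain ⟨hs1, hs2⟩ := hR.k_theta_small
  have key {t : ℝ} (ht : |t - θ| ≤ 5 * k * θ ^ 2) :
      |t + t ^ 2 / 2 + Real.log (1 - t)| ≤ 16 * θ ^ 3 ∧ |t ^ 2 - θ ^ 2| ≤ 15 * k * θ ^ 3 := by
    rw [abs_le] at ht
    have h1 : 5 * k * θ ^ 2 ≤ θ / 2 := by nlinarith
    have h2 : |t| ≤ 3 / 2 * θ := by rw [abs_le]; constructor <;> linarith
    have h3 : θ ≤ 1 / 100 := by nlinarith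
    have h4 := Real.abs_log_sub_add_sum_range_le (x := t) (by linarith) 2
    simp only [Finset.sum_range_succ, Finset.sum_range_zero] at h4
    norm_num at h4
    constructor
    · refine h4.trans ?_
      rw [div_le_iff₀ (by linarith)]
      calc |t| ^ 3 ≤ (3 / 2 * θ) ^ 3 := by gcongr
        _ ≤ 16 * θ ^ 3 * (1 / 2) := by nlinarith [pow_pos hθ 3]
        _ ≤ _ := by
          gcongr
          linarith
    · rw [show t ^ 2 - θ ^ 2 = (t - θ) * (t + θ) by ring, abs_mul]
      have h5 : |t + θ| ≤ 3 * θ := by rw [abs_le]; constructor <;> linarith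
      calc |t - θ| * |t + θ| ≤ 5 * k * θ ^ 2 * (3 * θ) := by
            gcongr
            exact abs_le.2 ht
        _ = _ := by ring
  obtain ⟨a1, a2⟩ := key hτ
  obtain ⟨b1, b2⟩ := key hσ
  rw [abs_le] at a1 a2 b1 b2 h ⊢
  have hk3 : (k : ℝ) ^ 2 * θ ^ 3 ≤ k ^ 3 * θ ^ 3 := by
    gcongr
    · linarith
    · norm_num
  have hk2 : (k : ℝ) * θ ^ 3 ≤ k ^ 3 * θ ^ 3 := by
    refine mul_le_mul_of_nonneg_right ?_ (by positivity)
    nlinarith [sq_nonneg (k : ℝ)]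
  have hk0 : (0 : ℝ) ≤ k := by linarith
  have hk1 : (0 : ℝ) ≤ k - 1 := by linarith
  have c1 := mul_le_mul_of_nonneg_left a1.1 hk0
  have c2 := mul_le_mul_of_nonneg_left a1.2 hk0
  have c3 := mul_le_mul_of_nonneg_left b1.1 hk1
  have c4 := mul_le_mul_of_nonneg_left b1.2 hk1
  have d1 := mul_le_mul_of_nonneg_left a2.1 hk0
  have d2 := mul_le_mul_of_nonneg_left a2.2 hk0
  have d3 := mul_le_mul_of_nonneg_left b2.1 hk1
  have d4 := mul_le_mul_of_nonneg_left b2.2 hk1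
  have hp : 0 ≤ θ ^ 3 := by positivity
  have hp2 : 0 ≤ 15 * k * θ ^ 3 := by positivity
  constructor <;> nlinarith

end Regime

end Real

namespace Regime

variable {k N : ℕ} {θ : ℝ} (hR : Regime k N θ)
include hR

/-- The contribution of the unforced configurations at a variable. -/
lemma free_part_bounds {a b c e T K Yf l D : ℝ} (ha : 0 < a)
    (hb : b ≤ θ / 2 * (1 + 100 * (k ^ 2 * θ)) * a) (hb' : θ / 2 * (1 - 100 * (k ^ 2 * θ)) * a ≤ b)
    (hc : c * K = b) (hc0 : 0 ≤ c) (hK : 1 / 2 ≤ K) (he : e * T = a) (hT : 1 - 2 * θ ≤ T) (hT1 : T ≤ 1)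
    (hl : 1 ≤ l) (hl2 : l ≤ 2) (hD : D * θ ≤ k) (hY1 : l * b ≤ Yf)
    (hY2 : Yf ≤ l * (b + 18 * D * k * θ ^ 2 * c)) :
    ∃ u : ℝ, 2 * (a - b) + Yf = 2 * a * (1 + u) ∧ |u - (l / 2 - 1) * θ / 2| ≤ 125 * k ^ 2 * θ ^ 2 ∧
      |u| ≤ θ ∧ |Yf - l * θ / 4 * (2 * (a - b) + Yf)| ≤ 151 * k ^ 2 * θ ^ 2 * a ∧ c ≤ 2 * θ * a ∧
      |2 * (e - c) - (2 * (a - b) + Yf)| ≤ 20 * θ * a ∧ a ≤ 2 * (a - b) + Yf := by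
  have hkge := hR.k_ge
  have hθ := hR.theta_pos
  have hk0 : (0 : ℝ) ≤ k := Nat.cast_nonneg k
  obtain ⟨hs1, hs2⟩ := hR.k_theta_small
  have hθs : θ ≤ 1 / 10 ^ 6 := by linarith [hR.small_zero]
  have hsθ : θ ≤ k ^ 2 * θ := le_mul_of_one_le_left hθ.le (by nlinarith)
  have hs0 : 0 < (k : ℝ) ^ 2 * θ := by positivity
  have hYs : Yf ≤ l * (b + 36 * (k ^ 2 * θ) * b) := by
    refine hY2.trans (mul_le_mul_of_nonneg_left ?_ (by linarith))
    have h1 : c ≤ 2 * b := by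
      rw [← hc]
      have := mul_le_mul_of_nonneg_left hK hc0
      linarith
    have h2 : 18 * D * k * θ ^ 2 * c ≤ 36 * (k ^ 2 * θ) * b := by
      calc 18 * D * k * θ ^ 2 * c = 18 * (k * θ) * c * (D * θ) := by ring
        _ ≤ 18 * (k * θ) * c * k := mul_le_mul_of_nonneg_left hD (by positivity)
        _ = 18 * (k ^ 2 * θ) * c := by ring
        _ ≤ 18 * (k ^ 2 * θ) * (2 * b) := mul_le_mul_of_nonneg_left h1 (by positivity)
        _ = _ := by ring
    linarith
  have hc2 : c ≤ 2 * b := by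
    rw [← hc]
    have := mul_le_mul_of_nonneg_left hK hc0
    linarith
  obtain ⟨x, rfl⟩ : ∃ x, b = a * x := ⟨b / a, by field_simp⟩
  obtain ⟨y, rfl⟩ : ∃ y, Yf = a * y := ⟨Yf / a, by field_simp⟩
  obtain ⟨z, rfl⟩ : ∃ z, c = a * z := ⟨c / a, by field_simp⟩
  obtain ⟨w, rfl⟩ : ∃ w, e = a * w := ⟨e / a, by field_simp⟩
  replace hb : x ≤ θ / 2 * (1 + 100 * (k ^ 2 * θ)) := le_of_mul_le_mul_left (by linarith) ha
  replace hb' : θ / 2 * (1 - 100 * (k ^ 2 * θ)) ≤ x := le_of_mul_le_mul_left (by linarith) ha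
  replace hY1 : l * x ≤ y := le_of_mul_le_mul_left (by linarith) ha
  replace hYs : y ≤ l * (x + 36 * (k ^ 2 * θ) * x) := le_of_mul_le_mul_left (by linarith) ha
  replace hc2 : z ≤ 2 * x := le_of_mul_le_mul_left (by linarith) ha
  replace hc0 : 0 ≤ z := le_of_mul_le_mul_left (by linarith) ha
  replace he : w * T = 1 := mul_left_cancel₀ ha.ne' (by linarith)
  rw [show 125 * (k : ℝ) ^ 2 * θ ^ 2 = 125 * (k ^ 2 * θ * θ) by ring,
    show 151 * (k : ℝ) ^ 2 * θ ^ 2 * a = a * (151 * (k ^ 2 * θ * θ)) by ring,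
    show 2 * (a - a * x) + a * y = 2 * a * (1 + (y / 2 - x)) by ring]
  clear hY2 hD hK hc hR hkge hs1
  generalize (k : ℝ) ^ 2 * θ = s at *
  have hsθ2 : s * θ ≤ θ / 10 ^ 6 := by
    have := mul_le_mul_of_nonneg_right hs2 hθ.le
    linarith
  have hθθ : θ * θ ≤ s * θ := mul_le_mul_of_nonneg_right hsθ hθ.le
  have hsθ0 : 0 < s * θ := mul_pos hs0 hθ
  have hx1 : x ≤ θ / 2 + 50 * (s * θ) := by linarith
  have hx2 : θ / 2 - 50 * (s * θ) ≤ x := by linarith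
  have hx0 : 0 ≤ x := by linarith
  have hl0 : 0 ≤ l := by linarith
  have hy1 : y ≤ l * θ / 2 + 137 * (s * θ) := by
    have h1 : l * (x - θ / 2) ≤ 2 * (50 * (s * θ)) :=
      (mul_le_mul_of_nonneg_left (by linarith) hl0).trans
        (mul_le_mul_of_nonneg_right hl2 (by positivity))
    have h2 : l * (36 * s * x) ≤ 2 * (36 * s * (51 / 100 * θ)) := by
      gcongr
      linarith
    linarith
  have hy2 : l * θ / 2 - 100 * (s * θ) ≤ y := by
    have h1 : l * (θ / 2 - x) ≤ 2 * (50 * (s * θ)) :=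
      (mul_le_mul_of_nonneg_left (by linarith) hl0).trans
        (mul_le_mul_of_nonneg_right hl2 (by positivity))
    linarith
  have hlθ1 : l * θ ≤ 2 * θ := mul_le_mul_of_nonneg_right hl2 hθ.le
  have hlθ2 : 1 * θ ≤ l * θ := mul_le_mul_of_nonneg_right hl hθ.le
  have hu : |y / 2 - x| ≤ θ := by
    rw [abs_le]
    constructor <;> linarith
  have hw0 : 1 ≤ w := by
    have hT0 : 0 < T := by linarith
    by_contra hw
    push Not at hw
    nlinarith
  have hw1 : w ≤ 1 + 3 * θ := by
    have h1 : w * (1 - 2 * θ) ≤ 1 := (mul_le_mul_of_nonneg_left hT (by linarith)).trans he.le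
    by_contra hw
    push Not at hw
    nlinarith
  refine ⟨y / 2 - x, rfl, ?_, hu, ?_, ?_, ?_, ?_⟩
  · rw [abs_le]
    constructor <;> linarith
  · rw [show a * y - l * θ / 4 * (2 * a * (1 + (y / 2 - x)))
      = a * (y - l * θ / 2 - l * θ / 2 * (y / 2 - x)) by ring, abs_mul, abs_of_pos ha]
    refine mul_le_mul_of_nonneg_left ?_ ha.le
    have h1 : |l * θ / 2 * (y / 2 - x)| ≤ s * θ := by
      rw [abs_mul, abs_of_nonneg (by positivity)]
      calc l * θ / 2 * |y / 2 - x| ≤ θ * θ := by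
            gcongr
            linarith
        _ ≤ _ := hθθ
    rw [abs_le] at h1 ⊢
    constructor <;> linarith [h1.1, h1.2]
  · have : a * z ≤ a * (2 * θ) := mul_le_mul_of_nonneg_left (by linarith) ha.le
    linarith
  · rw [show 2 * (a * w - a * z) - 2 * a * (1 + (y / 2 - x))
      = a * (2 * (w - z) - 2 * (1 + (y / 2 - x))) by ring, abs_mul, abs_of_pos ha,
      show 20 * θ * a = a * (20 * θ) by ring]
    refine mul_le_mul_of_nonneg_left ?_ ha.le
    rw [abs_le] at hu ⊢
    constructor <;> linarith [hu.1, hu.2]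
  · rw [abs_le] at hu
    have : a * (1 / 2) ≤ a * (1 + (y / 2 - x)) := mul_le_mul_of_nonneg_left (by linarith [hu.1]) ha.le
    linarith

end Regime

lemma abs_log_one_add_sub_le {u : ℝ} (hu : |u| ≤ 1 / 2) : |Real.log (1 + u) - u| ≤ 2 * u ^ 2 := by
  have h := Real.abs_log_sub_add_sum_range_le (x := -u) (by rw [abs_neg]; linarith) 1
  simp only [Finset.sum_range_succ, Finset.sum_range_zero, abs_neg, sub_neg_eq_add] at h
  norm_num at h
  rw [show Real.log (1 + u) - u = -u + Real.log (1 + u) by ring]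
  refine h.trans ?_
  rw [div_le_iff₀ (by linarith)]
  nlinarith [sq_nonneg u]

/-- The constant in the first order term of the complexity. -/
noncomputable def shift (lam : ℝ) : ℝ :=
  (Real.log 2 + 1 - 2 ^ lam / 2 + lam * (2 ^ lam / 2) * Real.log 2) / 2

namespace Regime

variable {k N : ℕ} {θ : ℝ} (hR : Regime k N θ)
include hR

lemma entropy_estimate {α D κ Λ σ Yf E R l Y c e a : ℝ} (hα0 : 0 ≤ α) (hα : α * θ ≤ Real.log 2)
    (hlog0 : 0 < Real.log 2) (hlog1 : Real.log 2 ≤ 1) (hD0 : 0 ≤ D) (hDθ : D * θ ≤ k)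
    (hκ0 : 0 ≤ κ) (hκ : κ ≤ 5 * k * θ ^ 2) (hΛ0 : 0 ≤ Λ) (hΛ : Λ ≤ 5 * k * θ ^ 2)
    (hκΛ : |k * κ - (k - 1) * Λ| ≤ 30 * k ^ 3 * θ ^ 3)
    (hZ : 1 / 2 ≤ 1 - σ) (hσ0 : 0 ≤ σ) (hσ1 : σ ≤ 3 / 2 * θ) (hE0 : 0 ≤ E) (hE : E ≤ θ ^ 3)
    (hR0 : 0 ≤ R) (hR1 : R ≤ 36 * D * k * θ ^ 2 * c)
    (hY0 : 0 < Y) (haY : a ≤ Y) (hc0 : 0 ≤ c) (hc : c ≤ 2 * θ * a)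
    (hYf : |Yf - l * θ / 4 * Y| ≤ 151 * k ^ 2 * θ ^ 2 * a)
    (hec : |2 * (e - c) - Y| ≤ 20 * θ * a) :
    |Real.log 2 * (Yf / Y) - D * (E / (1 - σ)) - R / Y
        - α * (k * κ * (2 * (e - c) / Y) - (k - 1) * Λ * (1 / (1 - σ)))
        - Real.log 2 * (l * θ / 4)| ≤ 400 * k ^ 3 * θ ^ 2 := by
  have hkge := hR.k_ge
  have hθ := hR.theta_pos
  have hk0 : (0 : ℝ) ≤ k := Nat.cast_nonneg k
  have hZ0 : 0 < 1 - σ := by linarith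
  have hYfY : |Yf / Y - l * θ / 4| ≤ 151 * k ^ 2 * θ ^ 2 := by
    rw [div_sub' hY0.ne', abs_div, abs_of_pos hY0, div_le_iff₀ hY0, mul_comm Y]
    exact hYf.trans (mul_le_mul_of_nonneg_left haY (by positivity))
  have hEZ : D * (E / (1 - σ)) ≤ 2 * k * θ ^ 2 := by
    have h1 : E / (1 - σ) ≤ 2 * θ ^ 3 := by
      rw [div_le_iff₀ hZ0]
      have := mul_le_mul_of_nonneg_left hZ (show 0 ≤ 2 * θ ^ 3 by positivity)
      linarith
    calc D * (E / (1 - σ)) ≤ D * (2 * θ ^ 3) := mul_le_mul_of_nonneg_left h1 hD0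
      _ = 2 * θ ^ 2 * (D * θ) := by ring
      _ ≤ 2 * θ ^ 2 * k := mul_le_mul_of_nonneg_left hDθ (by positivity)
      _ = _ := by ring
  have hEZ0 : 0 ≤ D * (E / (1 - σ)) := by
    positivity
  have hRY : R / Y ≤ 72 * k ^ 2 * θ ^ 2 := by
    rw [div_le_iff₀ hY0]
    calc R ≤ 36 * (D * θ) * k * θ * c := hR1.trans_eq (by ring)
      _ ≤ 36 * k * k * θ * (2 * θ * a) := by gcongr
      _ = 72 * k ^ 2 * θ ^ 2 * a := by ring
      _ ≤ _ := mul_le_mul_of_nonneg_left haY (by positivity)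
  have hRY0 : 0 ≤ R / Y := by positivity
  have hρ : |2 * (e - c) / Y - 1| ≤ 20 * θ := by
    rw [div_sub_one hY0.ne', abs_div, abs_of_pos hY0, div_le_iff₀ hY0]
    exact hec.trans (mul_le_mul_of_nonneg_left haY (by positivity))
  have hζ : |1 / (1 - σ) - 1| ≤ 3 * θ := by
    rw [div_sub_one hZ0.ne', abs_div, abs_of_pos hZ0, div_le_iff₀ hZ0, sub_sub_cancel,
      abs_of_nonneg (by linarith)]
    have := mul_le_mul_of_nonneg_left hZ hθ.le
    linarith
  have hmsg : |α * (k * κ * (2 * (e - c) / Y) - (k - 1) * Λ * (1 / (1 - σ)))| ≤ 145 * k ^ 3 * θ ^ 2 := by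
    have h1 : |k * κ * (2 * (e - c) / Y) - (k - 1) * Λ * (1 / (1 - σ))| ≤ 145 * k ^ 3 * θ ^ 3 := by
      have e1 : k * κ * (2 * (e - c) / Y) - (k - 1) * Λ * (1 / (1 - σ))
          = (k * κ - (k - 1) * Λ) + k * κ * (2 * (e - c) / Y - 1)
            - (k - 1) * Λ * (1 / (1 - σ) - 1) := by ring
      have h2 : |k * κ * (2 * (e - c) / Y - 1)| ≤ 100 * k ^ 2 * θ ^ 3 := by
        rw [abs_mul, abs_of_nonneg (by positivity)]
        calc k * κ * |2 * (e - c) / Y - 1| ≤ k * (5 * k * θ ^ 2) * (20 * θ) := by gcongr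
          _ = _ := by ring
      have h3 : |(k - 1) * Λ * (1 / (1 - σ) - 1)| ≤ 15 * k ^ 2 * θ ^ 3 := by
        have hk1 : (0 : ℝ) ≤ k - 1 := by linarith
        rw [abs_mul, abs_of_nonneg (by positivity)]
        calc (k - 1) * Λ * |1 / (1 - σ) - 1| ≤ k * (5 * k * θ ^ 2) * (3 * θ) := by
              gcongr
              linarith
          _ = _ := by ring
      have hk3 : (k : ℝ) ^ 2 * θ ^ 3 ≤ k ^ 3 * θ ^ 3 := by
        gcongr
        · linarith
        · norm_num
      rw [e1]
      rw [abs_le] at h2 h3 hκΛ ⊢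
      constructor <;> linarith [h2.1, h2.2, h3.1, h3.2, hκΛ.1, hκΛ.2]
    rw [abs_mul, abs_of_nonneg hα0]
    calc α * |k * κ * (2 * (e - c) / Y) - (k - 1) * Λ * (1 / (1 - σ))| ≤ α * (145 * k ^ 3 * θ ^ 3) :=
          mul_le_mul_of_nonneg_left h1 hα0
      _ = 145 * k ^ 3 * θ ^ 2 * (α * θ) := by ring
      _ ≤ 145 * k ^ 3 * θ ^ 2 * 1 := mul_le_mul_of_nonneg_left (by linarith) (by positivity)
      _ = _ := mul_one _
  clear hYf hec hR1 hκΛ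
  generalize α * (k * κ * (2 * (e - c) / Y) - (k - 1) * Λ * (1 / (1 - σ))) = x4 at *
  generalize D * (E / (1 - σ)) = x5 at *
  generalize R / Y = x6 at *
  rw [show Real.log 2 * (Yf / Y) - x5 - x6 - x4 - Real.log 2 * (l * θ / 4)
    = Real.log 2 * (Yf / Y - l * θ / 4) - x5 - x6 - x4 by ring]
  have h1 : |Real.log 2 * (Yf / Y - l * θ / 4)| ≤ 151 * k ^ 2 * θ ^ 2 := by
    rw [abs_mul, abs_of_pos hlog0]
    exact (mul_le_of_le_one_left (abs_nonneg _) hlog1).trans hYfY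
  have hk3 : (k : ℝ) ^ 2 * θ ^ 2 ≤ k ^ 3 * θ ^ 2 := by
    gcongr
    · linarith
    · norm_num
  have hk2 : (k : ℝ) * θ ^ 2 ≤ k ^ 3 * θ ^ 2 := by
    refine mul_le_mul_of_nonneg_right ?_ (by positivity)
    exact le_self_pow₀ (by linarith) (by norm_num)
  rw [abs_le] at h1 hmsg ⊢
  constructor <;> linarith [h1.1, h1.2, hmsg.1, hmsg.2]

lemma complexity_estimate {α lam D T K κ Λ τ σ V Yf C E R : ℝ} (hl : 0 ≤ lam) (hl1 : lam ≤ 1)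
    (hα0 : 0 ≤ α) (hα : α * θ ≤ Real.log 2) (hα' : Real.log 2 - 4 * θ ≤ α * θ) (hD : D = k * α)
    (hDN : D = N + 1) (hTτ : T = 1 - τ)
    (hτ : |τ - θ| ≤ 5 * k * θ ^ 2) (hσ : |σ - θ| ≤ 5 * k * θ ^ 2)
    (hτσ : |k * τ - (k - 1) * σ - θ| ≤ 30 * k ^ 3 * θ ^ 3)
    (hκ0 : 0 ≤ κ) (hκ : κ ≤ 5 * k * θ ^ 2) (hΛ0 : 0 ≤ Λ) (hΛ : Λ ≤ 5 * k * θ ^ 2)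
    (hκΛ : |k * κ - (k - 1) * Λ| ≤ 30 * k ^ 3 * θ ^ 3)
    (hK : 1 / 2 ≤ K) (hT1 : T ≤ 1) (hKT : K ≤ T)
    (hb : K ^ (N + 1) ≤ θ / 2 * (1 + 100 * (k ^ 2 * θ)) * T ^ (N + 1))
    (hb' : θ / 2 * (1 - 100 * (k ^ 2 * θ)) * T ^ (N + 1) ≤ K ^ (N + 1))
    (hE0 : 0 ≤ E) (hE : E ≤ θ ^ 3) (hR0 : 0 ≤ R) (hR1 : R ≤ 36 * (N + 1) * k * θ ^ 2 * K ^ N)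
    (hY1 : 2 ^ lam * K ^ (N + 1) ≤ Yf)
    (hY2 : Yf ≤ 2 ^ lam * (K ^ (N + 1) + 18 * (N + 1) * k * θ ^ 2 * K ^ N))
    (hV : V + Real.log 2 * Yf
      = (N + 1) * ((2 * (T ^ (N + 1) - K ^ (N + 1)) + Yf) * ((C + E) / (1 - σ)))
        + 2 * ((N + 1) * (κ * (T ^ N - K ^ N))) + R) :
    |Real.log (2 * (T ^ (N + 1) - K ^ (N + 1)) + Yf) - (k - 1) * α * Real.log (1 - σ)
      - lam * (-(V / (2 * (T ^ (N + 1) - K ^ (N + 1)) + Yf)) - α * (Λ / (1 - σ))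
        + D * ((Λ + C) / (1 - σ)))
      - (Real.log 2 - α * θ - θ * shift lam)| ≤ k ^ 6 * θ ^ 2 := by
  have hkge := hR.k_ge
  have hθ := hR.theta_pos
  have hk0 : (0 : ℝ) ≤ k := Nat.cast_nonneg k
  obtain ⟨hs1, hs2⟩ := hR.k_theta_small
  have hθs : θ ≤ 1 / 10 ^ 6 := by linarith [hR.small_zero]
  have hl2 : (1 : ℝ) ≤ 2 ^ lam := Real.one_le_rpow one_le_two hl
  have hl2' : (2 : ℝ) ^ lam ≤ 2 := by
    calc (2 : ℝ) ^ lam ≤ 2 ^ (1 : ℝ) := Real.rpow_le_rpow_of_exponent_le one_le_two hl1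
      _ = 2 := Real.rpow_one 2
  have hlog0 : 0 < Real.log 2 := Real.log_pos one_lt_two
  have hlog1 : Real.log 2 ≤ 1 := by linarith [Real.log_two_lt_d9]
  have hkk : 5 * k * θ ^ 2 ≤ θ / 2 := by nlinarith
  have hσ' := abs_le.1 hσ
  have hτ' := abs_le.1 hτ
  have hDθ : D * θ ≤ k := by
    rw [hD, mul_assoc]
    exact mul_le_of_le_one_right hk0 (hα.trans hlog1)
  have hT0 : 0 < T := by linarith
  have ha : 0 < T ^ (N + 1) := pow_pos hT0 _
  have hZ : 1 / 2 ≤ 1 - σ := by linarith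
  rw [← hDN] at hY2 hR1 hV
  obtain ⟨u, hu1, hu2, hu3, hYf, hc, hec, haY⟩ := hR.free_part_bounds ha hb hb' (pow_succ K N).symm
    (pow_nonneg (by linarith) N) hK (pow_succ T N).symm (by linarith) hT1 hl2 hl2' hDθ hY1 hY2
  have hlogT : Real.log (T ^ (N + 1)) = D * Real.log (1 - τ) := by
    rw [Real.log_pow, ← hTτ, hDN]
    push_cast
    rfl
  have hu3' := abs_le.1 hu3
  have hlogY : Real.log (2 * (T ^ (N + 1) - K ^ (N + 1)) + Yf)
      = D * Real.log (1 - τ) + Real.log 2 + Real.log (1 + u) := by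
    rw [hu1, Real.log_mul (by positivity) (by linarith), Real.log_mul two_ne_zero ha.ne', hlogT]
    ring
  rw [hlogY]
  unfold shift
  generalize 2 * (T ^ (N + 1) - K ^ (N + 1)) + Yf = Y at *
  generalize K ^ (N + 1) = b' at *
  generalize T ^ (N + 1) = a at *
  have hc0 : 0 ≤ K ^ N := pow_nonneg (by linarith) N
  generalize K ^ N = c at *
  generalize T ^ N = e at *
  generalize (2 : ℝ) ^ lam = l at *
  have hY0 : 0 < Y := by linarith
  have hZ0 : 0 < 1 - σ := by linarith
  -- the entropy
  have hs : -(V / Y) - α * (Λ / (1 - σ)) + D * ((Λ + C) / (1 - σ))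
      = Real.log 2 * (Yf / Y) - D * (E / (1 - σ)) - R / Y
        - α * (k * κ * (2 * (e - c) / Y) - (k - 1) * Λ * (1 / (1 - σ))) := by
    have : V = D * (Y * ((C + E) / (1 - σ))) + 2 * (D * (κ * (e - c))) + R - Real.log 2 * Yf := by linarith
    rw [this, hD]
    field_simp
    ring
  have hX1 : |α * (k * Real.log (1 - τ) - (k - 1) * Real.log (1 - σ) + θ + θ ^ 2 / 2)|
      ≤ 100 * k ^ 3 * θ ^ 2 := by
    rw [abs_mul, abs_of_nonneg hα0]
    calc _ ≤ α * (100 * k ^ 3 * θ ^ 3) :=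
          mul_le_mul_of_nonneg_left (hR.log_bounds hτ hσ hτσ) hα0
      _ = 100 * k ^ 3 * θ ^ 2 * (α * θ) := by ring
      _ ≤ 100 * k ^ 3 * θ ^ 2 * 1 := mul_le_mul_of_nonneg_left (by linarith) (by positivity)
      _ = _ := mul_one _
  have hX2 : |θ / 2 * (Real.log 2 - α * θ)| ≤ 2 * θ ^ 2 := by
    rw [abs_mul, abs_of_pos (by positivity), abs_of_nonneg (by linarith)]
    have := mul_le_mul_of_nonneg_left (show Real.log 2 - α * θ ≤ 4 * θ by linarith) (half_pos hθ).le
    linarith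
  have hX3 := abs_log_one_add_sub_le (show |u| ≤ 1 / 2 by linarith)
  have hu4 : u ^ 2 ≤ θ ^ 2 := sq_le_sq' hu3'.1 hu3'.2
  have hX4 := hR.entropy_estimate hα0 hα hlog0 hlog1 (by rw [hD]; positivity) hDθ hκ0 hκ hΛ0 hΛ hκΛ hZ
    (by linarith) (by linarith) hE0 hE hR0 hR1 hY0 haY hc0 hc hYf hec
  rw [← hs] at hX4
  clear hlogY hV hYf hec hu1 hlogT hY1 hY2 hb hb' hR1 hs hκΛ hτσ
  generalize -(V / Y) - α * (Λ / (1 - σ)) + D * ((Λ + C) / (1 - σ)) = S at *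
  have hlX4 : |lam * (S - Real.log 2 * (l * θ / 4))| ≤ 400 * k ^ 3 * θ ^ 2 := by
    rw [abs_mul, abs_of_nonneg hl]
    exact (mul_le_of_le_one_left (abs_nonneg _) hl1).trans hX4
  have hfinal : 1000 * (k : ℝ) ^ 3 * θ ^ 2 ≤ k ^ 6 * θ ^ 2 := by
    refine mul_le_mul_of_nonneg_right ?_ (by positivity)
    have : (1000 : ℝ) ≤ k ^ 3 := by
      calc (1000 : ℝ) ≤ 100 ^ 3 := by norm_num
        _ ≤ _ := by gcongr
    calc 1000 * (k : ℝ) ^ 3 ≤ k ^ 3 * k ^ 3 := by gcongr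
      _ = _ := by ring
  have hk3 : (k : ℝ) ^ 2 * θ ^ 2 ≤ k ^ 3 * θ ^ 2 := by
    gcongr
    · linarith
    · norm_num
  have hk1 : θ ^ 2 ≤ k ^ 3 * θ ^ 2 := le_mul_of_one_le_left (by positivity) (one_le_pow₀ (by linarith))
  have hident : D * Real.log (1 - τ) + Real.log 2 + Real.log (1 + u) - (k - 1) * α * Real.log (1 - σ)
      - lam * S
      - (Real.log 2 - α * θ - θ * ((Real.log 2 + 1 - l / 2 + lam * (l / 2) * Real.log 2) / 2))
      = α * (k * Real.log (1 - τ) - (k - 1) * Real.log (1 - σ) + θ + θ ^ 2 / 2)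
        + θ / 2 * (Real.log 2 - α * θ) + (Real.log (1 + u) - u) + (u - (l / 2 - 1) * θ / 2)
        - lam * (S - Real.log 2 * (l * θ / 4)) := by
    rw [hD]
    ring
  rw [hident]
  rw [abs_le] at hX1 hX2 hX3 hu2 hlX4 ⊢
  constructor <;> linarith [hX1.1, hX1.2, hX2.1, hX2.2, hX3.1, hX3.2, hu2.1, hu2.2, hlX4.1, hlX4.2]

end Regime

section TiltedLog

variable {Ω : Type*} [MeasurableSpace Ω] {ν : Measure Ω} {lam : ℝ} {g : Ω → ℝ}

/-- The facts about a law tilted by its own variable, with values in `[0, 1]`. -/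
lemma tiltedLaw_log (hg : Measurable g) (hg01 : ∀ᵐ ω ∂ν, g ω ∈ Icc (0 : ℝ) 1) {Z V : ℝ}
    (hZ : tiltedMass ν lam g = ENNReal.ofReal Z) (hZ0 : 0 < Z)
    (hV : ∫⁻ ω, weight lam (g ω) * ENNReal.ofReal (-Real.log (g ω)) ∂ν = ENNReal.ofReal V)
    (hV0 : 0 ≤ V) :
    IsProbabilityMeasure (tiltedLaw ν lam g g) ∧ Integrable Real.log (tiltedLaw ν lam g g) ∧
      ∫ x, Real.log x ∂tiltedLaw ν lam g g = -(V / Z) := by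
  have h0 : tiltedMass ν lam g ≠ 0 := by rw [hZ]; exact (ENNReal.ofReal_pos.2 hZ0).ne'
  have h1 : tiltedMass ν lam g ≠ ∞ := by rw [hZ]; exact ENNReal.ofReal_ne_top
  refine ⟨isProbabilityMeasure_tiltedLaw hg h0 h1, ?_, ?_⟩
  · rw [integrable_tiltedLaw_iff hg hg h0 h1 Real.measurable_log]
    have : ∫⁻ ω, weight lam (g ω) * ‖Real.log (g ω)‖ₑ ∂ν
        = ∫⁻ ω, weight lam (g ω) * ENNReal.ofReal (-Real.log (g ω)) ∂ν := by
      refine lintegral_congr_ae ?_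
      filter_upwards [hg01] with ω hω
      rw [Real.enorm_eq_ofReal_abs, abs_of_nonpos (Real.log_nonpos hω.1 hω.2)]
    rw [this, hV]
    exact ENNReal.ofReal_ne_top
  · rw [integral_tiltedLaw_of_nonpos hg hg h0 Real.measurable_log, hV, hZ,
      ENNReal.toReal_ofReal hV0, ENNReal.toReal_ofReal hZ0.le]
    filter_upwards [hg01] with ω hω _ using Real.log_nonpos hω.1 hω.2

end TiltedLog

section Formulas

variable {k d : ℕ} {θ lam : ℝ} (hR : Regime k (d - 1) θ) (hl : 0 ≤ lam) (hl1 : lam ≤ 1)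
include hR hl hl1

/-- The expressions for the variable, clause and edge laws through the unnormalized clause law. -/
lemma wellDefined_and_integrals {Y V Z Λ C : ℝ}
    (hY : tiltedMass (power d (clauseRaw (k - 1) lam (varLaw k d lam))) lam agree = ENNReal.ofReal Y)
    (hY0 : 0 < Y)
    (hV : ∫⁻ y, weight lam (agree y) * ENNReal.ofReal (-Real.log (agree y))
      ∂power d (clauseRaw (k - 1) lam (varLaw k d lam)) = ENNReal.ofReal V) (hV0 : 0 ≤ V)
    (hZ : tiltedMass (power k (varLaw k d lam)) lam (fun x => 1 - agree x) = ENNReal.ofReal Z)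
    (hZ0 : 0 < Z)
    (hΛ : ∫⁻ x, weight lam (1 - agree x) * ENNReal.ofReal (-Real.log (1 - agree x))
      ∂power k (varLaw k d lam) = ENNReal.ofReal Λ) (hΛ0 : 0 ≤ Λ)
    (hC : cavityLog (k - 1) lam (varLaw k d lam) = ENNReal.ofReal C) (hC0 : 0 ≤ C) :
    WellDefined k d lam ∧
    ∫ x, Real.log x ∂varW k d lam = -(V / Y) ∧
    ∫ x, Real.log x ∂clauseW k d lam = -(Λ / Z) ∧
    ∫ x, Real.log x ∂edgeW k d lam = -((Λ + C) / Z) ∧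
    Real.log (varZ k d lam).toReal - d * Real.log (edgeZ k d lam).toReal
      = Real.log Y - d * Real.log Z ∧
    (clauseZ k d lam).toReal = Z := by
  have hk := hR.large
  have hg := good_varLaw (d := d) hR hl hl1
  have hprob := hg.prob
  have hn : 0 < k - 1 := by omega
  have hd : 0 < d := by have := hR.N_pos; omega
  have hM0 := clauseMass_ne_zero hn hg.balanced hl
  have hM1 := clauseMass_ne_top hn hg.balanced hl hl1
  have hfin := isFiniteMeasure_clauseRaw hn hg.balanced hl hl1
  have hbal := balanced_clauseRaw (lam := lam) hn hg.balanced
  set μ := varLaw k d lam with hμ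
  set m := clauseRaw (k - 1) lam μ with hm
  set M := clauseMass (k - 1) lam μ with hM
  have hi0 : M⁻¹ ≠ 0 := ENNReal.inv_ne_zero.2 hM1
  have hi1 : M⁻¹ ≠ ∞ := ENNReal.inv_ne_top.2 hM0
  have hlaw : clauseLaw k d lam = M⁻¹ • m := clauseRec_eq k lam μ
  have hvarW : varW k d lam = tiltedLaw (power d m) lam agree agree := by
    unfold varW
    rw [hlaw, power_smul hi1]
    exact tiltedLaw_smul (pow_ne_zero _ hi0) (ENNReal.pow_ne_top hi1)
  have hedgeW : edgeW k d lam = tiltedLaw (μ.prod m) lam edgeAgree edgeAgree := by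
    unfold edgeW
    rw [hlaw, prod_smul_right hi1]
    exact tiltedLaw_smul hi0 hi1
  have hvarZ : varZ k d lam = M⁻¹ ^ d * ENNReal.ofReal Y := by
    unfold varZ
    rw [hlaw, power_smul hi1, tiltedMass_smul, hY]
  have hmassE : tiltedMass (μ.prod m) lam edgeAgree = ENNReal.ofReal Z := by
    rw [tiltedMass_edge (by omega) hg.balanced hl hl1, hZ]
  have hedgeZ : edgeZ k d lam = M⁻¹ * ENNReal.ofReal Z := by
    unfold edgeZ
    rw [hlaw, prod_smul_right hi1, tiltedMass_smul, hmassE]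
  have hlogE : ∫⁻ p, weight lam (edgeAgree p) * ENNReal.ofReal (-Real.log (edgeAgree p)) ∂μ.prod m
      = ENNReal.ofReal (Λ + C) := by
    rw [tiltedMass_edge_log (by omega) hg.balanced hl hl1, hΛ, hC, ENNReal.ofReal_add hΛ0 hC0]
  have hae : ∀ᵐ p ∂μ.prod m, edgeAgree p ∈ Icc (0 : ℝ) 1 := by
    have h1 : ∀ᵐ p ∂μ.prod m, p.1 ∈ Icc (0 : ℝ) 1 := Measure.quasiMeasurePreserving_fst.ae hg.balanced.supp
    have h2 : ∀ᵐ p ∂μ.prod m, p.2 ∈ Icc (0 : ℝ) 1 := Measure.quasiMeasurePreserving_snd.ae hbal.supp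
    filter_upwards [h1, h2] with p hp1 hp2 using edgeAgree_mem hp1 hp2
  obtain ⟨v1, v2, v3⟩ := tiltedLaw_log (ν := power d m) (lam := lam) measurable_agree
    (by filter_upwards [hbal.ae_power (n := d)] with y hy using ⟨agree_nonneg hy, agree_le_one hd hy⟩)
    hY hY0 hV hV0
  obtain ⟨c1, c2, c3⟩ := tiltedLaw_log (ν := power k μ) (lam := lam)
    (g := fun x => 1 - agree x) (by fun_prop)
    (by
      filter_upwards [hg.balanced.ae_power (n := k)] with y hy
      exact ⟨by linarith [agree_le_one (by omega) hy], by linarith [agree_nonneg hy]⟩)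
    hZ hZ0 hΛ hΛ0
  obtain ⟨e1, e2, e3⟩ := tiltedLaw_log (ν := μ.prod m) (lam := lam) measurable_edgeAgree hae hmassE hZ0
    hlogE (add_nonneg hΛ0 hC0)
  refine ⟨⟨fun l => (good_iterLaw hR hl hl1 l).prob, hprob, tendsto_atomDist hR hl hl1, ?_, ?_, c1,
    ?_, ?_, c2, ?_⟩, ?_, c3, ?_, ?_, ?_⟩
  · rw [hlaw]
    exact ⟨by rw [Measure.smul_apply, clauseMass_eq_univ, smul_eq_mul, ENNReal.inv_mul_cancel hM0 hM1]⟩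
  · rwa [hvarW]
  · rwa [hedgeW]
  · rwa [hvarW]
  · rwa [hedgeW]
  · rwa [hvarW]
  · rwa [hedgeW]
  · have h1 : 0 < (M⁻¹).toReal := ENNReal.toReal_pos hi0 hi1
    rw [hvarZ, hedgeZ, ENNReal.toReal_mul, ENNReal.toReal_mul, ENNReal.toReal_pow,
      ENNReal.toReal_ofReal hY0.le, ENNReal.toReal_ofReal hZ0.le,
      Real.log_mul (pow_pos h1 _).ne' hY0.ne', Real.log_mul h1.ne' hZ0.ne', Real.log_pow]
    ring
  · unfold clauseZ
    rw [hZ, ENNReal.toReal_ofReal hZ0.le]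

/-- The expansion of the complexity. -/
theorem wellDefined_and_complexity {α : ℝ} (hd : deg k α = d) (hdα : (d : ℝ) = k * α) (hα0 : 0 ≤ α)
    (hα : α * θ ≤ Real.log 2) (hα' : Real.log 2 - 4 * θ ≤ α * θ) (hRd : Regime k d θ) :
    WellDefined k d lam ∧
      |complexity k lam α - (Real.log 2 - α * θ - θ * shift lam)| ≤ k ^ 6 * θ ^ 2 := by
  have hd0 : 0 < d := by have := hR.N_pos; omega
  obtain ⟨N, rfl⟩ : ∃ N, d = N + 1 := ⟨d - 1, by omega⟩
  have hRN : Regime k N θ := hR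
  have hg := good_varLaw (d := N + 1) hR hl hl1
  have hfix : NAESat.step k N lam (varLaw k (N + 1) lam) = varLaw k (N + 1) lam :=
    step_varLaw (d := N + 1) hR hl hl1
  have hprob := hg.prob
  have hθ := hRN.theta_pos
  have hq0 : 0 ≤ (varLaw k (N + 1) lam).real (Ioo 0 1) := measureReal_nonneg
  have hq1 := hg.free_real hθ.le
  obtain ⟨J, τ, σ, hJ0, hJ1, hall, hτ0, hmass, hσ0, m1, m2, m3, m4⟩ := hg.expansion_mass hRN hl
  obtain ⟨J', κ, Λ, hJ0', hJ1', hκ0, hΛ0, hκ, hΛ, n1, n2, n3, n4⟩ := hg.expansion_entropy hRN hl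
  rw [hg.balanced.real_atom] at m1 m2 m3 m4 n1 n2 n3 n4
  obtain ⟨p1, p2, p3⟩ := hRN.mass_bounds hq0 hq1 hJ0 hJ1 m1 m2 m3 m4
  obtain ⟨r1, r2, r3⟩ := hRN.entropy_bounds hq0 hq1 hJ0' hJ1' n1 n2 n3 n4
  obtain ⟨b, T, K, hB⟩ := hg.messageBounds hRN hl hl1
  obtain ⟨hs1, hs2⟩ := hRN.k_theta_small
  have hkge := hRN.k_ge
  have hkθ : 5 * k * θ ^ 2 ≤ θ := by nlinarith
  have hθs : θ ≤ 1 / 10 ^ 6 := by nlinarith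
  have hσ1 : 0 < 1 - σ := by linarith [abs_le.1 p2]
  have hK := hB.K_ge hRN
  have hKT := hB.K_le_T hRN
  have hTτ : T = 1 - τ := by
    rw [← ENNReal.ofReal_eq_ofReal_iff (by linarith) (by linarith [abs_le.1 p1]), ← hB.all_eq, hall]
  obtain ⟨V, Yf, C, E, R, hV0, hYf0, hC0, hE0, hE, hR0, hR1, hY1, hY2, hYpos, hY, hV, hC, hid⟩ :=
    hg.variable_entropy hRN hl hl1 hfix hB hκ hκ0 hmass hσ1
  obtain ⟨hW, i1, i2, i3, i4, i5⟩ := wellDefined_and_integrals hR hl hl1 hY hYpos hV hV0 hmass hσ1 hΛ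
    hΛ0 hC hC0
  refine ⟨hW, ?_⟩
  have key := hRN.complexity_estimate (α := α) (D := (N + 1 : ℕ)) hl hl1 hα0 hα hα' hdα (by push_cast; ring) hTτ p1 p2 p3 hκ0 r1
    hΛ0 r2 r3 hK (hB.T_le_one hRN) hKT (hB.pow_le hRd) (hB.le_pow hRd) hE0 hE hR0 hR1 hY1 hY2 hid
  refine le_of_eq_of_le ?_ key
  congr 1
  unfold complexity freeEnergy clusterSize
  rw [hd, i1, i2, i3, i5]
  rw [← hdα]
  have e : ((N + 1 : ℕ) : ℝ) * Real.log (1 - σ) = k * α * Real.log (1 - σ) := by rw [hdα]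
  linear_combination i4 - e

end Formulas

section Spacing

variable {k : ℕ} {α β : ℝ}

lemma add_le_of_mem_densities (hk : 0 < k) (hα : α ∈ densities k) (hβ : β ∈ densities k) (h : α < β) :
    α + 1 / k ≤ β := by
  obtain ⟨-, m, rfl⟩ := hα
  obtain ⟨-, n, rfl⟩ := hβ
  have hk0 : (0 : ℝ) < k := by exact_mod_cast hk
  rw [div_lt_div_iff_of_pos_right hk0, Int.cast_lt] at h
  rw [← add_div, div_le_div_iff_of_pos_right hk0]
  exact_mod_cast h

lemma finite_densities (hk : 0 < k) : (densities k).Finite := by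
  have hk0 : (0 : ℝ) < k := by exact_mod_cast hk
  refine ((Set.finite_Icc ⌈k * (((2 : ℝ) ^ (k - 1) - 2) * Real.log 2)⌉
    ⌊k * ((2 : ℝ) ^ (k - 1) * Real.log 2)⌋).image fun m : ℤ => (m : ℝ) / k).subset ?_
  rintro _ ⟨⟨h1, h2⟩, m, rfl⟩
  rw [le_div_iff₀ hk0] at h1
  rw [div_le_iff₀ hk0] at h2
  exact ⟨m, ⟨Int.ceil_le.2 (by linarith), Int.le_floor.2 (by linarith)⟩, rfl⟩

lemma shift_bounds {lam : ℝ} (hl : 0 ≤ lam) (hl1 : lam ≤ 1) : 1 / 4 ≤ shift lam ∧ shift lam ≤ 1 := by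
  have h1 : (1 : ℝ) ≤ 2 ^ lam := Real.one_le_rpow (by norm_num) hl
  have h2 : (2 : ℝ) ^ lam ≤ 2 := by
    simpa using Real.rpow_le_rpow_of_exponent_le (by norm_num : (1 : ℝ) ≤ 2) hl1
  have h3 := Real.log_two_gt_d9
  have h4 := Real.log_two_lt_d9
  have h5 : 0 ≤ lam * (2 ^ lam / 2) * Real.log 2 := by positivity
  have h6 : lam * (2 ^ lam / 2) * Real.log 2 ≤ 1 * 1 * Real.log 2 := by gcongr; linarith
  unfold shift
  constructor <;> linarith

lemma shift_one : shift 1 = Real.log 2 := by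
  simp only [shift, Real.rpow_one]
  ring

lemma shift_zero : shift 0 = Real.log 2 / 2 + 1 / 4 := by
  simp only [shift, Real.rpow_zero]
  ring

end Spacing

section SignChange

variable {k : ℕ} {lam θ ε t : ℝ} (hk : 100 ≤ k) (hθ : 0 < θ) (hε0 : 0 ≤ ε) (hε : ε ≤ 1 / (4 * k))
  (ht : t ≤ (2 : ℝ) ^ (k - 1) * Real.log 2 - 1 / 4) (ht' : (2 : ℝ) ^ (k - 1) * Real.log 2 - 1 ≤ t)
  (hF : ∀ α ∈ densities k, |complexity k lam α - θ * (t - α)| ≤ θ * ε)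

include hk hε in
lemma inv_bounds : 0 < (1 : ℝ) / k ∧ (1 : ℝ) / k ≤ 1 / 100 ∧ ε ≤ 1 / k / 4 := by
  have hk0 : (100 : ℝ) ≤ k := by exact_mod_cast hk
  refine ⟨by positivity, one_div_le_one_div_of_le (by norm_num) hk0, hε.trans (le_of_eq ?_)⟩
  rw [div_div, mul_comm]

include hF in
lemma complexity_bounds {α : ℝ} (hα : α ∈ densities k) :
    θ * (t - α - ε) ≤ complexity k lam α ∧ complexity k lam α ≤ θ * (t - α + ε) := by
  have h := abs_le.1 (hF α hα)
  constructor <;> linarith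

include hk hθ hε hF in
lemma strictAntiOn_complexity : StrictAntiOn (fun α => complexity k lam α) (densities k) := by
  intro α hα β hβ h
  have h1 := add_le_of_mem_densities (by omega) hα hβ h
  obtain ⟨h2, h3, h4⟩ := inv_bounds hk hε
  refine (complexity_bounds hF hβ).2.trans_lt (lt_of_lt_of_le ?_ (complexity_bounds hF hα).1)
  exact mul_lt_mul_of_pos_left (by linarith) hθ

include hk hθ hε0 hε ht ht' hF in
lemma existsUnique_signChange : ∃! a : ℝ, IsSignChange k lam a := by
  have hanti := strictAntiOn_complexity hk hθ hε hF
  obtain ⟨h2, h3, h4⟩ := inv_bounds hk hε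
  have hk0 : (0 : ℝ) < k := by exact_mod_cast (by omega : 0 < k)
  have hlog := Real.log_two_gt_d9
  have hne : {α ∈ densities k | 0 ≤ complexity k lam α}.Nonempty := by
    have hb1 : (⌊k * (t - ε)⌋ : ℝ) / k ≤ t - ε := by
      rw [div_le_iff₀ hk0, mul_comm]
      exact Int.floor_le _
    have hb2 : t - ε - 1 / k ≤ (⌊k * (t - ε)⌋ : ℝ) / k := by
      rw [le_div_iff₀ hk0, sub_mul, div_mul_cancel₀ _ hk0.ne']
      linarith [Int.lt_floor_add_one (k * (t - ε))]
    have hmem : (⌊k * (t - ε)⌋ : ℝ) / k ∈ densities k :=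
      ⟨⟨by linarith, by linarith⟩, _, rfl⟩
    exact ⟨_, hmem, (mul_nonneg hθ.le (by linarith)).trans (complexity_bounds hF hmem).1⟩
  obtain ⟨a, ⟨ha, ha0⟩, hmax⟩ := Set.exists_max_image _ id
    ((finite_densities (k := k) (by omega)).subset (sep_subset _ _)) hne
  refine ⟨a, ⟨ha, fun α hα h => ha0.trans (hanti.antitoneOn hα ha h), fun α hα h => ?_⟩, ?_⟩
  · by_contra hc
    exact absurd (hmax α ⟨hα, not_lt.1 hc⟩) (not_le.2 h)
  · rintro b ⟨hb, hb1, hb2⟩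
    rcases lt_trichotomy a b with h | h | h
    · exact absurd (hmax b ⟨hb, hb1 b hb le_rfl⟩) (not_le.2 h)
    · exact h.symm
    · exact absurd ha0 (not_le.2 (hb2 a ha h))

include hk hθ hε ht ht' hF in
/-- The location of the sign change, and of the supremum of the densities of positive complexity. -/
lemma IsSignChange.threshold {a : ℝ} (ha : IsSignChange k lam a) :
    (complexity k lam a ≠ 0 → sSup {α ∈ densities k | 0 < complexity k lam α} = a) ∧
    (complexity k lam a = 0 → sSup {α ∈ densities k | 0 < complexity k lam α} = a - 1 / k) ∧
    (t - 1 / k - ε ≤ a ∧ a ≤ t + ε) ∧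
    (t - 1 / k - ε ≤ sSup {α ∈ densities k | 0 < complexity k lam α} ∧
      sSup {α ∈ densities k | 0 < complexity k lam α} ≤ t + ε) := by
  have hanti := strictAntiOn_complexity hk hθ hε hF
  obtain ⟨h2, h3, h4⟩ := inv_bounds hk hε
  have hk0 : (0 : ℝ) < k := by exact_mod_cast (by omega : 0 < k)
  have hlog := Real.log_two_gt_d9
  obtain ⟨hmem, hle, hgt⟩ := ha
  have ha0 := hle a hmem le_rfl
  obtain ⟨⟨hm1, hm2⟩, m, hm⟩ := id hmem
  have hup : a ≤ t + ε := by
    have := ha0.trans (complexity_bounds hF hmem).2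
    linarith [nonneg_of_mul_nonneg_right this hθ]
  have hlow : t - 1 / k - ε ≤ a := by
    have hmem' : a + 1 / k ∈ densities k :=
      ⟨⟨by linarith, by linarith⟩, m + 1, by rw [hm]; push_cast; ring⟩
    have := (complexity_bounds hF hmem').1.trans_lt (hgt _ hmem' (by linarith))
    by_contra hc
    exact absurd this (not_lt.2 (mul_nonneg hθ.le (by linarith)))
  have hpos (h : complexity k lam a ≠ 0) : sSup {α ∈ densities k | 0 < complexity k lam α} = a := by
    refine IsGreatest.csSup_eq ⟨⟨hmem, lt_of_le_of_ne ha0 h.symm⟩, ?_⟩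
    rintro α ⟨hα, hα0⟩
    by_contra hc
    exact absurd hα0 (not_lt.2 (hgt α hα (not_le.1 hc)).le)
  have hzl (h : complexity k lam a = 0) : t - ε ≤ a := by
    have := (complexity_bounds hF hmem).1
    rw [h] at this
    by_contra hc
    exact absurd this (not_le.2 (mul_pos hθ (by linarith)))
  have hzero (h : complexity k lam a = 0) :
      sSup {α ∈ densities k | 0 < complexity k lam α} = a - 1 / k := by
    have hal := hzl h
    have hmem' : a - 1 / k ∈ densities k :=
      ⟨⟨by linarith, by linarith⟩, m - 1, by rw [hm]; push_cast; ring⟩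
    refine IsGreatest.csSup_eq ⟨⟨hmem', ?_⟩, ?_⟩
    · have := hanti hmem' hmem (by linarith : a - 1 / k < a)
      simp only [h] at this
      exact this
    · rintro α ⟨hα, hα0⟩
      have : α < a := by
        by_contra hc
        have := hanti.antitoneOn hmem hα (not_lt.1 hc)
        simp only [h] at this
        exact absurd hα0 (not_lt.2 this)
      linarith [add_le_of_mem_densities (by omega) hα hmem this]
  refine ⟨hpos, hzero, ⟨hlow, hup⟩, ?_⟩
  by_cases h : complexity k lam a = 0
  · rw [hzero h]
    have := hzl h
    constructor <;> linarith
  · rw [hpos h]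
    exact ⟨hlow, hup⟩

end SignChange

section Densities

variable {k : ℕ}

lemma exists_large : ∃ k₀ : ℕ, ∀ k : ℕ, k₀ ≤ k → 100 ≤ k ∧ (k : ℝ) ^ 12 * (1 / 2) ^ (k - 1) ≤ 1 := by
  have h := tendsto_pow_const_mul_const_pow_of_lt_one 12 (by norm_num : (0 : ℝ) ≤ 1 / 2) (by norm_num)
  obtain ⟨k₀, hk₀⟩ := Filter.eventually_atTop.1
    ((h.eventually_le_const (by norm_num : (0 : ℝ) < 1 / 2)).and (eventually_ge_atTop 100))
  refine ⟨k₀, fun k hk => ⟨(hk₀ k hk).2, ?_⟩⟩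
  obtain ⟨h1, h2⟩ := hk₀ k hk
  obtain ⟨n, rfl⟩ : ∃ n, k = n + 1 := ⟨k - 1, by omega⟩
  rw [pow_succ (1 / 2 : ℝ)] at h1
  rw [Nat.add_sub_cancel]
  linarith

lemma densities_regime (hk : 100 ≤ k) (hs : (k : ℝ) ^ 12 * (1 / 2) ^ (k - 1) ≤ 1) {α : ℝ}
    (hα : α ∈ densities k) :
    0 ≤ α ∧ (deg k α : ℝ) = k * α ∧ α * (1 / 2) ^ (k - 1) ≤ Real.log 2 ∧
      Real.log 2 - 4 * (1 / 2) ^ (k - 1) ≤ α * (1 / 2) ^ (k - 1) ∧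
      Regime k (deg k α) ((1 / 2) ^ (k - 1)) ∧ Regime k (deg k α - 1) ((1 / 2) ^ (k - 1)) := by
  have hk0 : (100 : ℝ) ≤ k := by exact_mod_cast hk
  have hlog := Real.log_two_gt_d9
  have hlog' := Real.log_two_lt_d9
  obtain ⟨⟨h1, h2⟩, m, hm⟩ := hα
  have h3 : (2 : ℝ) ^ (k - 1) * (1 / 2) ^ (k - 1) = 1 := by rw [← mul_pow]; norm_num
  have h4 : (4 : ℝ) ≤ 2 ^ (k - 1) := by
    calc (4 : ℝ) = 2 ^ 2 := by norm_num
      _ ≤ 2 ^ (k - 1) := pow_le_pow_right₀ (by norm_num) (by omega)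
  have hα1 : 1 ≤ α := by nlinarith
  have hd : (deg k α : ℝ) = k * α := by
    have hkm : (k : ℝ) * α = m := by rw [hm]; field_simp
    have hm0 : 0 ≤ m := by
      have : (0 : ℝ) ≤ m := by rw [← hkm]; positivity
      exact_mod_cast this
    unfold deg
    rw [hkm, ← Int.cast_natCast, Int.natCast_floor_eq_floor (by exact_mod_cast hm0), Int.floor_intCast]
  have hd1 : 1 ≤ deg k α := by
    have : (1 : ℝ) ≤ deg k α := by rw [hd]; nlinarith
    exact_mod_cast this
  have hθ : (0 : ℝ) < (1 / 2) ^ (k - 1) := by positivity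
  obtain ⟨θ, hθe⟩ : ∃ θ : ℝ, θ = (1 / 2) ^ (k - 1) := ⟨_, rfl⟩
  rw [← hθe] at hs h3 hθ ⊢
  have e1 : α * θ ≤ Real.log 2 := by
    calc α * θ ≤ 2 ^ (k - 1) * Real.log 2 * θ := mul_le_mul_of_nonneg_right h2 hθ.le
      _ = 2 ^ (k - 1) * θ * Real.log 2 := by ring
      _ = Real.log 2 := by rw [h3, one_mul]
  have e2 : Real.log 2 - 2 * θ ≤ α * θ := by
    calc Real.log 2 - 2 * θ ≤ Real.log 2 - 2 * θ * Real.log 2 := by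
          have : 2 * θ * Real.log 2 ≤ 2 * θ * 1 := by gcongr; linarith
          linarith
      _ = 2 ^ (k - 1) * θ * Real.log 2 - 2 * θ * Real.log 2 := by rw [h3, one_mul]
      _ = (2 ^ (k - 1) - 2) * Real.log 2 * θ := by ring
      _ ≤ α * θ := mul_le_mul_of_nonneg_right h1 hθ.le
  have e3 : (k : ℝ) * (α * θ) ≤ k * Real.log 2 := mul_le_mul_of_nonneg_left e1 (by linarith)
  have e4 : (k : ℝ) * (Real.log 2 - 2 * θ) ≤ k * (α * θ) := mul_le_mul_of_nonneg_left e2 (by linarith)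
  have e5 : 1 * θ ≤ k * θ := mul_le_mul_of_nonneg_right (by linarith) hθ.le
  refine ⟨by linarith, hd, e1, by linarith, ⟨hθe, hk, hs, ?_, ?_⟩, ⟨hθe, hk, hs, ?_, ?_⟩⟩ <;>
    simp only [Nat.cast_sub hd1, hd, Nat.cast_one] <;> linarith

/-- The expansion of the complexity to first order. -/
lemma complexity_expansion (hk : 100 ≤ k) (hs : (k : ℝ) ^ 12 * (1 / 2) ^ (k - 1) ≤ 1) {lam : ℝ}
    (hl : 0 ≤ lam) (hl1 : lam ≤ 1) {α : ℝ} (hα : α ∈ densities k) :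
    WellDefined k (deg k α) lam ∧
      |complexity k lam α - (1 / 2) ^ (k - 1) * (2 ^ (k - 1) * Real.log 2 - shift lam - α)|
        ≤ (1 / 2) ^ (k - 1) * (k ^ 6 * (1 / 2) ^ (k - 1)) := by
  obtain ⟨h0, hd, h1, h2, hR, hR'⟩ := densities_regime hk hs hα
  obtain ⟨hW, h⟩ := wellDefined_and_complexity hR' hl hl1 rfl hd h0 h1 h2 hR
  refine ⟨hW, ?_⟩
  have h3 : (1 / 2 : ℝ) ^ (k - 1) * 2 ^ (k - 1) = 1 := by rw [← mul_pow]; norm_num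
  convert h using 1
  · congr 1
    linear_combination -Real.log 2 * h3
  · ring

lemma error_bounds (hk : 100 ≤ k) (hs : (k : ℝ) ^ 12 * (1 / 2) ^ (k - 1) ≤ 1) :
    (k : ℝ) ^ 6 * (1 / 2) ^ (k - 1) ≤ 1 / (4 * k) ∧
      (k : ℝ) ^ 6 * (1 / 2) ^ (k - 1) ≤ (k : ℝ) ^ 7 / 2 ^ k := by
  have hk0 : (100 : ℝ) ≤ k := by exact_mod_cast hk
  constructor
  · rw [le_div_iff₀ (by positivity)]
    refine le_trans ?_ hs
    calc (k : ℝ) ^ 6 * (1 / 2) ^ (k - 1) * (4 * k) = (k : ℝ) ^ 7 * 4 * (1 / 2) ^ (k - 1) := by ring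
      _ ≤ (k : ℝ) ^ 7 * k ^ 5 * (1 / 2) ^ (k - 1) := by
        gcongr
        calc (4 : ℝ) ≤ k := by linarith
          _ ≤ (k : ℝ) ^ 5 := le_self_pow₀ (by linarith) (by norm_num)
      _ = (k : ℝ) ^ 12 * (1 / 2) ^ (k - 1) := by ring
  · obtain ⟨n, rfl⟩ : ∃ n, k = n + 1 := ⟨k - 1, by omega⟩
    rw [Nat.add_sub_cancel, one_div, inv_pow, ← div_eq_mul_inv, div_le_div_iff₀ (by positivity)
      (by positivity), pow_succ (2 : ℝ), pow_succ _ 6]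
    have : ((n + 1 : ℕ) : ℝ) ^ 6 * 2 ^ n * 2 ≤ (n + 1 : ℕ) ^ 6 * 2 ^ n * (n + 1 : ℕ) := by
      gcongr
      linarith
    linarith

lemma IsSignChange.roundsDownTo (hk : 100 ≤ k) (hs : (k : ℝ) ^ 12 * (1 / 2) ^ (k - 1) ≤ 1) {lam : ℝ}
    (hl : 0 ≤ lam) (hl1 : lam ≤ 1) {a : ℝ} (ha : IsSignChange k lam a) :
    (complexity k lam a ≠ 0 → sSup {α ∈ densities k | 0 < complexity k lam α} = a) ∧
    (complexity k lam a = 0 → sSup {α ∈ densities k | 0 < complexity k lam α} = a - 1 / k) ∧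
    RoundsDownTo k 7 (2 ^ (k - 1) * Real.log 2 - shift lam) a ∧
    RoundsDownTo k 7 (2 ^ (k - 1) * Real.log 2 - shift lam)
      (sSup {α ∈ densities k | 0 < complexity k lam α}) := by
  obtain ⟨h1, h2⟩ := error_bounds hk hs
  obtain ⟨h3, h4⟩ := shift_bounds hl hl1
  obtain ⟨i1, i2, ⟨i3, i4⟩, i5, i6⟩ := ha.threshold (t := 2 ^ (k - 1) * Real.log 2 - shift lam) hk
    (by positivity : (0 : ℝ) < (1 / 2) ^ (k - 1)) h1
    (by linarith) (by linarith) fun α hα => (complexity_expansion hk hs hl hl1 hα).2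
  exact ⟨i1, i2, ⟨by linarith, by linarith⟩, ⟨by linarith, by linarith⟩⟩

end Densities

end NAESat

theorem propositionp :
    ∃ k₀ C : ℕ, ∀ k : ℕ, k₀ ≤ k →
      (∀ lam ∈ Set.Icc (0 : ℝ) 1,
        (∀ α ∈ NAESat.densities k, NAESat.WellDefined k (NAESat.deg k α) lam) ∧
        StrictAntiOn (fun α => NAESat.complexity k lam α) (NAESat.densities k) ∧
        ∃! a : ℝ, NAESat.IsSignChange k lam a) ∧
      (∀ a : ℝ, NAESat.IsSignChange k 1 a →
        (NAESat.complexity k 1 a ≠ 0 → NAESat.alphaCond k = a) ∧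
        (NAESat.complexity k 1 a = 0 → NAESat.alphaCond k = a - 1 / k) ∧
        NAESat.RoundsDownTo k C (((2 : ℝ) ^ (k - 1) - 1) * Real.log 2) a ∧
        NAESat.RoundsDownTo k C (((2 : ℝ) ^ (k - 1) - 1) * Real.log 2) (NAESat.alphaCond k)) ∧
      (∀ a : ℝ, NAESat.IsSignChange k 0 a →
        (NAESat.complexity k 0 a ≠ 0 → NAESat.alphaSat k = a) ∧
        (NAESat.complexity k 0 a = 0 → NAESat.alphaSat k = a - 1 / k) ∧
        NAESat.RoundsDownTo k C
          (((2 : ℝ) ^ (k - 1) - 1 / 2 - 1 / (4 * Real.log 2)) * Real.log 2) a ∧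
        NAESat.RoundsDownTo k C
          (((2 : ℝ) ^ (k - 1) - 1 / 2 - 1 / (4 * Real.log 2)) * Real.log 2)
          (NAESat.alphaSat k)) := by
  obtain ⟨k₀, hk₀⟩ := NAESat.exists_large
  refine ⟨k₀, 7, fun k hk => ?_⟩
  obtain ⟨hk, hs⟩ := hk₀ k hk
  refine ⟨fun lam ⟨hl, hl1⟩ => ?_, fun a ha => ?_, fun a ha => ?_⟩
  · obtain ⟨h1, -⟩ := NAESat.error_bounds hk hs
    obtain ⟨h3, h4⟩ := NAESat.shift_bounds hl hl1
    have hF := fun α hα => (NAESat.complexity_expansion hk hs hl hl1 (α := α) hα).2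
    have hθ : (0 : ℝ) < (1 / 2) ^ (k - 1) := by positivity
    exact ⟨fun α hα => (NAESat.complexity_expansion hk hs hl hl1 hα).1,
      NAESat.strictAntiOn_complexity hk hθ h1 hF,
      NAESat.existsUnique_signChange hk hθ (by positivity) h1 (by linarith) (by linarith) hF⟩
  · have h := ha.roundsDownTo hk hs zero_le_one le_rfl
    rwa [NAESat.shift_one, show (2 : ℝ) ^ (k - 1) * Real.log 2 - Real.log 2
      = (2 ^ (k - 1) - 1) * Real.log 2 by ring] at h
  · have h := ha.roundsDownTo hk hs le_rfl zero_le_one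
    have hlog : Real.log 2 ≠ 0 := (Real.log_pos one_lt_two).ne'
    rwa [NAESat.shift_zero, show (2 : ℝ) ^ (k - 1) * Real.log 2 - (Real.log 2 / 2 + 1 / 4)
      = (2 ^ (k - 1) - 1 / 2 - 1 / (4 * Real.log 2)) * Real.log 2 by field_simp; ring] at h
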